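/- Let $\tau,\eta\in\mathbb C$ with $\operatorname{Im}\tau>0$, $\operatorname{Im}\eta>0$, and put $p=e^{2\pi i\tau}$, $q=e^{4\pi i\eta}$, $\sqrt{pq}=e^{\pi i(\tau+2\eta)}$, $(a;p)_\infty=\prod_{j\ge0}(1-ap^j)$ and $\Gamma(z)=\prod_{j,k\ge0}\frac{1-z^{-1}p^{j+1}q^{k+1}}{1-zp^jq^k}$ (the elliptic gamma function), with the conventions $\Gamma(a,b)=\Gamma(a)\Gamma(b)$, $\Gamma(z^{\pm2})=\Gamma(z^2)\Gamma(z^{-2})$, $\Gamma(tx^{\pm1}y^{\pm1})=\Gamma(txy)\Gamma(txy^{-1})\Gamma(tx^{-1}y)\Gamma(tx^{-1}y^{-1})$. Let $$D(s;x,y)=\Gamma(\sqrt{pq}\,s^{-1}x^{\pm1}y^{\pm1}),\qquad (M(t)\alpha)(w)=\frac{(p;p)_\infty(q;q)_\infty}{4\pi i}\int_{\mathbb T}\frac{\Gamma(tw^{\pm1}x^{\pm1})}{\Gamma(t^2,x^{\pm2})}\,\alpha(x)\frac{dx}{x},$$ where $\mathbb T$ is the unit circle. For $\mathbf u=(u_1,u_2,v_1,v_2)\in\mathbb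 C^4$ let $s_1\mathbf u=(u_2,u_1,v_1,v_2)$, $s_2\mathbf u=(u_1,v_1,u_2,v_2)$, $s_3\mathbf u=(u_1,u_2,v_2,v_1)$. The operators below act on the functions of $n$ real variables of the form $\Phi(z)=e^{-\pi i\sum_k z_k^2/\eta}f(e^{2\pi iz_1},\dots,e^{2\pi iz_n})$ with $f$ continuous on $\mathbb T^n$; we write $\Phi=Ef$. Let $$[\mathrm S_2(\mathbf u)\Phi](z_1,z_2)=D(e^{2\pi i(v_1-u_2)};e^{2\pi iz_1},e^{2\pi iz_2})\,\Phi(z_1,z_2),$$ $$[\mathrm S_1(\mathbf u)\Phi](z_1,z_2)=e^{-\pi iz_1^2/\eta}\big(M(e^{2\pi i(u_2-u_1)})\,[\,e^{2\pi iz}\mapsto e^{\pi iz^2/\eta}\Phi(z,z_2)\,]\big)(e^{2\pi iz_1}),$$ and let $\mathrm S_3(\mathbf u)$ be the same operator as $\mathrm S_1$, acting on the variable $z_2$ and with $u_2-u_1$ replaced by $v_2-v_1$. Let $$\mathrm R_{12}(\mathbf u)=\mathrm S_2(s_1s_3s_2\mathbf u)\,\mathrm S_1(s_3s_2\mathbf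 u)\,\mathrm S_3(s_2\mathbf u)\,\mathrm S_2(\mathbf u),\qquad \mathbb R_{12}(\mathbf u)=\mathbb P_{12}\mathrm R_{12}(\mathbf u),$$ where $\mathbb P_{12}$ exchanges $z_1$ and $z_2$; for $i\ne j$, $\mathbb R_{ij}(\mathbf u)$ is the same operator acting on the variables $z_i,z_j$ of a function of $n$ variables. Call $\mathbf u$ admissible if $$|e^{2\pi i(v_1-u_1)}|<1,\quad |e^{2\pi i(v_2-u_2)}|<1,\quad |\sqrt{pq}|<|e^{2\pi i(v_1-u_2)}|,\quad |\sqrt{pq}|<|e^{2\pi i(v_2-u_1)}|,$$ $$\Gamma(e^{4\pi i(v_1-u_1)})\ne0,\quad\Gamma(e^{4\pi i(v_2-u_2)})\neq0.$$ (1) (Yang–Baxter equation.) For $u,\ell,\ell'\in\mathbb C$ let $\mathbb R_{ij}(u)$ be $\mathbb R_{ij}(\mathbf u)$ with $\mathbf u=\big(\tfrac u2+\eta(\ell+\tfrac12),\tfrac u2-\eta(\ell+\tfrac12),\eta(\ell'+\tfrac12),-\eta(\ell'+\tfrac12)\big)$, where $\ell$ is the spin attached to the site $i$ and $\ell'$ is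 the spin attached to the site $j$. Let spins $\ell_1,\ell_2,\ell_3\in\mathbb C$ be attached to the sites $1,2,3$, and let $u,v\in\mathbb C$ be such that the parameter vectors of $\mathbb R_{12}(u-v)$, $\mathbb R_{13}(u)$, $\mathbb R_{23}(v)$ are admissible. Then, on the functions $\Phi=Ef$ of three variables, $$\mathbb R_{12}(u-v)\,\mathbb R_{13}(u)\,\mathbb R_{23}(v)=\mathbb R_{23}(v)\,\mathbb R_{13}(u)\,\mathbb R_{12}(u-v).$$ The same equation holds on the continuous functions on $\mathbb T^3$ for the double integral operators $\mathcal R_{ij}$ of (2). (2) (Explicit form.) If $\mathbf u$ is admissible, then $\mathbb R_{12}(\mathbf u)Ef=E\,\mathcal R_{12}(\mathbf u)f$ for all continuous $f$, where $\mathcal R_{12}(\mathbf u)$ is the double integral operator $$[\mathcal R_{12}(\mathbf u)f](x_1,x_2)=\frac{(p;p)_\infty^2(q;q)_\infty^2}{(4\pi i)^2}\,\Gamma(\sqrt{pq}\,e^{2\pi i(u_1-v_2)}x_1^{\pm1}x_2^{\pm1})$$ $$\times\int_{\mathbb T^2}\frac{\Gamma(e^{2\pi i(v_1-u_1)}x_2^{\pm1}x^{\pm1},\;e^{2\pi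 i(v_2-u_2)}x_1^{\pm1}y^{\pm1})}{\Gamma(e^{4\pi i(v_1-u_1)},\,e^{4\pi i(v_2-u_2)},\,x^{\pm2},\,y^{\pm2})}\,\Gamma(\sqrt{pq}\,e^{2\pi i(u_2-v_1)}x^{\pm1}y^{\pm1})\,f(x,y)\,\frac{dx}{x}\frac{dy}{y};$$ the integrand is integrable for $x_1,x_2\in\mathbb T$, and $\mathcal R_{12}(\mathbf u)f$ is continuous on $\mathbb T^2$. The same holds for $\mathbb R_{ij}$ and $\mathcal R_{ij}$ acting on two of $n$ variables. (3) (Cubic Coxeter relations.) On the functions $\Phi=Ef$ of two variables, $$\mathrm S_1(s_2s_1\mathbf u)\,\mathrm S_2(s_1\mathbf u)\,\mathrm S_1(\mathbf u)=\mathrm S_2(s_1s_2\mathbf u)\,\mathrm S_1(s_2\mathbf u)\,\mathrm S_2(\mathbf u)$$ if $|e^{2\pi i(u_2-u_1)}|<1$, $|e^{2\pi i(v_1-u_2)}|<1$ and $|\sqrt{pq}|<|e^{2\pi i(v_1-u_1)}|$, and $$\mathrm S_2(s_3s_2\mathbf u)\,\mathrm S_3(s_2\mathbf u)\,\mathrm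 S_2(\mathbf u)=\mathrm S_3(s_2s_3\mathbf u)\,\mathrm S_2(s_3\mathbf u)\,\mathrm S_3(\mathbf u)$$ if $|e^{2\pi i(v_1-u_2)}|<1$, $|e^{2\pi i(v_2-v_1)}|<1$ and $|\sqrt{pq}|<|e^{2\pi i(v_2-u_2)}|$. -/

import Mathlib

namespace EllipticYB

noncomputable section

open Complex

/-! ### Elliptic gamma function -/

/-- `(a; p)_∞ = ∏_{j ≥ 0} (1 - a p^j)`. -/
def qPoch (a p : ℂ) : ℂ := ∏' j : ℕ, (1 - a * p ^ j)

/-- The elliptic gamma function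
`Γ(z; p, q) = ∏_{j, k ≥ 0} (1 - z⁻¹ p^(j+1) q^(k+1)) / (1 - z p^j q^k)`.
At a pole the value is `0`, so that `1 / Γ` has its correct value `0` there. -/
def ellGamma (p q z : ℂ) : ℂ :=
  ∏' n : ℕ × ℕ, (1 - z⁻¹ * p ^ (n.1 + 1) * q ^ (n.2 + 1)) / (1 - z * p ^ n.1 * q ^ n.2)

/-- `Γ(z^{±2}; p, q) = Γ(z²; p, q) Γ(z⁻²; p, q)`. -/
def gammaSq (p q z : ℂ) : ℂ := ellGamma p q (z ^ 2) * ellGamma p q ((z ^ 2)⁻¹)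

/-- `Γ(t x^{±1} y^{±1}; p, q)`, a product of four elliptic gamma functions. -/
def gammaPM (p q t x y : ℂ) : ℂ :=
  ellGamma p q (t * x * y) * ellGamma p q (t * x * y⁻¹) *
    ellGamma p q (t * x⁻¹ * y) * ellGamma p q (t * x⁻¹ * y⁻¹)

/-! ### Bases and exponentials -/

/-- `e^{2πi z}`. -/
def ee (z : ℂ) : ℂ := exp (2 * Real.pi * I * z)

/-- `p = e^{2πiτ}`. -/
def pp (τ : ℂ) : ℂ := exp (2 * Real.pi * I * τ)

/-- `q = e^{4πiη}`. -/
def qq (η : ℂ) : ℂ := exp (4 * Real.pi * I * η)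

/-- `√(pq) = e^{πi(τ + 2η)}`. -/
def sqrtpq (τ η : ℂ) : ℂ := exp (Real.pi * I * (τ + 2 * η))

/-! ### The entries of the Bailey lemma -/

/-- `D(s; x, y) = Γ(√(pq) s⁻¹ x^{±1} y^{±1}; p, q)`. -/
def baileyD (τ η s x y : ℂ) : ℂ := gammaPM (pp τ) (qq η) (sqrtpq τ η * s⁻¹) x y

/-- The integral operator `M(t)_{wx}`, evaluated at `w`:
`(p;p)_∞ (q;q)_∞ / (4πi) ∫_𝕋 Γ(t w^{±1} x^{±1}) / (Γ(t²) Γ(x^{±2})) α dx/x`.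
The unit circle is parametrised by `x = e^{2πi z}`, `0 ≤ z ≤ 1`, so `dx/x = 2πi dz`, and `α` is
given as a function of `z`. -/
def baileyM (τ η t : ℂ) (α : ℝ → ℂ) (w : ℂ) : ℂ :=
  qPoch (pp τ) (pp τ) * qPoch (qq η) (qq η) / (4 * Real.pi * I) *
    ∫ z in (0 : ℝ)..1,
      gammaPM (pp τ) (qq η) t w (ee z) /
        (ellGamma (pp τ) (qq η) (t ^ 2) * gammaSq (pp τ) (qq η) (ee z)) * α z *
        (2 * Real.pi * I)

/-! ### The operators `S_j`, `R` and `ℝ`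

They act on functions of `n` variables `z_k`; the sites `i`, `j` are the variables that are called
`z_1`, `z_2` in a two-variable formula, and all the other variables are spectators.
A parameter vector `U = (U 0, U 1, U 2, U 3)` stands for `(u_1, u_2, v_1, v_2)`. -/

/-- The elementary permutation `s_1 (u_1, u_2, v_1, v_2) = (u_2, u_1, v_1, v_2)`. -/
def s₁ (U : Fin 4 → ℂ) : Fin 4 → ℂ := ![U 1, U 0, U 2, U 3]

/-- The elementary permutation `s_2 (u_1, u_2, v_1, v_2) = (u_1, v_1, u_2, v_2)`. -/
def s₂ (U : Fin 4 → ℂ) : Fin 4 → ℂ := ![U 0, U 2, U 1, U 3]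

/-- The elementary permutation `s_3 (u_1, u_2, v_1, v_2) = (u_1, u_2, v_2, v_1)`. -/
def s₃ (U : Fin 4 → ℂ) : Fin 4 → ℂ := ![U 0, U 1, U 3, U 2]

variable {n : ℕ}

/-- The operator `e^{-πi z_i²/η} M(t)_{e^{2πi z_i}, e^{2πi z}} e^{πi z²/η}` in the variable `z_i`. -/
def opM (τ η t : ℂ) (i : Fin n) (Φ : (Fin n → ℝ) → ℂ) (z : Fin n → ℝ) : ℂ :=
  exp (-(Real.pi * I * (z i : ℂ) ^ 2 / η)) *
    baileyM τ η t
      (fun y => exp (Real.pi * I * (y : ℂ) ^ 2 / η) * Φ (Function.update z i y)) (ee (z i))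

/-- `S_1(U)`: the integral operator in `z_i` with `t = e^{2πi(u_2 - u_1)}`. -/
def S₁ (τ η : ℂ) (i : Fin n) (U : Fin 4 → ℂ) (Φ : (Fin n → ℝ) → ℂ) : (Fin n → ℝ) → ℂ :=
  opM τ η (ee (U 1 - U 0)) i Φ

/-- `S_2(U)`: multiplication by `D(e^{2πi(v_1 - u_2)}; e^{2πi z_i}, e^{2πi z_j})`. -/
def S₂ (τ η : ℂ) (i j : Fin n) (U : Fin 4 → ℂ) (Φ : (Fin n → ℝ) → ℂ) : (Fin n → ℝ) → ℂ :=
  fun z => baileyD τ η (ee (U 2 - U 1)) (ee (z i)) (ee (z j)) * Φ z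

/-- `S_3(U)`: the integral operator in `z_j` with `t = e^{2πi(v_2 - v_1)}`. -/
def S₃ (τ η : ℂ) (j : Fin n) (U : Fin 4 → ℂ) (Φ : (Fin n → ℝ) → ℂ) : (Fin n → ℝ) → ℂ :=
  opM τ η (ee (U 3 - U 2)) j Φ

/-- `R_{ij}(U) = S_2(s_1 s_3 s_2 U) S_1(s_3 s_2 U) S_3(s_2 U) S_2(U)`. -/
def opR (τ η : ℂ) (i j : Fin n) (U : Fin 4 → ℂ) (Φ : (Fin n → ℝ) → ℂ) : (Fin n → ℝ) → ℂ :=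
  S₂ τ η i j (s₁ (s₃ (s₂ U))) (S₁ τ η i (s₃ (s₂ U)) (S₃ τ η j (s₂ U) (S₂ τ η i j U Φ)))

/-- The permutation operator `ℙ_{ij}`, which exchanges the variables `z_i` and `z_j`. -/
def opP (i j : Fin n) (Φ : (Fin n → ℝ) → ℂ) : (Fin n → ℝ) → ℂ :=
  fun z => Φ (fun k => z (Equiv.swap i j k))

/-- `ℝ_{ij}(U) = ℙ_{ij} R_{ij}(U)`. -/
def bbR (τ η : ℂ) (i j : Fin n) (U : Fin 4 → ℂ) (Φ : (Fin n → ℝ) → ℂ) : (Fin n → ℝ) → ℂ :=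
  opP i j (opR τ η i j U Φ)

/-! ### Spectral parameter and spins -/

/-- `(u_1, u_2, v_1, v_2)` for the spectral parameters `u`, `v` and the spins `ℓ₁`, `ℓ₂`:
`u_{1,2} = u/2 ± η(ℓ₁ + 1/2)`, `v_{1,2} = v/2 ± η(ℓ₂ + 1/2)`. -/
def params (η ℓ₁ ℓ₂ u v : ℂ) : Fin 4 → ℂ :=
  ![u / 2 + η * (ℓ₁ + 1 / 2), u / 2 - η * (ℓ₁ + 1 / 2),
    v / 2 + η * (ℓ₂ + 1 / 2), v / 2 - η * (ℓ₂ + 1 / 2)]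

/-- The operator `ℝ_{ij}(u)` for spins `ℓ₁` at site `i` and `ℓ₂` at site `j`. -/
def bbRspec (τ η ℓ₁ ℓ₂ : ℂ) (i j : Fin n) (u : ℂ) (Φ : (Fin n → ℝ) → ℂ) : (Fin n → ℝ) → ℂ :=
  bbR τ η i j (params η ℓ₁ ℓ₂ u 0) Φ

/-- The operator `ℝ_{ij}(u_1, u_2, v_1, v_2)` depends on `u`, `v` through `u - v` only. -/
theorem bbR_params (τ η ℓ₁ ℓ₂ u v : ℂ) (i j : Fin n) (Φ : (Fin n → ℝ) → ℂ) :
    bbR τ η i j (params η ℓ₁ ℓ₂ u v) Φ = bbRspec τ η ℓ₁ ℓ₂ i j (u - v) Φ := by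
  have h1 : v / 2 + η * (ℓ₂ + 1 / 2) - (u / 2 - η * (ℓ₁ + 1 / 2)) =
      0 / 2 + η * (ℓ₂ + 1 / 2) - ((u - v) / 2 - η * (ℓ₁ + 1 / 2)) := by ring
  have h2 : v / 2 + η * (ℓ₂ + 1 / 2) - (u / 2 + η * (ℓ₁ + 1 / 2)) =
      0 / 2 + η * (ℓ₂ + 1 / 2) - ((u - v) / 2 + η * (ℓ₁ + 1 / 2)) := by ring
  have h3 : v / 2 - η * (ℓ₂ + 1 / 2) - (u / 2 - η * (ℓ₁ + 1 / 2)) =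
      0 / 2 - η * (ℓ₂ + 1 / 2) - ((u - v) / 2 - η * (ℓ₁ + 1 / 2)) := by ring
  have h4 : v / 2 - η * (ℓ₂ + 1 / 2) - (u / 2 + η * (ℓ₁ + 1 / 2)) =
      0 / 2 - η * (ℓ₂ + 1 / 2) - ((u - v) / 2 + η * (ℓ₁ + 1 / 2)) := by ring
  unfold bbRspec bbR opR S₁ S₂ S₃
  simp [s₁, s₂, s₃, params] at h1 h2 h3 h4 ⊢
  rw [h1, h2, h3, h4]

/-- The constraints under which the unit circle is the integration contour in `ℝ(U)`. The
parameter `t` of each of the two `M`-operators satisfies `|t| < 1`; the parameter `s` of each of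
the two `D`-factors satisfies `|√(pq) s⁻¹| < 1`; so, for variables on the unit circle, the poles of
`Γ(t x^{±1} y^{±1})` in each variable are separated by that circle. The normalising factors
`Γ(t²)`, by which the `M`-operators are divided, do not vanish. -/
structure Admissible (τ η : ℂ) (U : Fin 4 → ℂ) : Prop where
  norm_M₁ : ‖ee (U 2 - U 0)‖ < 1
  norm_M₂ : ‖ee (U 3 - U 1)‖ < 1
  norm_D₁ : ‖sqrtpq τ η‖ < ‖ee (U 2 - U 1)‖
  norm_D₂ : ‖sqrtpq τ η‖ < ‖ee (U 3 - U 0)‖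
  gamma_M₁ : ellGamma (pp τ) (qq η) (ee (U 2 - U 0) ^ 2) ≠ 0
  gamma_M₂ : ellGamma (pp τ) (qq η) (ee (U 3 - U 1) ^ 2) ≠ 0

/-! ### Function spaces -/

/-- The torus `𝕋^n`. -/
def torus (n : ℕ) : Set (Fin n → ℂ) := {x | ∀ k, ‖x k‖ = 1}

/-- The function `Φ(z) = e^{-πi(z_1² + ⋯ + z_n²)/η} f(e^{2πi z_1}, …, e^{2πi z_n})`. -/
def gauge (η : ℂ) (f : (Fin n → ℂ) → ℂ) : (Fin n → ℝ) → ℂ :=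
  fun z => exp (-(Real.pi * I * (∑ k, (z k : ℂ) ^ 2) / η)) * f (fun k => ee (z k))

/-- The space on which the operators act: the functions `gauge η f`, where `f` is continuous on
the torus. -/
def space (η : ℂ) (n : ℕ) : Set ((Fin n → ℝ) → ℂ) :=
  {Φ | ∃ f : (Fin n → ℂ) → ℂ, ContinuousOn f (torus n) ∧ Φ = gauge η f}

/-! ### The explicit double integral operator -/

/-- The integrand (with respect to `dx dy`, `x = w 0`, `y = w 1`) of the double integral, the
variables `x_i`, `x_j` being those that are called `x_1`, `x_2` in the two-variable formula. -/
def ellIntegrand (τ η : ℂ) (i j : Fin n) (U : Fin 4 → ℂ) (f : (Fin n → ℂ) → ℂ) (X : Fin n → ℂ)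
    (w : Fin 2 → ℂ) : ℂ :=
  gammaPM (pp τ) (qq η) (ee (U 2 - U 0)) (X j) (w 0) *
      gammaPM (pp τ) (qq η) (ee (U 3 - U 1)) (X i) (w 1) /
    (ellGamma (pp τ) (qq η) (ee (2 * (U 2 - U 0))) *
      ellGamma (pp τ) (qq η) (ee (2 * (U 3 - U 1))) *
      gammaSq (pp τ) (qq η) (w 0) * gammaSq (pp τ) (qq η) (w 1)) *
    gammaPM (pp τ) (qq η) (sqrtpq τ η * ee (U 1 - U 2)) (w 0) (w 1) *
    f (Function.update (Function.update X i (w 0)) j (w 1)) / (w 0 * w 1)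

/-- The double integral operator with elliptic hypergeometric kernel, in the variables
`x_k = e^{2πi z_k}`. -/
def ellR (τ η : ℂ) (i j : Fin n) (U : Fin 4 → ℂ) (f : (Fin n → ℂ) → ℂ) (X : Fin n → ℂ) : ℂ :=
  qPoch (pp τ) (pp τ) ^ 2 * qPoch (qq η) (qq η) ^ 2 / (4 * Real.pi * I) ^ 2 *
    gammaPM (pp τ) (qq η) (sqrtpq τ η * ee (U 0 - U 3)) (X i) (X j) *
    ∯ w in T((0 : Fin 2 → ℂ), (1 : Fin 2 → ℝ)), ellIntegrand τ η i j U f X w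

end

end EllipticYB

namespace EllipticYB

noncomputable section

open Complex

/-! ### Infinite products -/

/-! In logarithmic variables x = e^{2πiy}, and after conjugation by the Gaussian factors, `S₁` and
`S₃` become the integral operators `normOp`, and `S₂` becomes the multiplication operator `multOp`.
Exchanging the two integrations reduces a cubic Coxeter relation to an identity of kernels. That
identity is Spiridonov's elliptic beta integral: if t_1⋯t_6 = pq and all |t_j| < 1, then (p;p)_∞
(q;q)_∞ / 2 · ∫ ∏_j Γ(t_j x^{±1}) / Γ(x^{±2}) dy = ∏_{j<k} Γ(t_j t_k). So `betaIntegral_eq` gives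
the star-triangle relation `normOp_star_triangle`, which is (3).

For the beta integral, let `betaRatio` be the quotient of the two sides. Theta functions of degree
two form a space spanned by two functions. This yields Weierstrass' three-term relation and from it
the six-parameter identity `logTheta_six_term`, by which a combination of two shifted beta
integrands is a total difference g(y) - g(y - 2η). Moving the contour shows that the ratio does not
change when 2η is moved from one parameter to another (`betaRatio_shift`). As a function of one
parameter, with the sum of two parameters fixed, the ratio is then doubly periodic on a strip. If
the strip is taller than Im 2η, the ratio is constant. Two parameters can therefore be moved to ±i
e^{-2πε}. As ε → 0 they pinch the contour at x = ±i, the integrand becomes a Poisson kernel times a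
continuous function, and the ratio tends to 1. The remaining parameter values follow by the identity
theorem.

For the Yang-Baxter equation, each R-operator is a word of four generators labelled by differences
of two of the six numbers u_1, …, w_2, which are regarded as strands. Once the permutation operators
are moved to the left, the equation says that two reduced words of one permutation of six strands
agree (`labelled_braid_word`). The braid moves pass through intermediate operators with contour
conditions of their own. These hold when the imaginary parts of the strands increase and have small
spread. The result is then continued analytically to all parameters for which the three R-operators
themselves have the unit circle as contour (`wordR_braid`). Part (2) unfolds the word on the torus
(`torusLift_ellR`), and the equation for the double integral operators follows because the Gaussian
never vanishes. -/

theorem multipliable_one_sub {ι : Type*} {c : ι → ℂ} (hc : Summable fun i => ‖c i‖) (z : ℂ) :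
    Multipliable fun i => 1 - z * c i := by
  simp only [sub_eq_add_neg]
  refine multipliable_one_add_of_summable ?_
  simpa using hc.mul_left ‖z‖

theorem differentiable_tprod_one_sub {ι : Type*} {c : ι → ℂ} (hc : Summable fun i => ‖c i‖) :
    Differentiable ℂ fun z : ℂ => ∏' i, (1 - z * c i) := by
  simp only [sub_eq_add_neg]
  intro z
  have hz : z ∈ Metric.ball (0 : ℂ) (‖z‖ + 1) := by simp
  have h : HasProdLocallyUniformlyOn (fun i x => 1 + -(x * c i)) (fun x => ∏' i, (1 + -(x * c i)))
      (Metric.ball (0 : ℂ) (‖z‖ + 1)) := by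
    refine Summable.hasProdLocallyUniformlyOn_one_add Metric.isOpen_ball
      (hc.mul_left (‖z‖ + 1)) (Filter.Eventually.of_forall fun i x hx => ?_) fun i => by fun_prop
    rw [norm_neg, norm_mul]
    gcongr
    simpa using (Metric.mem_ball.1 hx).le
  rw [hasProdLocallyUniformlyOn_iff_tendstoLocallyUniformlyOn] at h
  refine (h.differentiableOn (Filter.Eventually.of_forall fun s => ?_)
    Metric.isOpen_ball).differentiableAt (Metric.isOpen_ball.mem_nhds hz)
  exact DifferentiableOn.fun_finsetProd fun i _ => by fun_prop

theorem tprod_one_sub_ne_zero {ι : Type*} {c : ι → ℂ} (hc : Summable fun i => ‖c i‖) {z : ℂ}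
    (h : ∀ i, 1 - z * c i ≠ 0) : ∏' i, (1 - z * c i) ≠ 0 := by
  simp only [sub_eq_add_neg] at h ⊢
  refine tprod_one_add_ne_zero_of_summable h ?_
  simpa using hc.mul_left ‖z‖

theorem one_sub_ne_zero_of_norm_lt {z : ℂ} (h : ‖z‖ < 1) : 1 - z ≠ 0 := by
  intro h'
  rw [sub_eq_zero] at h'
  simp [← h'] at h

theorem summable_norm_pow {p : ℂ} (hp : ‖p‖ < 1) : Summable fun j : ℕ => ‖p ^ j‖ := by
  simpa using summable_geometric_of_lt_one (norm_nonneg p) hp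

theorem summable_norm_pow_mul_pow {p q : ℂ} (hp : ‖p‖ < 1) (hq : ‖q‖ < 1) :
    Summable fun n : ℕ × ℕ => ‖p ^ n.1 * q ^ n.2‖ := by
  simpa using (summable_geometric_of_lt_one (norm_nonneg p) hp).mul_of_nonneg
    (summable_geometric_of_lt_one (norm_nonneg q) hq) (fun _ => by positivity)
    (fun _ => by positivity)

/-- `(z; p, q)_∞ = ∏_{j, k ≥ 0} (1 - z p^j q^k)`. -/
def qPoch₂ (p q z : ℂ) : ℂ := ∏' n : ℕ × ℕ, (1 - z * (p ^ n.1 * q ^ n.2))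

/-- The theta function `θ(z; p) = (z; p)_∞ (p/z; p)_∞`. -/
def theta (p z : ℂ) : ℂ := qPoch z p * qPoch (p * z⁻¹) p

variable {p q : ℂ}

theorem differentiable_qPoch (hp : ‖p‖ < 1) : Differentiable ℂ fun z => qPoch z p :=
  differentiable_tprod_one_sub (summable_norm_pow hp)

theorem differentiable_qPoch₂ (hp : ‖p‖ < 1) (hq : ‖q‖ < 1) : Differentiable ℂ (qPoch₂ p q) :=
  differentiable_tprod_one_sub (summable_norm_pow_mul_pow hp hq)

theorem qPoch_eq (hp : ‖p‖ < 1) (z : ℂ) : qPoch z p = (1 - z) * qPoch (p * z) p := by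
  have e : ∀ j : ℕ, 1 - p * z * p ^ j = 1 - z * p ^ (j + 1) := fun j => by ring
  have h := multipliable_one_sub (summable_norm_pow hp) (p * z)
  simp only [e] at h
  have h' := tprod_eq_zero_mul' (f := fun j : ℕ => 1 - z * p ^ j) h
  simp only [pow_zero, mul_one] at h'
  simp only [qPoch, e, h']

theorem qPoch_ne_zero (hp : ‖p‖ < 1) {z : ℂ} (h : ∀ j : ℕ, 1 - z * p ^ j ≠ 0) :
    qPoch z p ≠ 0 :=
  tprod_one_sub_ne_zero (summable_norm_pow hp) h

theorem qPoch_ne_zero_of_norm_lt (hp : ‖p‖ < 1) {z : ℂ} (h : ‖z‖ < 1) : qPoch z p ≠ 0 := by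
  refine qPoch_ne_zero hp fun j => one_sub_ne_zero_of_norm_lt ?_
  rw [norm_mul, norm_pow]
  exact mul_lt_one_of_nonneg_of_lt_one_left (norm_nonneg _) h (pow_le_one₀ (norm_nonneg _) hp.le)

theorem qPoch₂_ne_zero_of_norm_lt (hp : ‖p‖ < 1) (hq : ‖q‖ < 1) {z : ℂ} (h : ‖z‖ < 1) :
    qPoch₂ p q z ≠ 0 := by
  refine tprod_one_sub_ne_zero (summable_norm_pow_mul_pow hp hq) fun n =>
    one_sub_ne_zero_of_norm_lt ?_
  rw [norm_mul, norm_mul, norm_pow, norm_pow]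
  exact mul_lt_one_of_nonneg_of_lt_one_left (norm_nonneg _) h
    (mul_le_one₀ (pow_le_one₀ (norm_nonneg _) hp.le) (by positivity)
      (pow_le_one₀ (norm_nonneg _) hq.le))

theorem qPoch₂_comm (p q z : ℂ) : qPoch₂ p q z = qPoch₂ q p z := by
  rw [qPoch₂, ← (Equiv.prodComm ℕ ℕ).tprod_eq, qPoch₂]
  exact tprod_congr fun n => by simp [mul_comm]

/-- The factors with k = 0 form the single product in p; the remaining ones form the double product
at q z. -/
theorem qPoch₂_eq (hp : ‖p‖ < 1) (hq : ‖q‖ < 1) (z : ℂ) :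
    qPoch₂ p q z = qPoch z p * qPoch₂ p q (q * z) := by
  have hm := multipliable_one_sub (summable_norm_pow_mul_pow hp hq)
  have hi : ∀ (w : ℂ) (j : ℕ), Multipliable fun k : ℕ => 1 - w * (p ^ j * q ^ k) := fun w j =>
    (multipliable_one_sub (summable_norm_pow hq) (w * p ^ j)).congr fun k => by ring
  have ho := ((hm (q * z)).hasProd.prod_fiberwise fun j => (hi (q * z) j).hasProd).multipliable
  rw [qPoch₂, (hm z).tprod_prod' fun j => hi z j, qPoch₂, (hm (q * z)).tprod_prod' fun j => hi _ j,
    qPoch, ← (multipliable_one_sub (summable_norm_pow hp) z).tprod_mul ho]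
  refine tprod_congr fun j => ?_
  rw [tprod_eq_zero_mul']
  · simp only [pow_zero, mul_one]
    congr 1
    exact tprod_congr fun k => by ring
  · exact (hi (q * z) j).congr fun k => by ring

/-! ### The elliptic gamma function as a quotient -/

theorem ellGamma_eq_div (hp : ‖p‖ < 1) (hq : ‖q‖ < 1) (z : ℂ) :
    ellGamma p q z = qPoch₂ p q (p * q * z⁻¹) / qPoch₂ p q z := by
  have hm := multipliable_one_sub (summable_norm_pow_mul_pow hp hq)
  -- At a pole both sides are 0: on the left one factor is a division by zero, on the right the
  -- whole denominator vanishes.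
  by_cases h : ∃ n : ℕ × ℕ, 1 - z * (p ^ n.1 * q ^ n.2) = 0
  · obtain ⟨n, hn⟩ := h
    rw [show qPoch₂ p q z = 0 from tprod_of_exists_eq_zero ⟨n, hn⟩, div_zero]
    refine tprod_of_exists_eq_zero ⟨n, ?_⟩
    rw [mul_assoc z, hn, div_zero]
  · push Not at h
    rw [qPoch₂, qPoch₂, ← (hm _).tprod_div₀ (hm z)
      (tprod_one_sub_ne_zero (summable_norm_pow_mul_pow hp hq) h), ellGamma]
    exact tprod_congr fun n => by ring

theorem ellGamma_ne_zero (hp : ‖p‖ < 1) (hq : ‖q‖ < 1) {z : ℂ} (h1 : ‖p * q‖ < ‖z‖)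
    (h2 : ‖z‖ < 1) : ellGamma p q z ≠ 0 := by
  have hz : 0 < ‖z‖ := (norm_nonneg _).trans_lt h1
  rw [ellGamma_eq_div hp hq]
  refine div_ne_zero (qPoch₂_ne_zero_of_norm_lt hp hq ?_) (qPoch₂_ne_zero_of_norm_lt hp hq h2)
  rw [norm_mul, norm_inv, ← div_eq_mul_inv, div_lt_one hz]
  exact h1

theorem ellGamma_mul_ellGamma (hp : ‖p‖ < 1) (hq : ‖q‖ < 1) (h0 : p * q ≠ 0) {z : ℂ}
    (h1 : ‖p * q‖ < ‖z‖) (h2 : ‖z‖ < 1) : ellGamma p q z * ellGamma p q (p * q * z⁻¹) = 1 := by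
  have h := ellGamma_ne_zero hp hq h1 h2
  have hz : z ≠ 0 := norm_pos_iff.1 ((norm_nonneg _).trans_lt h1)
  rw [ellGamma_eq_div hp hq] at h ⊢
  rw [ellGamma_eq_div hp hq]
  have : p * q * (p * q * z⁻¹)⁻¹ = z := by
    rw [mul_inv, inv_inv, mul_inv_cancel_left₀ h0]
  rw [this]
  have ha := (div_ne_zero_iff.1 h).1
  have hb := (div_ne_zero_iff.1 h).2
  rw [div_mul_div_comm, mul_comm, div_self (mul_ne_zero hb ha)]

/-- In Γ(qz) the numerator gains the factors (p/z; p)_∞ and the denominator loses (z; p)_∞. The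
bound on z keeps the cancelled products nonzero, away from the poles where the value 0 would break
the relation. -/
theorem ellGamma_mul_left (hp : ‖p‖ < 1) (hq : ‖q‖ < 1) (hq0 : q ≠ 0) {z : ℂ} (h1 : ‖z‖ < 1) :
    ellGamma p q (q * z) = theta p z * ellGamma p q z := by
  rw [ellGamma_eq_div hp hq, ellGamma_eq_div hp hq, theta, qPoch₂_eq hp hq z]
  have h3 : p * q * (q * z)⁻¹ = p * z⁻¹ := by
    rw [mul_inv]; field_simp
  rw [h3, qPoch₂_eq hp hq (p * z⁻¹)]
  have h4 : q * (p * z⁻¹) = p * q * z⁻¹ := by ring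
  rw [h4]
  have h5 := qPoch_ne_zero_of_norm_lt hp h1
  have h6 : qPoch₂ p q (q * z) ≠ 0 := qPoch₂_ne_zero_of_norm_lt hp hq (by
    rw [norm_mul]
    exact mul_lt_one_of_nonneg_of_lt_one_left (norm_nonneg _) hq h1.le)
  field_simp

theorem qPoch_eq_zero_of_eq_one : qPoch 1 p = 0 :=
  tprod_of_exists_eq_zero ⟨0, by simp⟩

/-- Splitting one row and one column off each denominator leaves (pqz; p, q)_∞ and (pq/z; p, q)_∞,
which cancel crosswise against the two numerators. What remains is a product of theta functions. At
z = 1 both sides are 0. -/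
theorem inv_ellGamma_mul_inv (hp : ‖p‖ < 1) (hq : ‖q‖ < 1) {z : ℂ}
    (hz : ‖z‖ = 1) :
    (ellGamma p q z * ellGamma p q z⁻¹)⁻¹ = theta p z * theta q z⁻¹ := by
  have hpq : ‖p * q‖ < 1 := by
    rw [norm_mul]
    exact mul_lt_one_of_nonneg_of_lt_one_left (norm_nonneg _) hp hq.le
  have hs : ∀ w : ℂ, qPoch₂ p q w = qPoch w p * (qPoch (q * w) q * qPoch₂ p q (p * q * w)) := by
    intro w
    rw [qPoch₂_eq hp hq w, qPoch₂_comm p q (q * w), qPoch₂_eq hq hp, qPoch₂_comm q p, mul_assoc p]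
  have hs' : ∀ w : ℂ, qPoch₂ p q w = qPoch w q * (qPoch (p * w) p * qPoch₂ p q (p * q * w)) := by
    intro w
    rw [qPoch₂_comm p q w, qPoch₂_eq hq hp w, qPoch₂_comm q p (p * w), qPoch₂_eq hp hq, mul_comm p q,
      mul_assoc q]
  have hn : qPoch₂ p q (p * q * z) ≠ 0 := qPoch₂_ne_zero_of_norm_lt hp hq (by
    rw [norm_mul, hz, mul_one]; exact hpq)
  have hn' : qPoch₂ p q (p * q * z⁻¹) ≠ 0 := qPoch₂_ne_zero_of_norm_lt hp hq (by
    rw [norm_mul, norm_inv, hz, inv_one, mul_one]; exact hpq)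
  rw [ellGamma_eq_div hp hq, ellGamma_eq_div hp hq, inv_inv, hs z, hs' z⁻¹, theta, theta, inv_inv,
    mul_inv, inv_div, inv_div]
  generalize qPoch₂ p q (p * q * z) = a at *
  generalize qPoch₂ p q (p * q * z⁻¹) = b at *
  rw [div_mul_div_comm, div_eq_iff (mul_ne_zero hn' hn)]
  ring

theorem theta_inv (hp : ‖p‖ < 1) {z : ℂ} (hz : z ≠ 0) : theta p z⁻¹ = -z⁻¹ * theta p z := by
  rw [theta, theta, qPoch_eq hp z⁻¹, qPoch_eq hp z, inv_inv]
  field_simp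
  ring

theorem theta_mul_left (hp : ‖p‖ < 1) (hp0 : p ≠ 0) {z : ℂ} (hz : z ≠ 0) :
    theta p (p * z) = -z⁻¹ * theta p z := by
  have : p * (p * z)⁻¹ = z⁻¹ := by field_simp
  rw [theta, theta, this, qPoch_eq hp z⁻¹, qPoch_eq hp z]
  field_simp
  ring

theorem theta_one : theta p 1 = 0 := by
  rw [theta, qPoch_eq_zero_of_eq_one, zero_mul]

theorem theta_ne_zero (hp : ‖p‖ < 1) {z : ℂ} (h1 : ‖p‖ < ‖z‖) (h2 : ‖z‖ < 1) :
    theta p z ≠ 0 := by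
  refine mul_ne_zero (qPoch_ne_zero_of_norm_lt hp h2) (qPoch_ne_zero_of_norm_lt hp ?_)
  rw [norm_mul, norm_inv, ← div_eq_mul_inv, div_lt_one ((norm_nonneg _).trans_lt h1)]
  exact h1

theorem theta_ne_zero_of_norm_eq_one (hp : ‖p‖ < 1) {z : ℂ} (h1 : ‖z‖ = 1) (h2 : z ≠ 1) :
    theta p z ≠ 0 := by
  refine mul_ne_zero ?_ (qPoch_ne_zero_of_norm_lt hp ?_)
  · rw [qPoch_eq hp]
    refine mul_ne_zero (sub_ne_zero.2 h2.symm) (qPoch_ne_zero_of_norm_lt hp ?_)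
    rwa [norm_mul, h1, mul_one]
  · rwa [norm_mul, norm_inv, h1, inv_one, mul_one]

end

end EllipticYB

namespace EllipticYB

noncomputable section

open Complex

/-! ### Exponentials -/

theorem ee_add (x y : ℂ) : ee (x + y) = ee x * ee y := by
  rw [ee, ee, ee, ← exp_add, mul_add]

theorem ee_neg (x : ℂ) : ee (-x) = (ee x)⁻¹ := by
  rw [ee, ee, ← exp_neg, mul_neg]

theorem ee_sub (x y : ℂ) : ee (x - y) = ee x * (ee y)⁻¹ := by
  rw [sub_eq_add_neg, ee_add, ee_neg]

theorem ee_zero : ee 0 = 1 := by simp [ee]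

theorem ee_one : ee 1 = 1 := by simp [ee, exp_two_pi_mul_I]

theorem ee_int (n : ℤ) : ee n = 1 := by
  rw [ee, mul_comm, exp_int_mul_two_pi_mul_I]

theorem ee_add_one (x : ℂ) : ee (x + 1) = ee x := by rw [ee_add, ee_one, mul_one]

theorem ee_ne_zero (x : ℂ) : ee x ≠ 0 := exp_ne_zero _

theorem ee_nat_mul (n : ℕ) (x : ℂ) : ee (n * x) = ee x ^ n := by
  rw [ee, ee, ← exp_nat_mul]
  congr 1
  ring

theorem ee_two_mul (x : ℂ) : ee (2 * x) = ee x ^ 2 := by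
  simpa using ee_nat_mul 2 x

theorem norm_ee (x : ℂ) : ‖ee x‖ = Real.exp (-(2 * Real.pi * x.im)) := by
  rw [ee, norm_exp]
  congr 1
  simp

theorem norm_ee_lt_norm_ee {x y : ℂ} : ‖ee x‖ < ‖ee y‖ ↔ y.im < x.im := by
  rw [norm_ee, norm_ee, Real.exp_lt_exp, neg_lt_neg_iff,
    mul_lt_mul_iff_right₀ (by positivity)]

theorem norm_ee_lt_one {x : ℂ} : ‖ee x‖ < 1 ↔ 0 < x.im := by
  have h := @norm_ee_lt_norm_ee x 0
  rwa [ee_zero, norm_one, zero_im] at h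

theorem norm_ee_ofReal (x : ℝ) : ‖ee x‖ = 1 := by
  simp [norm_ee]

theorem differentiable_ee : Differentiable ℂ ee := by
  unfold ee
  fun_prop

theorem continuous_ee : Continuous ee := differentiable_ee.continuous

theorem pp_eq (τ : ℂ) : pp τ = ee τ := rfl

theorem qq_eq (η : ℂ) : qq η = ee (2 * η) := by
  rw [qq, ee]
  congr 1
  ring

theorem sqrtpq_eq (τ η : ℂ) : sqrtpq τ η = ee ((τ + 2 * η) / 2) := by
  rw [sqrtpq, ee]
  congr 1
  ring

theorem exists_int_of_ee_eq_one {x : ℂ} (h : ee x = 1) : ∃ n : ℤ, x = n := by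
  obtain ⟨n, hn⟩ := exp_eq_one_iff.1 h
  refine ⟨n, ?_⟩
  have : (2 * Real.pi * I : ℂ) ≠ 0 := two_pi_I_ne_zero
  apply mul_left_cancel₀ this
  rw [hn]
  ring

/-! ### Moving the contour of integration of a periodic function -/

/-- Periodicity absorbs the real part of the shift. For the imaginary part, Cauchy's theorem is
applied to a rectangle of width 1, whose vertical sides cancel. -/
theorem integral_add_eq_integral_add {F : ℂ → ℂ} {a b : ℝ}
    (hF : DifferentiableOn ℂ F {x | a < x.im ∧ x.im < b}) (hper : ∀ x, F (x + 1) = F x)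
    {w₁ w₂ : ℂ} (h₁ : a < w₁.im ∧ w₁.im < b) (h₂ : a < w₂.im ∧ w₂.im < b) :
    ∫ y in (0 : ℝ)..1, F (y + w₁) = ∫ y in (0 : ℝ)..1, F (y + w₂) := by
  have key : ∀ w : ℂ, ∫ y in (0 : ℝ)..1, F (y + w) = ∫ y in (0 : ℝ)..1, F (y + w.im * I) := by
    intro w
    have hp : Function.Periodic (fun y : ℝ => F (y + w.im * I)) 1 := by
      intro y
      dsimp only
      rw [← hper (y + w.im * I)]
      congr 1
      push_cast
      ring
    have h := hp.intervalIntegral_add_eq w.re 0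
    rw [zero_add] at h
    rw [← h]
    have h' := intervalIntegral.integral_comp_add_right (a := 0) (b := 1)
      (fun y : ℝ => F (y + w.im * I)) w.re
    rw [zero_add, add_comm 1] at h'
    rw [← h']
    refine intervalIntegral.integral_congr fun y _ => ?_
    congr 1
    conv_lhs => rw [← re_add_im w]
    push_cast
    ring
  rw [key w₁, key w₂]
  have hr := integral_boundary_rect_eq_zero_of_differentiableOn F (w₁.im * I) (1 + w₂.im * I)
    (hF.mono ?_)
  · have e : ∀ y : ℝ, F (1 + y * I) = F (y * I) := fun y => by rw [add_comm, hper]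
    simp only [mul_re, ofReal_re, I_re, ofReal_im, I_im, mul_im, add_re, one_re, add_im, one_im,
      mul_zero, mul_one, zero_add, add_zero, ofReal_zero, ofReal_one, e,
      sub_self] at hr
    simpa [sub_eq_zero] using hr
  · intro x hx
    rw [mem_reProdIm] at hx
    have hx' := hx.2
    simp only [mul_im, ofReal_re, I_im, mul_one, ofReal_im, I_re, mul_zero, add_zero, add_im,
      one_im, zero_add] at hx'
    rw [Set.mem_uIcc] at hx'
    constructor <;> rcases hx' with h | h <;> linarith [h₁.1, h₁.2, h₂.1, h₂.2, h.1, h.2]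

/-! ### Theta functions of degree two -/

/-- The `n`-th term of the Fourier series of a theta function of degree two. -/
def thetaTerm (τ : ℂ) (n : ℤ) (w : ℂ) : ℂ := ee (τ * n ^ 2 / 4) * ee (n * w)

theorem summable_thetaTerm {τ : ℂ} (hτ : 0 < τ.im) (w : ℂ) :
    Summable fun n : ℤ => thetaTerm τ n w := by
  have h : 0 < (τ / 2).im := by
    rw [show τ / 2 = τ / (2 : ℝ) by push_cast; rfl, div_ofReal_im]
    linarith
  refine ((summable_jacobiTheta₂_term_iff w (τ / 2)).2 h).congr fun n => ?_
  rw [jacobiTheta₂_term, thetaTerm, ee, ee, ← exp_add]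
  congr 1
  ring

/-- The even and the odd part of the Fourier series of a theta function of degree two. -/
def thetaTwo (τ : ℂ) (j : ℤ) (w : ℂ) : ℂ := ∑' n : ℤ, if n % 2 = j then thetaTerm τ n w else 0

theorem hasSum_fourier_of_periodic {f : ℝ → ℂ} (hf : Continuous f) (hper : Function.Periodic f 1)
    (hs : Summable fun n : ℤ => ∫ x in (0 : ℝ)..1, ee (-n * x) * f x) :
    HasSum (fun n : ℤ => ∫ x in (0 : ℝ)..1, ee (-n * x) * f x) (f 0) := by
  let g : C(AddCircle (1 : ℝ), ℂ) := ⟨hper.lift, hf.quotient_lift _⟩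
  have hc : ∀ n : ℤ, fourierCoeff g n = ∫ x in (0 : ℝ)..1, ee (-n * x) * f x := by
    intro n
    rw [fourierCoeff_eq_intervalIntegral g n 0, zero_add, div_one, one_smul]
    refine intervalIntegral.integral_congr fun y _ => ?_
    change fourier (-n) (y : AddCircle (1 : ℝ)) • f y = _
    rw [fourier_coe_apply, smul_eq_mul, ee]
    congr 2
    push_cast
    ring
  have h := has_pointwise_sum_fourier_series_of_summable (f := g) (by simpa only [funext hc]) 0
  have h0 : g 0 = f 0 := rfl
  rw [h0] at h
  simpa only [hc, fourier_eval_zero, smul_eq_mul, mul_one] using h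

/-- Moving the contour by τ turns the quasi-periodicity into a two-step recursion for the Fourier
coefficients, so the coefficients of index 0 and 1 determine the function. The recursion makes the
coefficients Gaussian, which also gives the convergence of the series. -/
theorem exists_eq_thetaTwo {τ : ℂ} (hτ : 0 < τ.im) {f : ℂ → ℂ} (hf : Differentiable ℂ f)
    (h1 : ∀ w, f (w + 1) = f w) (h2 : ∀ w, f (w + τ) = ee (-2 * w - τ) * f w) :
    ∃ a b : ℂ, ∀ w, f w = a * thetaTwo τ 0 w + b * thetaTwo τ 1 w := by
  let F : ℤ → ℂ → ℂ := fun n x => ee (-n * x) * f x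
  have hFd : ∀ n, Differentiable ℂ (F n) := fun n =>
    (differentiable_ee.comp (by fun_prop : Differentiable ℂ fun x : ℂ => -n * x)).mul hf
  have hFp : ∀ n x, F n (x + 1) = F n x := by
    intro n x
    have : -(n : ℂ) * (x + 1) = -n * x + (-n : ℤ) := by push_cast; ring
    simp only [F, h1, this, ee_add, ee_int, mul_one]
  let c : ℤ → ℂ := fun n => ∫ x in (0 : ℝ)..1, F n x
  have hshift : ∀ n w, ∫ x in (0 : ℝ)..1, F n (x + w) = c n := by
    intro n w
    have h := integral_add_eq_integral_add (a := min 0 w.im - 1) (b := max 0 w.im + 1)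
      (hFd n).differentiableOn (hFp n) (w₁ := w) (w₂ := 0)
      ⟨by linarith [min_le_right 0 w.im], by linarith [le_max_right 0 w.im]⟩
      ⟨by rw [zero_im]; linarith [min_le_left 0 w.im],
        by rw [zero_im]; linarith [le_max_left 0 w.im]⟩
    simpa only [add_zero] using h
  have hcw : ∀ (n : ℤ) (w : ℂ), ∫ x in (0 : ℝ)..1, ee (-n * x) * f (x + w) = ee (n * w) * c n := by
    intro n w
    rw [← hshift n w, ← intervalIntegral.integral_const_mul]
    refine intervalIntegral.integral_congr fun x _ => ?_
    simp only [F]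
    rw [← mul_assoc, ← ee_add]
    congr 2
    ring
  -- The factor e(-2w - τ) raises the Fourier index by 2.
  have hrec : ∀ n, c n = ee (-(n + 1) * τ) * c (n + 2) := by
    intro n
    rw [← hshift n τ, ← intervalIntegral.integral_const_mul]
    refine intervalIntegral.integral_congr fun x _ => ?_
    simp only [F]
    rw [h2, ← mul_assoc, ← mul_assoc, ← ee_add, ← ee_add]
    congr 2
    push_cast
    ring
  -- Dividing by the Gaussian e(τ n²/4), which solves the same recursion, leaves a sequence of
  -- period 2.
  let d : ℤ → ℂ := fun n => ee (-(τ * n ^ 2 / 4)) * c n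
  have hd2 : Function.Periodic d 2 := by
    intro n
    simp only [d]
    rw [hrec n, ← mul_assoc, ← ee_add]
    congr 2
    push_cast
    ring
  have hd : ∀ n, d n = d (n % 2) := by
    intro n
    have h := hd2.sub_zsmul_eq (x := n) (n / 2)
    rw [← h]
    congr 1
    rw [smul_eq_mul]
    omega
  have hcd : ∀ (n : ℤ) (w : ℂ), ee (n * w) * c n = d (n % 2) * thetaTerm τ n w := by
    intro n w
    rw [← hd n]
    simp only [d, thetaTerm, ee_neg]
    field_simp [ee_ne_zero]
  have hsum : ∀ (j : ℤ) w, Summable fun n : ℤ => if n % 2 = j then thetaTerm τ n w else 0 := by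
    intro j w
    classical
    refine ((summable_thetaTerm hτ w).indicator {n | n % 2 = j}).congr fun n => ?_
    simp [Set.indicator_apply]
  refine ⟨d 0, d 1, fun w => ?_⟩
  have hs := ((hsum 0 w).hasSum.mul_left (d 0)).add ((hsum 1 w).hasSum.mul_left (d 1))
  have he : ∀ n : ℤ, (d 0 * (if n % 2 = 0 then thetaTerm τ n w else 0) +
      d 1 * if n % 2 = 1 then thetaTerm τ n w else 0) =
      ∫ x in (0 : ℝ)..1, ee (-n * x) * f (x + w) := by
    intro n
    rw [hcw, hcd]
    rcases Int.emod_two_eq_zero_or_one n with h | h <;> simp [h]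
  simp only [he] at hs
  -- The value at a complex w is the Fourier series of the translate x ↦ f(x + w), evaluated at x =
  -- 0.
  have hf' := hasSum_fourier_of_periodic (f := fun x : ℝ => f (x + w))
    (hf.continuous.comp (by fun_prop)) (fun x => by
      dsimp only
      rw [← h1 (x + w)]
      congr 1
      push_cast
      ring) hs.summable
  have := hf'.unique hs
  simpa only [ofReal_zero, zero_add, thetaTwo] using this

/-! ### The theta function in the logarithmic variable -/

/-- `θ(e^{2πix}; e^{2πiτ})`. -/
def logTheta (τ x : ℂ) : ℂ := theta (ee τ) (ee x)

variable {τ : ℂ}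

theorem differentiable_logTheta (hτ : 0 < τ.im) : Differentiable ℂ (logTheta τ) := by
  have h := differentiable_qPoch (norm_ee_lt_one.2 hτ)
  have e : logTheta τ = fun x => qPoch (ee x) (ee τ) * qPoch (ee (τ - x)) (ee τ) := by
    funext x
    rw [logTheta, theta, ee_sub]
  rw [e]
  exact (h.comp differentiable_ee).mul
    (h.comp (differentiable_ee.comp (by fun_prop : Differentiable ℂ fun x : ℂ => τ - x)))

theorem logTheta_add_one (x : ℂ) : logTheta τ (x + 1) = logTheta τ x := by
  rw [logTheta, ee_add_one, logTheta]

theorem logTheta_neg (hτ : 0 < τ.im) (x : ℂ) : logTheta τ (-x) = -ee (-x) * logTheta τ x := by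
  rw [logTheta, ee_neg, theta_inv (norm_ee_lt_one.2 hτ) (ee_ne_zero x), logTheta]

theorem logTheta_add (hτ : 0 < τ.im) (x : ℂ) : logTheta τ (x + τ) = -ee (-x) * logTheta τ x := by
  rw [logTheta, add_comm, ee_add, theta_mul_left (norm_ee_lt_one.2 hτ) (ee_ne_zero _)
    (ee_ne_zero x), logTheta, ee_neg]

/-- Reflection in τ/2. The balancing condition (parameters adding up to τ) enters the theta
identities through this symmetry. -/
theorem logTheta_sub (hτ : 0 < τ.im) (x : ℂ) : logTheta τ (τ - x) = logTheta τ x := by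
  rw [sub_eq_neg_add, logTheta_add hτ, logTheta_neg hτ, ← mul_assoc, neg_mul_neg, ← ee_add]
  simp [ee_zero]

theorem logTheta_zero : logTheta τ 0 = 0 := by
  rw [logTheta, ee_zero, theta_one]

theorem logTheta_int (n : ℤ) : logTheta τ n = 0 := by
  rw [logTheta, ee_int, theta_one]

theorem logTheta_ne_zero (hτ : 0 < τ.im) {x : ℂ} (h0 : 0 < x.im) (h1 : x.im < τ.im) :
    logTheta τ x ≠ 0 :=
  theta_ne_zero (norm_ee_lt_one.2 hτ) (norm_ee_lt_norm_ee.2 h1) (norm_ee_lt_one.2 h0)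

theorem exists_int_of_logTheta_eq_zero (hτ : 0 < τ.im) {x : ℝ} (h : logTheta τ x = 0) :
    ∃ n : ℤ, (x : ℂ) = n := by
  by_contra hx
  exact theta_ne_zero_of_norm_eq_one (norm_ee_lt_one.2 hτ) (norm_ee_ofReal x)
    (fun h' => hx (exists_int_of_ee_eq_one h')) h

/-- The antisymmetric function `e^{-2πix} θ(x + y) θ(x - y)`. -/
def thetaPair (τ x y : ℂ) : ℂ := ee (-x) * (logTheta τ (x + y) * logTheta τ (x - y))

theorem thetaPair_swap (hτ : 0 < τ.im) (x y : ℂ) : thetaPair τ x y = -thetaPair τ y x := by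
  rw [thetaPair, thetaPair, ← neg_sub x y, logTheta_neg hτ, add_comm y, neg_sub, ee_sub, ee_neg,
    ee_neg]
  field_simp [ee_ne_zero]

theorem thetaPair_self (x : ℂ) : thetaPair τ x x = 0 := by
  rw [thetaPair, sub_self, logTheta_zero, mul_zero, mul_zero]

/-- The multipliers in y do not depend on x, so all the functions `thetaPair τ x` lie in the span of
the same two theta functions. -/
theorem exists_thetaPair_eq (hτ : 0 < τ.im) (x : ℂ) :
    ∃ a b : ℂ, ∀ y, thetaPair τ x y = a * thetaTwo τ 0 y + b * thetaTwo τ 1 y := by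
  have hd := differentiable_logTheta hτ
  refine exists_eq_thetaTwo hτ ?_ (fun w => ?_) fun w => ?_
  · unfold thetaPair
    exact ((hd.comp (by fun_prop : Differentiable ℂ fun y => x + y)).mul
      (hd.comp (by fun_prop : Differentiable ℂ fun y => x - y))).const_mul _
  · rw [thetaPair, ← add_assoc, logTheta_add_one, ← logTheta_add_one (x - (w + 1)), thetaPair]
    ring_nf
  · have h := logTheta_add hτ (x - (w + τ))
    rw [show x - (w + τ) + τ = x - w by ring] at h
    rw [thetaPair, thetaPair, ← add_assoc, logTheta_add hτ, h]
    have e : ee (-2 * w - τ) * -ee (-(x - (w + τ))) = -ee (-(x + w)) := by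
      rw [mul_neg, ← ee_add]
      congr 2
      ring
    linear_combination (-(ee (-x) * logTheta τ (x + w) * logTheta τ (x - (w + τ)))) * e

/-- The three-term addition formula of Weierstrass. -/
theorem thetaPair_three_term (hτ : 0 < τ.im) (x y u v : ℂ) :
    thetaPair τ x y * thetaPair τ u v - thetaPair τ x u * thetaPair τ y v +
      thetaPair τ x v * thetaPair τ y u = 0 := by
  choose a b h using exists_thetaPair_eq hτ
  have hs := thetaPair_swap hτ
  rw [← sq_eq_zero_iff]
  -- The left side is the Pfaffian of the antisymmetric 4 × 4 matrix of values of `thetaPair`; its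
  -- square is the determinant.
  have e : (thetaPair τ x y * thetaPair τ u v - thetaPair τ x u * thetaPair τ y v +
      thetaPair τ x v * thetaPair τ y u) ^ 2 =
      Matrix.det !![thetaPair τ x x, thetaPair τ x y, thetaPair τ x u, thetaPair τ x v;
        thetaPair τ y x, thetaPair τ y y, thetaPair τ y u, thetaPair τ y v;
        thetaPair τ u x, thetaPair τ u y, thetaPair τ u u, thetaPair τ u v;
        thetaPair τ v x, thetaPair τ v y, thetaPair τ v u, thetaPair τ v v] := by
    rw [hs y x, hs u x, hs u y, hs v x, hs v y, hs v u]
    simp only [thetaPair_self]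
    simp [Matrix.det_succ_row_zero, Fin.sum_univ_succ, Fin.succAbove]
    ring
  rw [e]
  -- Each row is a combination of the same two vectors, so the matrix has rank at most 2 and its
  -- determinant vanishes.
  simp only [h]
  simp [Matrix.det_succ_row_zero, Fin.sum_univ_succ, Fin.succAbove]
  ring

end

end EllipticYB

namespace EllipticYB

noncomputable section

open Complex

/-! ### Theta function identities behind the beta integral -/

variable {τ : ℂ}

/-- Weierstrass' relation at the points (a + b + s)/2 ± z and (s ± (b - a))/2, with the exponential
prefactors collected. -/
theorem logTheta_three_term (hτ : 0 < τ.im) (a b s z : ℂ) :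
    ee z * (logTheta τ (a + z) * logTheta τ (b - z) * logTheta τ (b + s + z) *
        logTheta τ (a + s - z) -
      logTheta τ (b + z) * logTheta τ (a - z) * logTheta τ (a + s + z) *
        logTheta τ (b + s - z)) =
      ee a * logTheta τ (b - a) * logTheta τ s * logTheta τ (a + b + s) * logTheta τ (2 * z) := by
  have h := thetaPair_three_term hτ ((a + b + s) / 2 + z) ((a + b + s) / 2 - z)
    ((s + b - a) / 2) ((s + a - b) / 2)
  simp only [thetaPair] at h
  rw [show (a + b + s) / 2 + z + ((a + b + s) / 2 - z) = a + b + s by ring,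
    show (a + b + s) / 2 + z - ((a + b + s) / 2 - z) = 2 * z by ring,
    show (s + b - a) / 2 + (s + a - b) / 2 = s by ring,
    show (s + b - a) / 2 - (s + a - b) / 2 = b - a by ring,
    show (a + b + s) / 2 + z + (s + b - a) / 2 = b + s + z by ring,
    show (a + b + s) / 2 + z - (s + b - a) / 2 = a + z by ring,
    show (a + b + s) / 2 - z + (s + a - b) / 2 = a + s - z by ring,
    show (a + b + s) / 2 - z - (s + a - b) / 2 = b - z by ring,
    show (a + b + s) / 2 + z + (s + a - b) / 2 = a + s + z by ring,
    show (a + b + s) / 2 + z - (s + a - b) / 2 = b + z by ring,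
    show (a + b + s) / 2 - z + (s + b - a) / 2 = b + s - z by ring,
    show (a + b + s) / 2 - z - (s + b - a) / 2 = a - z by ring] at h
  have e1 : ee (-((a + b + s) / 2 + z)) * ee (-((s + b - a) / 2)) * ee (a + b + s) * ee z =
      ee a := by
    rw [← ee_add, ← ee_add, ← ee_add]
    congr 1
    ring
  have e2 : ee (-((a + b + s) / 2 + z)) * ee (-((a + b + s) / 2 - z)) * ee (a + b + s) = 1 := by
    rw [← ee_add, ← ee_add, ← ee_zero]
    congr 1
    ring
  linear_combination (-ee z * ee (a + b + s)) * h +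
    (logTheta τ (b - a) * logTheta τ s * logTheta τ (a + b + s) * logTheta τ (2 * z)) * e1 -
    ee z * (logTheta τ (a + z) * logTheta τ (b - z) * logTheta τ (b + s + z) *
        logTheta τ (a + s - z) -
      logTheta τ (b + z) * logTheta τ (a - z) * logTheta τ (a + s + z) *
        logTheta τ (b + s - z)) * e2

/-- Interpolation in a two-dimensional space: the function `thetaPair τ x` is recovered from its
values at two nodes P and Q. -/
theorem thetaPair_mul_thetaPair (hτ : 0 < τ.im) (P Q x y : ℂ) :
    thetaPair τ P Q * thetaPair τ x y =
      thetaPair τ x P * thetaPair τ y Q - thetaPair τ x Q * thetaPair τ y P := by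
  have h := thetaPair_three_term hτ P Q x y
  rw [thetaPair_swap hτ P x, thetaPair_swap hτ Q y, thetaPair_swap hτ P y,
    thetaPair_swap hτ Q x] at h
  linear_combination h

/-- A bilinear relation between the functions `thetaPair τ x` can be verified on a basis. -/
theorem bilinear_thetaPair_eq_zero (hτ : 0 < τ.im) {P Q P' Q' : ℂ}
    (hPQ : thetaPair τ P Q ≠ 0) (hPQ' : thetaPair τ P' Q' ≠ 0)
    (k₁ k₂ k₃ k₄ x₁ x₂ x₃ x₄ x₁' x₂' x₃' x₄' : ℂ) {X : ℂ → ℂ → ℂ}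
    (hX : ∀ y y', X y y' = k₁ * thetaPair τ x₁ y * thetaPair τ x₁' y' +
      k₂ * thetaPair τ x₂ y * thetaPair τ x₂' y' + k₃ * thetaPair τ x₃ y * thetaPair τ x₃' y' +
      k₄ * thetaPair τ x₄ y * thetaPair τ x₄' y')
    (h1 : X P P' = 0) (h2 : X P Q' = 0) (h3 : X Q P' = 0) (h4 : X Q Q' = 0) (y y' : ℂ) :
    X y y' = 0 := by
  -- After multiplication by this nonzero constant, interpolation in y and in y' expresses X through
  -- its four values at the nodes.
  refine (mul_eq_zero.1 (?_ : (thetaPair τ P Q * thetaPair τ P' Q') * X y y' = 0)).resolve_left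
    (mul_ne_zero hPQ hPQ')
  have h := fun x => thetaPair_mul_thetaPair hτ P Q x y
  have h' := fun x => thetaPair_mul_thetaPair hτ P' Q' x y'
  calc _ = k₁ * (thetaPair τ P Q * thetaPair τ x₁ y) * (thetaPair τ P' Q' * thetaPair τ x₁' y') +
      k₂ * (thetaPair τ P Q * thetaPair τ x₂ y) * (thetaPair τ P' Q' * thetaPair τ x₂' y') +
      k₃ * (thetaPair τ P Q * thetaPair τ x₃ y) * (thetaPair τ P' Q' * thetaPair τ x₃' y') +
      k₄ * (thetaPair τ P Q * thetaPair τ x₄ y) * (thetaPair τ P' Q' * thetaPair τ x₄' y') := by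
        rw [hX]; ring
    _ = X P P' * thetaPair τ y Q * thetaPair τ y' Q' - X P Q' * thetaPair τ y Q * thetaPair τ y' P' -
      X Q P' * thetaPair τ y P * thetaPair τ y' Q' + X Q Q' * thetaPair τ y P * thetaPair τ y' P' := by
        simp only [h, h', hX]; ring
    _ = 0 := by rw [h1, h2, h3, h4]; ring

/-- The last four parameters are written as σ ± y and ρ ± y', so that every term is a product of a
`thetaPair` in y and one in y'. It then suffices to test a bilinear form at four pairs of nodes. -/
theorem logTheta_six_term_aux (hτ : 0 < τ.im) {a b σ ρ z : ℂ} (hs : a + b + 2 * σ + 2 * ρ = τ)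
    (hz : logTheta τ (2 * z) ≠ 0) (hσ : logTheta τ (2 * σ) ≠ 0) (hρ : logTheta τ (2 * ρ) ≠ 0)
    (y y' : ℂ) :
    ee z * logTheta τ (2 * z) *
      (logTheta τ (a + z) * logTheta τ (a - z) * (logTheta τ (b + (σ + y)) *
        logTheta τ (b + (σ - y)) * logTheta τ (b + (ρ + y')) * logTheta τ (b + (ρ - y'))) -
      logTheta τ (b + z) * logTheta τ (b - z) * (logTheta τ (a + (σ + y)) *
        logTheta τ (a + (σ - y)) * logTheta τ (a + (ρ + y')) * logTheta τ (a + (ρ - y')))) +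
    ee a * logTheta τ (b - a) * (logTheta τ (a + z) * logTheta τ (b + z) *
        (logTheta τ (σ + y + z) * logTheta τ (σ - y + z) * logTheta τ (ρ + y' + z) *
          logTheta τ (ρ - y' + z)) -
      ee (4 * z) * (logTheta τ (a - z) * logTheta τ (b - z) *
        (logTheta τ (σ + y - z) * logTheta τ (σ - y - z) * logTheta τ (ρ + y' - z) *
          logTheta τ (ρ - y' - z)))) = 0 := by
  -- The balancing condition and the reflection in τ/2 eliminate ρ from the arguments that occur at
  -- the nodes.
  have hb₁ : logTheta τ (b + 2 * ρ + z) = logTheta τ (a + 2 * σ - z) := by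
    rw [← logTheta_sub hτ]; congr 1; linear_combination -hs
  have hb₂ : logTheta τ (b + 2 * ρ - z) = logTheta τ (a + 2 * σ + z) := by
    rw [← logTheta_sub hτ]; congr 1; linear_combination -hs
  have ha₁ : logTheta τ (a + 2 * ρ + z) = logTheta τ (b + 2 * σ - z) := by
    rw [← logTheta_sub hτ]; congr 1; linear_combination -hs
  have ha₂ : logTheta τ (a + 2 * ρ - z) = logTheta τ (b + 2 * σ + z) := by
    rw [← logTheta_sub hτ]; congr 1; linear_combination -hs
  have h₃ : logTheta τ (2 * ρ) = logTheta τ (a + b + 2 * σ) := by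
    rw [← logTheta_sub hτ]; congr 1; linear_combination -hs
  have hT := logTheta_three_term hτ a b (2 * σ) z
  have hT' := logTheta_three_term hτ a b (2 * σ) (-z)
  rw [mul_neg, logTheta_neg hτ, ee_neg, ee_neg, ee_two_mul] at hT'
  simp only [sub_neg_eq_add, ← sub_eq_add_neg] at hT'
  -- the values of the pairings
  have w : ∀ x s t : ℂ, thetaPair τ (x + s) (t + s) =
      (ee x * ee s)⁻¹ * (logTheta τ (x + 2 * s + t) * logTheta τ (x - t)) := by
    intro x s t
    rw [thetaPair, ee_neg, ee_add]
    congr 3 <;> ring_nf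
  have w' : ∀ x s t : ℂ, thetaPair τ (x + s) (s - t) =
      (ee x * ee s)⁻¹ * (logTheta τ (x + 2 * s - t) * logTheta τ (x + t)) := by
    intro x s t
    rw [thetaPair, ee_neg, ee_add]
    congr 3 <;> ring_nf
  have w₁ : ∀ s : ℂ, thetaPair τ (z + s) (s - z) =
      (ee z * ee s)⁻¹ * (logTheta τ (2 * s) * logTheta τ (2 * z)) := by
    intro s
    rw [thetaPair, ee_neg, ee_add]
    congr 3 <;> ring_nf
  have w₂ : ∀ s : ℂ, thetaPair τ (s - z) (z + s) =
      -((ee z * ee s)⁻¹ * (logTheta τ (2 * s) * logTheta τ (2 * z))) := by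
    intro s
    rw [thetaPair_swap hτ, w₁]
  have e4 : ee (4 * z) = ee z ^ 4 := by simpa using ee_nat_mul 4 z
  have hez := ee_ne_zero z
  have heσ := ee_ne_zero σ
  have heρ := ee_ne_zero ρ
  have hea := ee_ne_zero a
  have heb := ee_ne_zero b
  -- The nodes σ ± z and ρ ± z are zeros of factors of the last two terms. At mixed signs both of
  -- these terms vanish and the first two cancel. At equal signs one of them survives and the claim
  -- is the three-term relation at z or at -z.
  refine (bilinear_thetaPair_eq_zero hτ (P := z + σ) (Q := σ - z) (P' := z + ρ) (Q' := ρ - z)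
    ?_ ?_
    (ee z * logTheta τ (2 * z) * (logTheta τ (a + z) * logTheta τ (a - z)) *
      (ee b ^ 2 * ee σ * ee ρ))
    (-(ee z * logTheta τ (2 * z) * (logTheta τ (b + z) * logTheta τ (b - z)) *
      (ee a ^ 2 * ee σ * ee ρ)))
    (ee a * logTheta τ (b - a) * (logTheta τ (a + z) * logTheta τ (b + z)) *
      (ee z ^ 2 * ee σ * ee ρ))
    (-(ee a * logTheta τ (b - a) * (logTheta τ (a - z) * logTheta τ (b - z)) *
      (ee z ^ 2 * ee σ * ee ρ)))
    (b + σ) (a + σ) (z + σ) (σ - z) (b + ρ) (a + ρ) (z + ρ) (ρ - z)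
    (X := fun y y' => _) (fun y y' => rfl) ?_ ?_ ?_ ?_ y y').symm.trans ?_ |>.symm
  · rw [w₁]
    positivity
  · rw [w₁]
    positivity
  · simp only [w, w₂, sub_self, logTheta_zero, hb₁, ha₁, h₃]
    field_simp
    linear_combination (logTheta τ (2 * z) * logTheta τ (a - z) * logTheta τ (b - z)) * hT
  · simp only [w, w', thetaPair_self, sub_self, logTheta_zero, hb₂, ha₂]
    field_simp
    ring
  · simp only [w, w', thetaPair_self, sub_self, logTheta_zero, hb₁, ha₁]
    field_simp
    ring
  · simp only [w₁]
    simp only [w', thetaPair_self, hb₂, ha₂, h₃]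
    generalize logTheta τ (2 * z) = T at *
    field_simp at hT' ⊢
    linear_combination (T * logTheta τ (a + z) * logTheta τ (b + z)) * hT'
  · simp only [thetaPair, ee_neg, ee_add, ee_sub, e4, mul_inv, inv_inv,
      show ∀ x s y : ℂ, x + s + y = x + (s + y) from fun x s y => by ring,
      show ∀ x s y : ℂ, x + s - y = x + (s - y) from fun x s y => by ring]
    field_simp
    ring_nf

/-- The theta function identity that expresses an elliptic hypergeometric integrand as a total
difference. -/
theorem logTheta_six_term (hτ : 0 < τ.im) {a b c d e f z : ℂ} (hs : a + b + c + d + e + f = τ)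
    (hz : logTheta τ (2 * z) ≠ 0) (hcd : logTheta τ (c + d) ≠ 0) (hef : logTheta τ (e + f) ≠ 0) :
    ee z * logTheta τ (2 * z) *
      (logTheta τ (a + z) * logTheta τ (a - z) * (logTheta τ (b + c) *
        logTheta τ (b + d) * logTheta τ (b + e) * logTheta τ (b + f)) -
      logTheta τ (b + z) * logTheta τ (b - z) * (logTheta τ (a + c) *
        logTheta τ (a + d) * logTheta τ (a + e) * logTheta τ (a + f))) +
    ee a * logTheta τ (b - a) * (logTheta τ (a + z) * logTheta τ (b + z) *
        (logTheta τ (c + z) * logTheta τ (d + z) * logTheta τ (e + z) * logTheta τ (f + z)) -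
      ee (4 * z) * (logTheta τ (a - z) * logTheta τ (b - z) *
        (logTheta τ (c - z) * logTheta τ (d - z) * logTheta τ (e - z) * logTheta τ (f - z)))) =
      0 := by
  have h := logTheta_six_term_aux hτ (a := a) (b := b) (σ := (c + d) / 2) (ρ := (e + f) / 2)
    (z := z) (by rw [← hs]; ring) hz (by rwa [mul_div_cancel₀ _ two_ne_zero])
    (by rwa [mul_div_cancel₀ _ two_ne_zero]) ((c - d) / 2) ((e - f) / 2)
  rwa [show (c + d) / 2 + (c - d) / 2 = c by ring, show (c + d) / 2 - (c - d) / 2 = d by ring,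
    show (e + f) / 2 + (e - f) / 2 = e by ring, show (e + f) / 2 - (e - f) / 2 = f by ring] at h

end

end EllipticYB

namespace EllipticYB

noncomputable section

open Complex

/-! ### Integrals depending on a parameter -/

theorem continuousOn_intervalIntegral {X : Type*} [TopologicalSpace X] {s : Set X}
    {F : X → ℝ → ℂ} (hF : ContinuousOn (Function.uncurry F) (s ×ˢ Set.univ)) (a b : ℝ) :
    ContinuousOn (fun x => ∫ y in a..b, F x y) s := by
  rw [continuousOn_iff_continuous_domRestrict]
  refine intervalIntegral.continuous_parametric_intervalIntegral_of_continuous'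
    (f := fun (x : s) y => F x y) ?_ a b
  exact hF.comp_continuous (f := fun z : s × ℝ => ((z.1 : X), z.2)) (by fun_prop)
    fun z => ⟨z.1.2, trivial⟩

/-- Joint continuity gives a local bound of the integrand, and Cauchy's estimate turns it into a
bound of the derivative, so no hypothesis on the derivative is needed for dominated convergence. -/
theorem differentiableOn_intervalIntegral {U : Set ℂ} (hU : IsOpen U) {F : ℂ → ℝ → ℂ}
    (hF : ContinuousOn (Function.uncurry F) (U ×ˢ Set.univ))
    (hd : ∀ y, DifferentiableOn ℂ (fun s => F s y) U) (a b : ℝ) :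
    DifferentiableOn ℂ (fun s => ∫ y in a..b, F s y) U := by
  intro s₀ hs₀
  obtain ⟨R, hR, hRU⟩ := Metric.isOpen_iff.1 hU s₀ hs₀
  have hc : ∀ s ∈ U, Continuous (F s) := fun s hs =>
    hF.comp_continuous (f := fun y => (s, y)) (by fun_prop) fun y => ⟨hs, trivial⟩
  have hsub : Metric.closedBall s₀ (R / 2) ⊆ U :=
    (Metric.closedBall_subset_ball (by linarith)).trans hRU
  obtain ⟨C, hC⟩ := ((isCompact_closedBall s₀ (R / 2)).prod
    (isCompact_uIcc (a := a) (b := b))).exists_bound_of_continuousOn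
    (hF.mono (Set.prod_mono hsub (Set.subset_univ _)))
  have hder : ∀ y, ∀ s ∈ U, HasDerivAt (fun s => F s y) (deriv (fun s => F s y) s) s :=
    fun y s hs => ((hd y).differentiableAt (hU.mem_nhds hs)).hasDerivAt
  have hball : Metric.ball s₀ (R / 4) ∈ nhds s₀ := Metric.ball_mem_nhds _ (by linarith)
  have hballU : ∀ s ∈ Metric.ball s₀ (R / 4), Metric.closedBall s (R / 4) ⊆
      Metric.closedBall s₀ (R / 2) := by
    intro s hs
    refine Metric.closedBall_subset_closedBall' ?_
    linarith [Metric.mem_ball.1 hs]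
  have hm : MeasureTheory.AEStronglyMeasurable (fun y => deriv (fun s => F s y) s₀)
      (MeasureTheory.volume.restrict (Set.uIoc a b)) := by
    -- The derivative is measurable in y as a limit of the difference quotients along t n → 0; the
    -- steps are at most R / 2, so they stay inside U.
    let t : ℕ → ℂ := fun n => ((R / 2 / (n + 1) : ℝ) : ℂ)
    have htpos : ∀ n : ℕ, 0 < R / 2 / ((n : ℝ) + 1) := fun n => by positivity
    have htU : ∀ n, s₀ + t n ∈ U := by
      intro n
      refine hsub ?_
      rw [Metric.mem_closedBall, dist_eq, add_sub_cancel_left, norm_real, Real.norm_eq_abs,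
        abs_of_pos (htpos n)]
      exact div_le_self (by linarith) (by linarith [(Nat.cast_nonneg n : (0 : ℝ) ≤ n)])
    have ht : Filter.Tendsto t Filter.atTop (nhdsWithin 0 {0}ᶜ) := by
      rw [tendsto_nhdsWithin_iff]
      constructor
      · have h1 : Filter.Tendsto (fun n : ℕ => R / 2 / ((n : ℝ) + 1)) Filter.atTop (nhds 0) := by
          have := (tendsto_one_div_add_atTop_nhds_zero_nat (𝕜 := ℝ)).const_mul (R / 2)
          simpa [div_eq_mul_inv] using this
        have := (continuous_ofReal.tendsto 0).comp h1
        rw [ofReal_zero] at this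
        exact this
      · exact Filter.Eventually.of_forall fun n => by
          simpa [t] using (ofReal_ne_zero.2 (htpos n).ne')
    refine aestronglyMeasurable_of_tendsto_ae Filter.atTop
      (f := fun n y => (t n)⁻¹ • (F (s₀ + t n) y - F s₀ y)) (fun n => ?_)
      (Filter.Eventually.of_forall fun y => ?_)
    · have h1 := hc _ (htU n)
      have h2 := hc _ hs₀
      exact (by fun_prop : Continuous fun y => (t n)⁻¹ • (F (s₀ + t n) y - F s₀ y))
        |>.aestronglyMeasurable
    · exact (hder y s₀ hs₀).tendsto_slope_zero.comp ht
  have := intervalIntegral.hasDerivAt_integral_of_dominated_loc_of_deriv_le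
    (μ := MeasureTheory.volume) (a := a) (b := b) (F := F)
    (F' := fun s y => deriv (fun s => F s y) s) (bound := fun _ => C / (R / 4)) hball ?_ ?_ hm
    ?_ ?_ ?_
  · exact this.2.differentiableAt.differentiableWithinAt
  · filter_upwards [hU.mem_nhds hs₀] with s hs using (hc s hs).aestronglyMeasurable
  · exact (hc s₀ hs₀).intervalIntegrable _ _
  -- Cauchy's estimate on the circle of radius R / 4 about s, which lies in the closed ball of
  -- radius R / 2 where C bounds the integrand.
  · refine Filter.Eventually.of_forall fun y hy s hs => ?_
    refine norm_deriv_le_of_forall_mem_sphere_norm_le (by linarith) ?_ fun w hw => ?_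
    · refine DifferentiableOn.diffContOnCl ?_
      rw [closure_ball _ (by linarith)]
      exact (hd y).mono ((hballU s hs).trans hsub)
    · exact hC (w, y) ⟨hballU s hs (Metric.sphere_subset_closedBall hw), Set.uIoc_subset_uIcc hy⟩
  · exact intervalIntegrable_const
  · exact Filter.Eventually.of_forall fun y _ s hs =>
      hder y s (hsub (hballU s hs (Metric.mem_closedBall_self (by linarith))))

/-! ### The elliptic gamma function in the logarithmic variable -/

/-- `Γ(e^{2πix}; p, q)`. -/
def logGamma (τ η x : ℂ) : ℂ := ellGamma (pp τ) (qq η) (ee x)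

variable {τ η : ℂ}

theorem two_mul_im_pos (hη : 0 < η.im) : 0 < (2 * η).im := by
  simpa using hη

theorem norm_pp_lt_one (hτ : 0 < τ.im) : ‖pp τ‖ < 1 := norm_ee_lt_one.2 hτ

theorem norm_qq_lt_one (hη : 0 < η.im) : ‖qq η‖ < 1 := by
  rw [qq_eq]
  exact norm_ee_lt_one.2 (two_mul_im_pos hη)

theorem pp_mul_qq (τ η : ℂ) : pp τ * qq η = ee (τ + 2 * η) := by
  rw [pp_eq, qq_eq, ee_add]

theorem logGamma_eq_div (hτ : 0 < τ.im) (hη : 0 < η.im) (x : ℂ) :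
    logGamma τ η x = qPoch₂ (pp τ) (qq η) (ee (τ + 2 * η - x)) / qPoch₂ (pp τ) (qq η) (ee x) := by
  rw [logGamma, ellGamma_eq_div (norm_pp_lt_one hτ) (norm_qq_lt_one hη), pp_mul_qq, ← ee_sub]

theorem differentiableAt_logGamma (hτ : 0 < τ.im) (hη : 0 < η.im) {x : ℂ} (hx : 0 < x.im) :
    DifferentiableAt ℂ (logGamma τ η) x := by
  rw [funext (logGamma_eq_div hτ hη)]
  have h := differentiable_qPoch₂ (norm_pp_lt_one hτ) (norm_qq_lt_one hη)
  have h1 : Differentiable ℂ fun x => qPoch₂ (pp τ) (qq η) (ee (τ + 2 * η - x)) :=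
    h.comp (differentiable_ee.comp (by fun_prop))
  exact (h1 x).div ((h.comp differentiable_ee) x)
    (qPoch₂_ne_zero_of_norm_lt (norm_pp_lt_one hτ) (norm_qq_lt_one hη) (norm_ee_lt_one.2 hx))

theorem differentiableOn_logGamma (hτ : 0 < τ.im) (hη : 0 < η.im) :
    DifferentiableOn ℂ (logGamma τ η) {x | 0 < x.im} :=
  fun _ hx => (differentiableAt_logGamma hτ hη hx).differentiableWithinAt

theorem continuousOn_logGamma (hτ : 0 < τ.im) (hη : 0 < η.im) :
    ContinuousOn (logGamma τ η) {x | 0 < x.im} :=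
  (differentiableOn_logGamma hτ hη).continuousOn

theorem logGamma_ne_zero (hτ : 0 < τ.im) (hη : 0 < η.im) {x : ℂ} (h0 : 0 < x.im)
    (h1 : x.im < (τ + 2 * η).im) : logGamma τ η x ≠ 0 :=
  ellGamma_ne_zero (norm_pp_lt_one hτ) (norm_qq_lt_one hη)
    (by rw [pp_mul_qq]; exact norm_ee_lt_norm_ee.2 h1) (norm_ee_lt_one.2 h0)

theorem logGamma_mul_logGamma (hτ : 0 < τ.im) (hη : 0 < η.im) {x y : ℂ} (h : x + y = τ + 2 * η)
    (h0 : 0 < x.im) (h1 : 0 < y.im) : logGamma τ η x * logGamma τ η y = 1 := by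
  obtain rfl : y = τ + 2 * η - x := by rw [← h]; ring
  have := ellGamma_mul_ellGamma (norm_pp_lt_one hτ) (norm_qq_lt_one hη)
    (by rw [pp_mul_qq]; exact ee_ne_zero _) (z := ee x)
    (by rw [pp_mul_qq]; refine norm_ee_lt_norm_ee.2 ?_; rw [sub_im] at h1; linarith)
    (norm_ee_lt_one.2 h0)
  rwa [pp_mul_qq, ← ee_sub] at this

theorem logGamma_add_one (x : ℂ) : logGamma τ η (x + 1) = logGamma τ η x := by
  rw [logGamma, ee_add_one, logGamma]

theorem logGamma_add (hτ : 0 < τ.im) (hη : 0 < η.im) {x : ℂ} (hx : 0 < x.im) :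
    logGamma τ η (x + 2 * η) = logTheta τ x * logGamma τ η x := by
  rw [logGamma, add_comm, ee_add, ← qq_eq, ellGamma_mul_left (norm_pp_lt_one hτ)
    (norm_qq_lt_one hη) (by rw [qq_eq]; exact ee_ne_zero _) (norm_ee_lt_one.2 hx)]
  rfl

/-- The weight `1 / Γ(x^{±2})` in the variable `y`, `x = e^{2πiy}`. -/
def betaWeight (τ η y : ℂ) : ℂ := logTheta τ (2 * y) * logTheta (2 * η) (-(2 * y))

/-- The product formula for 1 / (Γ(z) Γ(z⁻¹)) at z = x². The theta form on the left is entire in y,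
so it allows the contour to be moved. -/
theorem betaWeight_ofReal (hτ : 0 < τ.im) (hη : 0 < η.im) (y : ℝ) :
    betaWeight τ η y = (gammaSq (pp τ) (qq η) (ee y))⁻¹ := by
  rw [gammaSq, ← ee_two_mul, inv_ellGamma_mul_inv (norm_pp_lt_one hτ) (norm_qq_lt_one hη),
    betaWeight, logTheta, logTheta, ee_neg, pp_eq, qq_eq]
  exact_mod_cast norm_ee_ofReal (2 * y)

theorem differentiable_betaWeight (hτ : 0 < τ.im) (hη : 0 < η.im) :
    Differentiable ℂ (betaWeight τ η) :=
  ((differentiable_logTheta hτ).comp (by fun_prop : Differentiable ℂ fun y : ℂ => 2 * y)).mul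
    ((differentiable_logTheta (two_mul_im_pos hη)).comp
      (by fun_prop : Differentiable ℂ fun y : ℂ => -(2 * y)))

/-- `Γ(e^{2πia} x^{±1})`, `x = e^{2πiy}`. -/
def gammaPair (τ η a y : ℂ) : ℂ := logGamma τ η (a + y) * logGamma τ η (a - y)

theorem gammaPair_add (hτ : 0 < τ.im) (hη : 0 < η.im) {a : ℂ} (ha : 0 < a.im) (y : ℝ) :
    gammaPair τ η (a + 2 * η) y =
      logTheta τ (a + y) * logTheta τ (a - y) * gammaPair τ η a y := by
  rw [gammaPair, add_right_comm, ← sub_add_eq_add_sub, logGamma_add hτ hη (by simpa using ha),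
    logGamma_add hτ hη (by simpa using ha), gammaPair]
  ring

theorem continuous_gammaPair (hτ : 0 < τ.im) (hη : 0 < η.im) {a : ℂ} (ha : 0 < a.im) :
    Continuous fun y : ℝ => gammaPair τ η a y :=
  ((continuousOn_logGamma hτ hη).comp_continuous (by fun_prop) fun y => by simpa using ha).mul
    ((continuousOn_logGamma hτ hη).comp_continuous (by fun_prop) fun y => by simpa using ha)

theorem continuous_betaWeight (hτ : 0 < τ.im) (hη : 0 < η.im) :
    Continuous fun y : ℝ => betaWeight τ η y :=
  (differentiable_betaWeight hτ hη).continuous.comp continuous_ofReal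

/-- The integrand of the elliptic beta integral with parameters `e^{2πia}, …, e^{2πif}`. -/
def betaIntegrand (τ η a b c d e f y : ℂ) : ℂ :=
  gammaPair τ η a y * gammaPair τ η b y * gammaPair τ η c y * gammaPair τ η d y *
    gammaPair τ η e y * gammaPair τ η f y * betaWeight τ η y

/-- The elliptic beta integral. -/
def betaIntegral (τ η a b c d e f : ℂ) : ℂ := ∫ y in (0 : ℝ)..1, betaIntegrand τ η a b c d e f y

theorem continuous_betaIntegrand (hτ : 0 < τ.im) (hη : 0 < η.im) {a b c d e f : ℂ} (ha : 0 < a.im)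
    (hb : 0 < b.im) (hc : 0 < c.im) (hd : 0 < d.im) (he : 0 < e.im) (hf : 0 < f.im) :
    Continuous fun y : ℝ => betaIntegrand τ η a b c d e f y :=
  ((((((continuous_gammaPair hτ hη ha).mul (continuous_gammaPair hτ hη hb)).mul
    (continuous_gammaPair hτ hη hc)).mul (continuous_gammaPair hτ hη hd)).mul
    (continuous_gammaPair hτ hη he)).mul (continuous_gammaPair hτ hη hf)).mul
    (continuous_betaWeight hτ hη)

end

end EllipticYB

namespace EllipticYB

noncomputable section

open Complex

variable {τ η : ℂ}

/-! ### The difference equation of the elliptic beta integral -/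

theorem logTheta_sub_one (x : ℂ) : logTheta τ (x - 1) = logTheta τ x := by
  rw [← logTheta_add_one, sub_add_cancel]

theorem logGamma_sub_one (x : ℂ) : logGamma τ η (x - 1) = logGamma τ η x := by
  rw [← logGamma_add_one, sub_add_cancel]

/-- `Γ(q e^{2πia} x) Γ(e^{2πia} x⁻¹)`, `x = e^{2πiy}`. -/
def gammaShift (τ η a y : ℂ) : ℂ := logGamma τ η (a + 2 * η + y) * logGamma τ η (a - y)

theorem gammaShift_add_one (a y : ℂ) : gammaShift τ η a (y + 1) = gammaShift τ η a y := by
  rw [gammaShift, ← add_assoc, logGamma_add_one, sub_add_eq_sub_sub, logGamma_sub_one, gammaShift]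

theorem gammaShift_eq (hτ : 0 < τ.im) (hη : 0 < η.im) {a : ℂ} (ha : 0 < a.im) (y : ℝ) :
    gammaShift τ η a y = logTheta τ (a + y) * gammaPair τ η a y := by
  rw [gammaShift, add_right_comm, logGamma_add hτ hη (by simpa using ha), gammaPair, mul_assoc]

theorem gammaShift_neg (hτ : 0 < τ.im) (hη : 0 < η.im) {a : ℂ} (ha : 0 < a.im) (y : ℝ) :
    gammaShift τ η a (-y) = logTheta τ (a - y) * gammaPair τ η a y := by
  rw [gammaShift, add_right_comm, logGamma_add hτ hη (by simpa using ha), gammaPair, sub_neg_eq_add,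
    ← sub_eq_add_neg]
  ring

/-- The shift by -2η interchanges the two factors up to y ↦ -y. A shifted contour can thus be
compared with a reflected one. -/
theorem gammaShift_sub (a y : ℂ) : gammaShift τ η a (y - 2 * η) = gammaShift τ η a (-y) := by
  rw [gammaShift, gammaShift, mul_comm]
  congr 2 <;> ring

theorem differentiableAt_gammaShift (hτ : 0 < τ.im) (hη : 0 < η.im) {a y : ℂ}
    (h1 : 0 < a.im + (2 * η).im + y.im) (h2 : y.im < a.im) :
    DifferentiableAt ℂ (gammaShift τ η a) y := by
  have e1 : DifferentiableAt ℂ (logGamma τ η) (a + 2 * η + y) :=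
    differentiableAt_logGamma hτ hη (by simpa using h1)
  have e2 : DifferentiableAt ℂ (logGamma τ η) (a - y) :=
    differentiableAt_logGamma hτ hη (by simpa using h2)
  exact (e1.comp y (by fun_prop : DifferentiableAt ℂ (fun y => a + 2 * η + y) y)).mul
    (e2.comp y (by fun_prop : DifferentiableAt ℂ (fun y => a - y) y))

/-- The theta part of the weight, twisted by e(-y), reproduces its own reflection with a minus sign;
this sign makes the expression g(y) + g(-y) below a total difference. -/
theorem logTheta_total_difference (hη : 0 < η.im) (y : ℂ) :
    logTheta (2 * η) (-(2 * (y - 2 * η))) * ee (-(y - 2 * η)) =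
      -(logTheta (2 * η) (2 * y) * ee y) := by
  have h2 := two_mul_im_pos hη
  rw [show -(2 * (y - 2 * η)) = -(2 * y) + 2 * η + 2 * η by ring, logTheta_add h2,
    logTheta_add h2, logTheta_neg h2]
  simp only [neg_neg, ee_neg, ee_add, ee_sub, ee_two_mul y]
  field_simp [ee_ne_zero]

/-- The difference of the two integrands is a constant multiple of g(y) + g(-y) = g(y) - g(y - 2η),
by the six-term theta identity. Its integral vanishes because g is holomorphic and 1-periodic
between the contours Im y = 0 and Im y = -Im 2η. -/
theorem betaIntegral_shift (hτ : 0 < τ.im) (hη : 0 < η.im) {a b c d e f : ℂ} (ha : 0 < a.im)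
    (hb : 0 < b.im) (hc : 0 < c.im) (hd : 0 < d.im) (he : 0 < e.im) (hf : 0 < f.im)
    (hs : a + b + c + d + e + f = τ) :
    logTheta τ (b + c) * logTheta τ (b + d) * logTheta τ (b + e) * logTheta τ (b + f) *
        betaIntegral τ η (a + 2 * η) b c d e f =
      logTheta τ (a + c) * logTheta τ (a + d) * logTheta τ (a + e) * logTheta τ (a + f) *
        betaIntegral τ η a (b + 2 * η) c d e f := by
  have h2 := two_mul_im_pos hη
  let g : ℂ → ℂ := fun y => gammaShift τ η a y * gammaShift τ η b y * gammaShift τ η c y *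
    gammaShift τ η d y * gammaShift τ η e y * gammaShift τ η f y *
    (logTheta (2 * η) (-(2 * y)) * ee (-y))
  have hgper : ∀ y, g (y + 1) = g y := by
    intro y
    have e1 : -(2 * (y + 1)) = -(2 * y) - 1 - 1 := by ring
    have e2 : ee (-(y + 1)) = ee (-y) := by
      rw [← ee_add_one]; congr 1; ring
    simp only [g, gammaShift_add_one, e1, logTheta_sub_one, e2]
  -- The least imaginary part of the parameters is the margin by which g stays holomorphic beyond
  -- both contours.
  obtain ⟨m, hm, hma, hmb, hmc, hmd, hme, hmf⟩ : ∃ m : ℝ, 0 < m ∧ m ≤ a.im ∧ m ≤ b.im ∧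
      m ≤ c.im ∧ m ≤ d.im ∧ m ≤ e.im ∧ m ≤ f.im := by
    refine ⟨min a.im (min b.im (min c.im (min d.im (min e.im f.im)))), by positivity, ?_⟩
    simp
  have hgd : DifferentiableOn ℂ g {y | -(2 * η).im - m < y.im ∧ y.im < m} := by
    rintro y ⟨hy1, hy2⟩
    have hS : ∀ {x : ℂ}, m ≤ x.im → DifferentiableAt ℂ (gammaShift τ η x) y := fun hx =>
      differentiableAt_gammaShift hτ hη (by linarith) (by linarith)
    have hT : DifferentiableAt ℂ (fun y => logTheta (2 * η) (-(2 * y)) * ee (-y)) y :=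
      (((differentiable_logTheta h2).comp (by fun_prop : Differentiable ℂ fun y : ℂ => -(2 * y))).mul
        (differentiable_ee.comp (by fun_prop : Differentiable ℂ fun y : ℂ => -y))) y
    exact (((((((hS hma).mul (hS hmb)).mul (hS hmc)).mul (hS hmd)).mul (hS hme)).mul
      (hS hmf)).mul hT).differentiableWithinAt
  have hgc : ∀ w : ℂ, -(2 * η).im - m < w.im → w.im < m → Continuous fun y : ℝ => g (y + w) :=
    fun w h1 h2 => hgd.continuousOn.comp_continuous (by fun_prop) fun y => by
      simpa only [Set.mem_ofPred_eq, add_im, ofReal_im, zero_add] using ⟨h1, h2⟩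
  have hg0 : ∀ y : ℂ, g (y - 2 * η) = -g (-y) := by
    intro y
    simp only [g, gammaShift_sub, logTheta_total_difference hη]
    rw [mul_neg, neg_neg]
    ring_nf
  have hgc0 : Continuous fun y : ℝ => g y := by simpa using hgc 0 (by simp; linarith) (by simpa)
  have hgc1 : Continuous fun y : ℝ => g (-y) := by
    have h := hgc (-(2 * η)) (by rw [neg_im]; linarith) (by rw [neg_im]; linarith)
    simp only [← sub_eq_add_neg, hg0] at h
    simpa using h.fun_neg
  have hint : ∫ y in (0 : ℝ)..1, (g y + g (-y)) = 0 := by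
    have h := integral_add_eq_integral_add hgd hgper (w₁ := 0) (w₂ := -(2 * η))
      ⟨by simp; linarith, by simpa⟩ ⟨by rw [neg_im]; linarith, by rw [neg_im]; linarith⟩
    simp only [add_zero, ← sub_eq_add_neg, hg0, intervalIntegral.integral_neg] at h
    rw [intervalIntegral.integral_add (hgc0.intervalIntegrable _ _) (hgc1.intervalIntegrable _ _), h,
      neg_add_cancel]
  have hcd : logTheta τ (c + d) ≠ 0 := by
    refine logTheta_ne_zero hτ (by rw [add_im]; linarith) ?_
    rw [← hs]
    simp only [add_im]
    linarith
  have hef : logTheta τ (e + f) ≠ 0 := by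
    refine logTheta_ne_zero hτ (by rw [add_im]; linarith) ?_
    rw [← hs]
    simp only [add_im]
    linarith
  have hpt : ∀ y : ℝ,
      logTheta τ (b + c) * logTheta τ (b + d) * logTheta τ (b + e) * logTheta τ (b + f) *
        betaIntegrand τ η (a + 2 * η) b c d e f y -
      logTheta τ (a + c) * logTheta τ (a + d) * logTheta τ (a + e) * logTheta τ (a + f) *
        betaIntegrand τ η a (b + 2 * η) c d e f y =
      -(ee a * logTheta τ (b - a)) * (g y + g (-y)) := by
    intro y
    simp only [g, betaIntegrand, betaWeight, gammaPair_add hτ hη ha, gammaPair_add hτ hη hb,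
      gammaShift_eq hτ hη ha, gammaShift_eq hτ hη hb, gammaShift_eq hτ hη hc,
      gammaShift_eq hτ hη hd, gammaShift_eq hτ hη he, gammaShift_eq hτ hη hf,
      gammaShift_neg hτ hη ha, gammaShift_neg hτ hη hb, gammaShift_neg hτ hη hc,
      gammaShift_neg hτ hη hd, gammaShift_neg hτ hη he, gammaShift_neg hτ hη hf, mul_neg, neg_neg]
    -- The six-term identity requires θ(2y) ≠ 0. Otherwise 2y is an integer and both sides vanish
    -- because of the theta factors in the weight and in g.
    by_cases hy : logTheta τ (2 * y) = 0
    · obtain ⟨n, hn⟩ := exists_int_of_logTheta_eq_zero hτ (x := 2 * y) (by exact_mod_cast hy)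
      have hn' : (2 * y : ℂ) = n := by exact_mod_cast hn
      have hn'' : (-n : ℂ) = (-n : ℤ) := by push_cast; rfl
      rw [hn', hn'', logTheta_int, logTheta_int, logTheta_int]
      ring
    · have h6 := logTheta_six_term hτ hs hy hcd hef
      have h3 : logTheta (2 * η) (2 * y) = -ee y ^ 2 * logTheta (2 * η) (-(2 * y)) := by
        conv_lhs => rw [← neg_neg (2 * (y : ℂ)), logTheta_neg h2, neg_neg, ee_two_mul]
      have h4 : ee (4 * y) = ee y ^ 4 := by simpa using ee_nat_mul 4 y
      have h5 : ee (-y) * ee y = 1 := by rw [← ee_add, neg_add_cancel, ee_zero]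
      rw [h3]
      rw [h4] at h6
      generalize gammaPair τ η a y = A at *
      generalize gammaPair τ η b y = B at *
      generalize gammaPair τ η c y = C at *
      generalize gammaPair τ η d y = D at *
      generalize gammaPair τ η e y = E at *
      generalize gammaPair τ η f y = F at *
      generalize logTheta (2 * η) (-(2 * y)) = T at *
      generalize ee (-y) = Y' at *
      generalize ee (y : ℂ) = Y at *
      linear_combination (A * B * C * D * E * F * T * Y') * h6 +
        (A * B * C * D * E * F * T) * (ee a * logTheta τ (b - a) * Y ^ 3 *
          (logTheta τ (a - y) * logTheta τ (b - y) * (logTheta τ (c - y) * logTheta τ (d - y) *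
            logTheta τ (e - y) * logTheta τ (f - y))) -
          logTheta τ (2 * y) * (logTheta τ (a + y) * logTheta τ (a - y) * (logTheta τ (b + c) *
            logTheta τ (b + d) * logTheta τ (b + e) * logTheta τ (b + f)) -
          logTheta τ (b + y) * logTheta τ (b - y) * (logTheta τ (a + c) *
            logTheta τ (a + d) * logTheta τ (a + e) * logTheta τ (a + f)))) * h5
  rw [← sub_eq_zero, betaIntegral, betaIntegral, ← intervalIntegral.integral_const_mul,
    ← intervalIntegral.integral_const_mul, ← intervalIntegral.integral_sub]
  · simp only [hpt]
    rw [intervalIntegral.integral_const_mul, hint, mul_zero]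
  · exact (continuous_const.mul (continuous_betaIntegrand hτ hη (by rw [add_im]; linarith)
      hb hc hd he hf)).intervalIntegrable _ _
  · exact (continuous_const.mul (continuous_betaIntegrand hτ hη ha (by rw [add_im]; linarith)
      hc hd he hf)).intervalIntegrable _ _

/-! ### Doubly periodic functions on a strip -/

/-- Every point of the strip has a translate, reached inside the strip, in one compact set. Hence
|h| attains its maximum at an interior point, and h is constant by the maximum modulus principle. -/
theorem eq_of_doubly_periodic_on_strip {h : ℂ → ℂ} {H : ℝ} {ω : ℂ} (hω : 0 < ω.im)
    (hωH : ω.im < H) (hd : DifferentiableOn ℂ h {x | 0 < x.im ∧ x.im < H})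
    (h1 : ∀ x, h (x + 1) = h x) (h2 : ∀ x, 0 < x.im → x.im + ω.im < H → h (x + ω) = h x)
    {x y : ℂ} (hx : 0 < x.im ∧ x.im < H) (hy : 0 < y.im ∧ y.im < H) : h x = h y := by
  -- The strip is taller than Im ω, which leaves room for a full closed period δ ≤ Im x ≤ δ + Im ω
  -- in its interior.
  obtain ⟨δ, hδ, hδH⟩ : ∃ δ : ℝ, 0 < δ ∧ δ + ω.im < H := ⟨(H - ω.im) / 2, by linarith, by linarith⟩
  have hstep : ∀ (n : ℕ) (x : ℂ), 0 < x.im → x.im + n * ω.im < H → h (x + n * ω) = h x := by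
    intro n
    induction n with
    | zero => simp
    | succ n ih =>
      intro x hx0 hxn
      have e : x + (n + 1 : ℕ) * ω = (x + n * ω) + ω := by push_cast; ring
      push_cast at hxn
      have hn : 0 ≤ n * ω.im := by positivity
      rw [e, h2, ih x hx0 (by linarith)]
      · simp; linarith
      · simp; linarith
  have him : ∀ x : ℂ, 0 < x.im → x.im < H → ∃ x', δ ≤ x'.im ∧ x'.im ≤ δ + ω.im ∧ h x' = h x := by
    intro x hx0 hxH
    rcases le_total δ x.im with hδx | hδx
    · have hf1 := Nat.floor_le (a := (x.im - δ) / ω.im) (div_nonneg (by linarith) hω.le)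
      have hf2 := Nat.lt_floor_add_one ((x.im - δ) / ω.im)
      set n := ⌊(x.im - δ) / ω.im⌋₊
      rw [le_div_iff₀ hω] at hf1
      rw [div_lt_iff₀ hω] at hf2
      have hi : (x - n * ω).im = x.im - n * ω.im := by simp
      refine ⟨x - n * ω, by rw [hi]; linarith, by rw [hi]; linarith, ?_⟩
      rw [← hstep n (x - n * ω) (by rw [hi]; linarith) (by rw [hi]; linarith), sub_add_cancel]
    · have hf1 := Nat.le_ceil ((δ - x.im) / ω.im)
      have hf2 := Nat.ceil_lt_add_one (a := (δ - x.im) / ω.im) (div_nonneg (by linarith) hω.le)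
      set n := ⌈(δ - x.im) / ω.im⌉₊
      rw [div_le_iff₀ hω] at hf1
      rw [← sub_lt_iff_lt_add, lt_div_iff₀ hω] at hf2
      have hi : (x + n * ω).im = x.im + n * ω.im := by simp
      exact ⟨x + n * ω, by rw [hi]; linarith, by rw [hi]; linarith,
        hstep n x hx0 (by linarith)⟩
  let K : Set ℂ := Set.Icc 0 1 ×ℂ Set.Icc δ (δ + ω.im)
  have hK : IsCompact K := isCompact_Icc.reProdIm isCompact_Icc
  have hrep : ∀ x : ℂ, 0 < x.im → x.im < H → ∃ x' ∈ K, h x' = h x := by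
    intro x hx0 hxH
    obtain ⟨x', h3, h4, h5⟩ := him x hx0 hxH
    refine ⟨x' - ⌊x'.re⌋ • (1 : ℂ), ?_, ?_⟩
    · rw [mem_reProdIm]
      simp only [zsmul_eq_mul, mul_one, sub_re, intCast_re, sub_im, intCast_im, sub_zero]
      exact ⟨⟨by linarith [Int.floor_le x'.re], by linarith [Int.lt_floor_add_one x'.re]⟩, h3, h4⟩
    · rw [← h5]
      exact Function.Periodic.sub_zsmul_eq (f := h) h1 _
  have hKU : K ⊆ {x | 0 < x.im ∧ x.im < H} := by
    intro z hz
    rw [mem_reProdIm] at hz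
    exact ⟨by linarith [hz.2.1], by linarith [hz.2.2]⟩
  obtain ⟨x₀, hx₀, hmax⟩ := hK.exists_isMaxOn
    (by obtain ⟨z, hz, -⟩ := hrep x hx.1 hx.2; exact ⟨z, hz⟩) (hd.continuousOn.mono hKU).norm
  have hU : {x : ℂ | 0 < x.im ∧ x.im < H} = im ⁻¹' Set.Ioo 0 H := rfl
  have hmax' : IsMaxOn (norm ∘ h) {x | 0 < x.im ∧ x.im < H} x₀ := by
    intro z hz
    obtain ⟨z', hz', e⟩ := hrep z hz.1 hz.2
    have := hmax hz'
    simp only [Set.mem_ofPred_eq, e] at this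
    exact this
  have hc := eqOn_of_isPreconnected_of_isMaxOn_norm
    (by
      rw [hU]
      exact ((convex_Ioo 0 H).linear_preimage imLm).isPreconnected)
    (by rw [hU]; exact isOpen_Ioo.preimage continuous_im) hd (hKU hx₀) hmax'
  exact (hc hx).trans (hc hy).symm

end

end EllipticYB

namespace EllipticYB

noncomputable section

open Complex

/-! ### Symmetry and periodicity of the ratio of the two sides of the beta integral -/

variable {τ η : ℂ}

/-- The product `∏_{j < k} Γ(t_j t_k)` over the pairs of six parameters. -/
def betaGammas (τ η a b c d e f : ℂ) : ℂ :=
  logGamma τ η (a + b) *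
    (logGamma τ η (a + c) * logGamma τ η (a + d) * logGamma τ η (a + e) * logGamma τ η (a + f)) *
    (logGamma τ η (b + c) * logGamma τ η (b + d) * logGamma τ η (b + e) * logGamma τ η (b + f)) *
    (logGamma τ η (c + d) * logGamma τ η (c + e) * logGamma τ η (c + f)) *
    (logGamma τ η (d + e) * logGamma τ η (d + f) * logGamma τ η (e + f))

/-- The quotient of the two sides of the elliptic beta integral evaluation. -/
def betaRatio (τ η a b c d e f : ℂ) : ℂ :=
  qPoch (pp τ) (pp τ) * qPoch (qq η) (qq η) / 2 * betaIntegral τ η a b c d e f /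
    betaGammas τ η a b c d e f

theorem betaRatio_swap_first (a b c d e f : ℂ) :
    betaRatio τ η a b c d e f = betaRatio τ η b a c d e f := by
  have h1 : betaIntegral τ η a b c d e f = betaIntegral τ η b a c d e f := by
    refine intervalIntegral.integral_congr fun y _ => ?_
    simp only [betaIntegrand]
    ring
  rw [betaRatio, betaRatio, h1, betaGammas, betaGammas, add_comm b a]
  ring

theorem betaRatio_swap_outer (a b c d e f : ℂ) :
    betaRatio τ η a b c d e f = betaRatio τ η c b a d e f := by
  have h1 : betaIntegral τ η a b c d e f = betaIntegral τ η c b a d e f := by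
    refine intervalIntegral.integral_congr fun y _ => ?_
    simp only [betaIntegrand]
    ring
  rw [betaRatio, betaRatio, h1, betaGammas, betaGammas, add_comm c a, add_comm b a, add_comm c b]
  ring

/-- The sum of two parameters has imaginary part strictly between 0 and Im(τ + 2η), where Γ has
neither zeros nor poles. -/
theorem betaGammas_ne_zero (hτ : 0 < τ.im) (hη : 0 < η.im) {a b c d e f : ℂ} (ha : 0 < a.im)
    (hb : 0 < b.im) (hc : 0 < c.im) (hd : 0 < d.im) (he : 0 < e.im) (hf : 0 < f.im)
    (hs : a + b + c + d + e + f = τ + 2 * η) : betaGammas τ η a b c d e f ≠ 0 := by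
  have hT : (τ + 2 * η).im = a.im + b.im + c.im + d.im + e.im + f.im := by
    rw [← hs]; simp only [add_im]
  have h : ∀ x y : ℂ, 0 < (x + y).im → (x + y).im < (τ + 2 * η).im → logGamma τ η (x + y) ≠ 0 :=
    fun x y => logGamma_ne_zero hτ hη
  rw [hT] at h
  simp only [add_im] at h
  unfold betaGammas
  refine mul_ne_zero (mul_ne_zero (mul_ne_zero (mul_ne_zero (h _ _ ?_ ?_) (mul_ne_zero (mul_ne_zero
    (mul_ne_zero (h _ _ ?_ ?_) (h _ _ ?_ ?_)) (h _ _ ?_ ?_)) (h _ _ ?_ ?_))) (mul_ne_zero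
    (mul_ne_zero (mul_ne_zero (h _ _ ?_ ?_) (h _ _ ?_ ?_)) (h _ _ ?_ ?_)) (h _ _ ?_ ?_)))
    (mul_ne_zero (mul_ne_zero (h _ _ ?_ ?_) (h _ _ ?_ ?_)) (h _ _ ?_ ?_))) (mul_ne_zero
    (mul_ne_zero (h _ _ ?_ ?_) (h _ _ ?_ ?_)) (h _ _ ?_ ?_)) <;> linarith

theorem continuousOn_gammaPair_comp (hτ : 0 < τ.im) (hη : 0 < η.im) {U : Set ℂ} {a : ℂ → ℂ}
    (ha : ContinuousOn a U) (ha' : ∀ s ∈ U, 0 < (a s).im) :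
    ContinuousOn (fun z : ℂ × ℝ => gammaPair τ η (a z.1) z.2) (U ×ˢ Set.univ) := by
  have h1 : ContinuousOn (fun z : ℂ × ℝ => a z.1) (U ×ˢ Set.univ) :=
    ha.comp continuousOn_fst fun z hz => hz.1
  have h2 : ContinuousOn (fun z : ℂ × ℝ => (z.2 : ℂ)) (U ×ˢ Set.univ) := by fun_prop
  exact ((continuousOn_logGamma hτ hη).comp (h1.add h2) fun z hz => by simpa using ha' _ hz.1).mul
    ((continuousOn_logGamma hτ hη).comp (h1.sub h2) fun z hz => by simpa using ha' _ hz.1)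

theorem differentiableOn_logGamma_comp (hτ : 0 < τ.im) (hη : 0 < η.im) {U : Set ℂ} {a : ℂ → ℂ}
    (ha : DifferentiableOn ℂ a U) (ha' : ∀ s ∈ U, 0 < (a s).im) :
    DifferentiableOn ℂ (fun s => logGamma τ η (a s)) U :=
  (differentiableOn_logGamma hτ hη).comp ha ha'

theorem differentiableOn_gammaPair_comp (hτ : 0 < τ.im) (hη : 0 < η.im) {U : Set ℂ} {a : ℂ → ℂ}
    (ha : DifferentiableOn ℂ a U) (ha' : ∀ s ∈ U, 0 < (a s).im) (y : ℝ) :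
    DifferentiableOn ℂ (fun s => gammaPair τ η (a s) y) U :=
  (differentiableOn_logGamma_comp hτ hη (ha.add_const _) fun s hs => by simpa using ha' s hs).mul
    (differentiableOn_logGamma_comp hτ hη (ha.sub_const _) fun s hs => by simpa using ha' s hs)

theorem differentiableOn_betaRatio (hτ : 0 < τ.im) (hη : 0 < η.im) {U : Set ℂ} (hU : IsOpen U)
    {a b c d e f : ℂ → ℂ} (ha : DifferentiableOn ℂ a U) (hb : DifferentiableOn ℂ b U)
    (hc : DifferentiableOn ℂ c U) (hd : DifferentiableOn ℂ d U) (he : DifferentiableOn ℂ e U)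
    (hf : DifferentiableOn ℂ f U) (ha' : ∀ s ∈ U, 0 < (a s).im) (hb' : ∀ s ∈ U, 0 < (b s).im)
    (hc' : ∀ s ∈ U, 0 < (c s).im) (hd' : ∀ s ∈ U, 0 < (d s).im) (he' : ∀ s ∈ U, 0 < (e s).im)
    (hf' : ∀ s ∈ U, 0 < (f s).im) (hs : ∀ s ∈ U, a s + b s + c s + d s + e s + f s = τ + 2 * η) :
    DifferentiableOn ℂ (fun s => betaRatio τ η (a s) (b s) (c s) (d s) (e s) (f s)) U := by
  have hi : DifferentiableOn ℂ (fun s => betaIntegral τ η (a s) (b s) (c s) (d s) (e s) (f s)) U := by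
    refine differentiableOn_intervalIntegral hU ?_ (fun y => ?_) 0 1
    · have hC := fun {x : ℂ → ℂ} (hx : DifferentiableOn ℂ x U) (hx' : ∀ s ∈ U, 0 < (x s).im) =>
        continuousOn_gammaPair_comp hτ hη hx.continuousOn hx'
      exact ((((((hC ha ha').mul (hC hb hb')).mul (hC hc hc')).mul (hC hd hd')).mul
        (hC he he')).mul (hC hf hf')).mul
        ((differentiable_betaWeight hτ hη).continuous.comp (by fun_prop)).continuousOn
    · have hD := fun {x : ℂ → ℂ} (hx : DifferentiableOn ℂ x U) (hx' : ∀ s ∈ U, 0 < (x s).im) =>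
        differentiableOn_gammaPair_comp hτ hη hx hx' y
      exact ((((((hD ha ha').mul (hD hb hb')).mul (hD hc hc')).mul (hD hd hd')).mul
        (hD he he')).mul (hD hf hf')).mul_const _
  have hG := fun {x y : ℂ → ℂ} (hx : DifferentiableOn ℂ x U) (hx' : ∀ s ∈ U, 0 < (x s).im)
      (hy : DifferentiableOn ℂ y U) (hy' : ∀ s ∈ U, 0 < (y s).im) =>
    differentiableOn_logGamma_comp hτ hη (hx.add hy) fun s hs => by
      simpa using add_pos (hx' s hs) (hy' s hs)
  refine (hi.const_mul _).div ?_ fun s hsU => betaGammas_ne_zero hτ hη (ha' s hsU) (hb' s hsU)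
    (hc' s hsU) (hd' s hsU) (he' s hsU) (hf' s hsU) (hs s hsU)
  exact ((((hG ha ha' hb hb').mul ((((hG ha ha' hc hc').mul (hG ha ha' hd hd')).mul
    (hG ha ha' he he')).mul (hG ha ha' hf hf'))).mul ((((hG hb hb' hc hc').mul
    (hG hb hb' hd hd')).mul (hG hb hb' he he')).mul (hG hb hb' hf hf'))).mul
    (((hG hc hc' hd hd').mul (hG hc hc' he he')).mul (hG hc hc' hf hf'))).mul
    (((hG hd hd' he he').mul (hG hd hd' hf hf')).mul (hG he he' hf hf'))

/-- The theta factors produced by Γ(qz) = θ(z) Γ(z) in the product over pairs are exactly those of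
the difference equation of the integral. -/
theorem betaRatio_shift (hτ : 0 < τ.im) (hη : 0 < η.im) {a b c d e f : ℂ} (ha : 0 < a.im)
    (hb : 0 < b.im) (hc : 0 < c.im) (hd : 0 < d.im) (he : 0 < e.im) (hf : 0 < f.im)
    (hs : a + b + c + d + e + f = τ) :
    betaRatio τ η (a + 2 * η) b c d e f = betaRatio τ η a (b + 2 * η) c d e f := by
  have hT : τ.im = a.im + b.im + c.im + d.im + e.im + f.im := by
    rw [← hs]; simp only [add_im]
  have h2 := two_mul_im_pos hη
  have hΘ : ∀ x y : ℂ, 0 < x.im + y.im → x.im + y.im < τ.im → logTheta τ (x + y) ≠ 0 :=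
    fun x y h1 h2 => logTheta_ne_zero hτ (by rwa [add_im]) (by rwa [add_im])
  have hg := fun {x y : ℂ} (hx : 0 < x.im) (hy : 0 < y.im) =>
    (logGamma_add hτ hη (x := x + y) (by rw [add_im]; exact add_pos hx hy))
  have h := betaIntegral_shift hτ hη ha hb hc hd he hf hs
  have hn1 := betaGammas_ne_zero hτ hη (a := a + 2 * η) (by rw [add_im]; linarith) hb hc hd he hf
    (by rw [← hs]; ring)
  have hn2 := betaGammas_ne_zero hτ hη (b := b + 2 * η) ha (by rw [add_im]; linarith) hc hd he hf
    (by rw [← hs]; ring)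
  rw [betaRatio, betaRatio, div_eq_div_iff hn1 hn2]
  simp only [betaGammas, add_right_comm _ (2 * η), ← add_assoc, hg ha hc, hg ha hd, hg ha he,
    hg ha hf, hg hb hc, hg hb hd, hg hb he, hg hb hf]
  generalize betaIntegral τ η (a + 2 * η) b c d e f = X at *
  generalize betaIntegral τ η a (b + 2 * η) c d e f = Y at *
  linear_combination (qPoch (pp τ) (pp τ) * qPoch (qq η) (qq η) / 2 *
    (logGamma τ η (a + b + 2 * η) *
    (logGamma τ η (a + c) * logGamma τ η (a + d) * logGamma τ η (a + e) * logGamma τ η (a + f)) *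
    (logGamma τ η (b + c) * logGamma τ η (b + d) * logGamma τ η (b + e) * logGamma τ η (b + f)) *
    (logGamma τ η (c + d) * logGamma τ η (c + e) * logGamma τ η (c + f)) *
    (logGamma τ η (d + e) * logGamma τ η (d + f) * logGamma τ η (e + f)))) * h

theorem gammaPair_add_one (a y : ℂ) : gammaPair τ η (a + 1) y = gammaPair τ η a y := by
  rw [gammaPair, add_right_comm, logGamma_add_one, add_sub_right_comm, logGamma_add_one, gammaPair]

theorem betaRatio_add_one (a b c d e f : ℂ) :
    betaRatio τ η (a + 1) (b - 1) c d e f = betaRatio τ η a b c d e f := by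
  have hb : ∀ y, gammaPair τ η (b - 1) y = gammaPair τ η b y := fun y => by
    rw [← gammaPair_add_one, sub_add_cancel]
  have h : ∀ x, logGamma τ η (a + 1 + x) = logGamma τ η (a + x) := fun x => by
    rw [add_right_comm, logGamma_add_one]
  have h' : ∀ x, logGamma τ η (b - 1 + x) = logGamma τ η (b + x) := fun x => by
    rw [sub_add_eq_add_sub, logGamma_sub_one]
  have h'' : logGamma τ η (a + (b - 1)) = logGamma τ η (a + b) := by
    rw [← add_sub_assoc, logGamma_sub_one]
  simp only [betaRatio, betaIntegral, betaIntegrand, gammaPair_add_one, hb, betaGammas, h, h', h'']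

/-- For fixed a + b the ratio is a function of a alone on the strip 0 < Im a < Im(a + b), with
periods 1 and 2η. The strip is taller than Im 2η, so the function is constant. -/
theorem betaRatio_eq_of_add_eq (hτ : 0 < τ.im) (hη : 0 < η.im) {a b a' b' c d e f : ℂ}
    (ha : 0 < a.im) (hb : 0 < b.im) (ha' : 0 < a'.im) (hb' : 0 < b'.im) (hc : 0 < c.im)
    (hd : 0 < d.im) (he : 0 < e.im) (hf : 0 < f.im) (hs : a + b + c + d + e + f = τ + 2 * η)
    (hab : a + b = a' + b') (h2 : (2 * η).im < (a + b).im) :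
    betaRatio τ η a b c d e f = betaRatio τ η a' b' c d e f := by
  have hU : IsOpen {x : ℂ | 0 < x.im ∧ x.im < (a + b).im} :=
    (isOpen_lt continuous_const continuous_im).inter (isOpen_lt continuous_im continuous_const)
  have h := eq_of_doubly_periodic_on_strip (h := fun x => betaRatio τ η x (a + b - x) c d e f)
    (H := (a + b).im) (ω := 2 * η) (two_mul_im_pos hη) h2 ?_ (fun x => ?_) (fun x hx1 hx2 => ?_)
    (x := a) (y := a') ⟨ha, by rw [add_im]; linarith⟩ ⟨ha', by rw [hab, add_im]; linarith⟩
  · rw [add_sub_cancel_left, hab, add_sub_cancel_left] at h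
    exact h
  · refine differentiableOn_betaRatio hτ hη hU (by fun_prop) (by fun_prop) (by fun_prop)
      (by fun_prop) (by fun_prop) (by fun_prop) (fun s hs => hs.1) (fun s hs => ?_) (fun _ _ => hc)
      (fun _ _ => hd) (fun _ _ => he) (fun _ _ => hf) (fun s _ => by rw [← hs]; ring)
    rw [sub_im]
    linarith [hs.2]
  · rw [← betaRatio_add_one x]
    congr 1
    ring
  · rw [betaRatio_shift hτ hη hx1 _ hc hd he hf]
    · congr 1
      ring
    · linear_combination hs
    · rw [sub_im, add_im x]
      linarith

end

end EllipticYB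

namespace EllipticYB

noncomputable section

open Complex Filter Topology

/-! ### The Poisson kernel -/

/-- The Poisson kernel with peaks at `y = 1/4` and `y = 3/4`. -/
def peakKernel (r : ℝ) (y : ℝ) : ℂ :=
  (1 - r ^ 2) / ((1 + r * ee (2 * y)) * (1 + r * ee (-(2 * y))))

theorem one_add_mul_ee_ne_zero {r : ℝ} (h0 : 0 ≤ r) (h1 : r < 1) (y : ℝ) :
    1 + r * ee (y : ℂ) ≠ 0 := by
  rw [← sub_neg_eq_add]
  refine one_sub_ne_zero_of_norm_lt ?_
  rwa [norm_neg, norm_mul, norm_ee_ofReal, mul_one, norm_real, Real.norm_eq_abs, abs_of_nonneg h0]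

theorem continuous_peakKernel {r : ℝ} (h0 : 0 ≤ r) (h1 : r < 1) : Continuous (peakKernel r) := by
  have hc := continuous_ee
  refine continuous_const.div (by fun_prop) fun y => mul_ne_zero ?_ ?_
  · exact_mod_cast one_add_mul_ee_ne_zero h0 h1 (2 * y)
  · exact_mod_cast one_add_mul_ee_ne_zero h0 h1 (-(2 * y))

theorem one_add_mul_ee_neg (r y : ℝ) :
    1 + r * ee (-(2 * y)) = (starRingEnd ℂ) (1 + r * ee (2 * y)) := by
  have : (starRingEnd ℂ) (ee (2 * y)) = ee (-(2 * y)) := by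
    rw [ee, ← exp_conj, ee]
    congr 1
    simp only [map_mul, conj_ofReal, conj_I, map_ofNat]
    ring
  rw [map_add, map_one, map_mul, conj_ofReal, this]

theorem norm_peakKernel {r : ℝ} (h0 : 0 ≤ r) (h1 : r < 1) (y : ℝ) :
    ‖peakKernel r y‖ = (1 - r ^ 2) / ‖1 + r * ee (2 * y)‖ ^ 2 := by
  have hc := one_add_mul_ee_neg r y
  have h2 : (1 - r ^ 2 : ℂ) = ((1 - r ^ 2 : ℝ) : ℂ) := by push_cast; rfl
  rw [peakKernel, norm_div, norm_mul, hc, RCLike.norm_conj, ← sq, h2, norm_real, Real.norm_eq_abs,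
    abs_of_nonneg (by nlinarith)]

theorem peakKernel_eq_norm {r : ℝ} (h0 : 0 ≤ r) (h1 : r < 1) (y : ℝ) :
    peakKernel r y = (‖peakKernel r y‖ : ℂ) := by
  have hc := one_add_mul_ee_neg r y
  rw [norm_peakKernel h0 h1, peakKernel, hc, mul_conj']
  push_cast
  rfl

/-- By partial fractions the kernel is 1/(1 + r e(2y)) + 1/(1 + r e(-2y)) - 1. Both fractions have
integral 1: the mean value property of (1 + r z²)⁻¹ on the unit disc gives the first, and y ↦ 1 - y
the second. -/
theorem integral_peakKernel {r : ℝ} (h0 : 0 ≤ r) (h1 : r < 1) :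
    ∫ y in (0 : ℝ)..1, peakKernel r y = 1 := by
  have hne : ∀ z ∈ Metric.closedBall (0 : ℂ) |1|, 1 + r * z ^ 2 ≠ 0 := by
    intro z hz
    rw [← sub_neg_eq_add]
    refine one_sub_ne_zero_of_norm_lt ?_
    rw [abs_one, mem_closedBall_zero_iff] at hz
    rw [norm_neg, norm_mul, norm_pow, norm_real, Real.norm_eq_abs, abs_of_nonneg h0]
    have : ‖z‖ ^ 2 ≤ 1 := pow_le_one₀ (norm_nonneg z) hz
    nlinarith
  have hmean : ∫ y in (0 : ℝ)..1, (1 + r * ee (2 * y))⁻¹ = 1 := by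
    have h := circleAverage_of_differentiable_on_off_countable (f := fun z => (1 + r * z ^ 2)⁻¹)
      (c := 0) (R := 1) Set.countable_empty
      (ContinuousOn.inv₀ (by fun_prop) hne) fun z hz => by
        have hz' := hne z (Metric.ball_subset_closedBall hz.1)
        fun_prop (disch := assumption)
    simp only [ne_eq, OfNat.ofNat_ne_zero, not_false_eq_true, zero_pow, mul_zero, add_zero,
      inv_one] at h
    have h2 := intervalIntegral.integral_comp_mul_left (a := 0) (b := 1)
      (fun θ : ℝ => (1 + r * circleMap 0 1 θ ^ 2)⁻¹) (c := 2 * Real.pi) (by positivity)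
    rw [mul_zero, mul_one] at h2
    rw [Real.circleAverage, ← h2] at h
    rw [← h]
    refine intervalIntegral.integral_congr fun y _ => ?_
    rw [ee_two_mul, circleMap_zero, ofReal_one, one_mul, ee]
    push_cast
    congr 5
    ring
  have hmean' : ∫ y in (0 : ℝ)..1, (1 + r * ee (-(2 * y)))⁻¹ = 1 := by
    refine Eq.trans ?_ hmean
    have h := intervalIntegral.integral_comp_sub_left (a := 0) (b := 1)
      (fun y : ℝ => (1 + r * ee (2 * y))⁻¹) 1
    rw [sub_self, sub_zero] at h
    refine Eq.trans ?_ h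
    refine intervalIntegral.integral_congr fun y _ => ?_
    have e : (2 * ((1 - y : ℝ) : ℂ)) = -(2 * y) + 1 + 1 := by push_cast; ring
    rw [e, ee_add_one, ee_add_one]
  have hc := continuous_ee
  have n1 : ∀ y : ℝ, 1 + r * ee (2 * y) ≠ 0 := fun y => by
    exact_mod_cast one_add_mul_ee_ne_zero h0 h1 (2 * y)
  have n2 : ∀ y : ℝ, 1 + r * ee (-(2 * y)) ≠ 0 := fun y => by
    exact_mod_cast one_add_mul_ee_ne_zero h0 h1 (-(2 * y))
  have c1 : Continuous fun y : ℝ => (1 + r * ee (2 * y))⁻¹ :=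
    Continuous.inv₀ (by fun_prop) n1
  have c2 : Continuous fun y : ℝ => (1 + r * ee (-(2 * y)))⁻¹ :=
    Continuous.inv₀ (by fun_prop) n2
  have e : ∀ y : ℝ, peakKernel r y = (1 + r * ee (2 * y))⁻¹ + (1 + r * ee (-(2 * y)))⁻¹ - 1 := by
    intro y
    have h3 : ee (2 * y) * ee (-(2 * y)) = 1 := by rw [← ee_add, add_neg_cancel, ee_zero]
    have := n1 y
    have := n2 y
    rw [peakKernel]
    field_simp
    linear_combination (r ^ 2 : ℂ) * h3
  simp only [e]
  rw [intervalIntegral.integral_sub ((c1.fun_add c2).intervalIntegrable _ _)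
    (continuous_const.intervalIntegrable _ _), intervalIntegral.integral_add
    (c1.intervalIntegrable _ _) (c2.intervalIntegrable _ _), hmean, hmean']
  simp

theorem integral_norm_peakKernel {r : ℝ} (h0 : 0 ≤ r) (h1 : r < 1) :
    ∫ y in (0 : ℝ)..1, ‖peakKernel r y‖ = 1 := by
  have h := integral_peakKernel h0 h1
  rw [intervalIntegral.integral_congr fun y _ => peakKernel_eq_norm h0 h1 y,
    intervalIntegral.integral_ofReal] at h
  exact_mod_cast h

/-- Since |1 + e(2y)| ≤ 2 |1 + r e(2y)|, the factor |1 + e(2y)|² compensates the denominator of the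
kernel. So the kernel tends to 0 uniformly away from the peaks as r → 1. -/
theorem norm_peakKernel_mul_le {r : ℝ} (h0 : 0 ≤ r) (h1 : r < 1) (y : ℝ) :
    ‖peakKernel r y‖ * ‖1 + ee (2 * y)‖ ^ 2 ≤ 4 * (1 - r ^ 2) := by
  have hn : 0 < ‖1 + r * ee (2 * (y : ℂ))‖ := norm_pos_iff.2 (by
    exact_mod_cast one_add_mul_ee_ne_zero h0 h1 (2 * y))
  have h2 : ‖ee (2 * (y : ℂ))‖ = 1 := by exact_mod_cast norm_ee_ofReal (2 * y)
  have h3 : ‖(r : ℂ) * ee (2 * y)‖ = r := by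
    rw [norm_mul, h2, mul_one, norm_real, Real.norm_eq_abs, abs_of_nonneg h0]
  have h4 : 1 - r ≤ ‖1 + r * ee (2 * (y : ℂ))‖ := by
    have := norm_sub_le (1 + r * ee (2 * (y : ℂ))) (r * ee (2 * y))
    rw [add_sub_cancel_right, norm_one, h3] at this
    linarith
  have h5 : ‖1 + ee (2 * (y : ℂ))‖ ≤ 2 * ‖1 + r * ee (2 * (y : ℂ))‖ := by
    have h6 : 1 + ee (2 * (y : ℂ)) = (1 + r * ee (2 * (y : ℂ))) + ((1 - r : ℝ) : ℂ) * ee (2 * y) := by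
      push_cast; ring
    have h7 := norm_add_le (1 + r * ee (2 * (y : ℂ))) (((1 - r : ℝ) : ℂ) * ee (2 * y))
    rw [← h6, norm_mul, h2, mul_one, norm_real, Real.norm_eq_abs, abs_of_nonneg (by linarith)] at h7
    linarith
  rw [norm_peakKernel h0 h1, div_mul_eq_mul_div, div_le_iff₀ (by positivity)]
  have h8 : ‖1 + ee (2 * (y : ℂ))‖ ^ 2 ≤ (2 * ‖1 + r * ee (2 * (y : ℂ))‖) ^ 2 :=
    pow_le_pow_left₀ (norm_nonneg _) h5 2
  have h9 : 0 ≤ 1 - r ^ 2 := by nlinarith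
  nlinarith [mul_le_mul_of_nonneg_left h8 h9]

/-- The kernel is an approximate identity with two peaks. The mass at each peak is not needed,
because Φ 0 takes the same value L at both. Uniform continuity allows Φ to vary with ε. -/
theorem tendsto_integral_peakKernel {r : ℝ → ℝ} (hr0 : ∀ᶠ ε in 𝓝[>] 0, 0 ≤ r ε ∧ r ε < 1)
    (hr1 : Tendsto r (𝓝[>] 0) (𝓝 1)) {ε₀ : ℝ} (hε₀ : 0 < ε₀) {Φ : ℝ → ℝ → ℂ}
    (hΦ : ContinuousOn (Function.uncurry Φ) (Set.Icc 0 ε₀ ×ˢ Set.Icc 0 1)) {L : ℂ}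
    (h1 : Φ 0 (1 / 4) = L) (h3 : Φ 0 (3 / 4) = L) :
    Tendsto (fun ε => ∫ y in (0 : ℝ)..1, peakKernel (r ε) y * Φ ε y) (𝓝[>] 0) (𝓝 L) := by
  have hcomp : IsCompact (Set.Icc (0 : ℝ) ε₀ ×ˢ Set.Icc (0 : ℝ) 1) := isCompact_Icc.prod isCompact_Icc
  obtain ⟨C, hC⟩ := hcomp.exists_bound_of_continuousOn (hΦ.sub (continuousOn_const (c := L)))
  rw [Metric.tendsto_nhds]
  intro δ hδ
  -- near the peaks `Φ` is close to `L`
  have huc := hcomp.uniformContinuousOn_of_continuous hΦ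
  rw [Metric.uniformContinuousOn_iff] at huc
  obtain ⟨κ, hκ, hκ'⟩ := huc (δ / 2) (by linarith)
  -- away from the peaks `1 + e^{4πiy}` is bounded below
  obtain ⟨m, hm, hm'⟩ : ∃ m : ℝ, 0 < m ∧ ∀ y ∈ Set.Icc (0 : ℝ) 1, κ ≤ |y - 1 / 4| →
      κ ≤ |y - 3 / 4| → m ≤ ‖1 + ee (2 * (y : ℂ))‖ := by
    have hc := continuous_ee
    have hK : IsCompact {y : ℝ | y ∈ Set.Icc (0 : ℝ) 1 ∧ κ ≤ |y - 1 / 4| ∧ κ ≤ |y - 3 / 4|} :=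
      isCompact_Icc.inter_right
        ((isClosed_le continuous_const (by fun_prop : Continuous fun y : ℝ => |y - 1 / 4|)).inter
        (isClosed_le continuous_const (by fun_prop : Continuous fun y : ℝ => |y - 3 / 4|)))
    by_cases hne : {y : ℝ | y ∈ Set.Icc (0 : ℝ) 1 ∧ κ ≤ |y - 1 / 4| ∧ κ ≤ |y - 3 / 4|}.Nonempty
    · obtain ⟨y₀, hy₀, hmin⟩ := hK.exists_isMinOn hne
        (f := fun y : ℝ => ‖1 + ee (2 * (y : ℂ))‖) (by fun_prop)
      refine ⟨‖1 + ee (2 * (y₀ : ℂ))‖, norm_pos_iff.2 fun h => ?_,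
        fun y hy h1 h3 => hmin ⟨hy, h1, h3⟩⟩
      have h2 : ee (2 * y₀ - 1 / 2) = 1 := by
        have h4 : ee (1 / 2) = -1 := by
          rw [ee, ← exp_pi_mul_I]
          congr 1
          ring
        rw [ee_sub, h4]
        linear_combination -h
      obtain ⟨n, hn⟩ := exists_int_of_ee_eq_one h2
      have hn' : 2 * y₀ - 1 / 2 = n := by
        apply ofReal_injective
        push_cast
        exact hn
      have hn0 : (-1 : ℝ) < n := by rw [← hn']; linarith [hy₀.1.1]
      have hn1 : (n : ℝ) < 2 := by rw [← hn']; linarith [hy₀.1.2]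
      have hn0' : -1 < n := by exact_mod_cast hn0
      have hn1' : n < 2 := by exact_mod_cast hn1
      obtain rfl | rfl : n = 0 ∨ n = 1 := by omega
      · have : y₀ - 1 / 4 = 0 := by push_cast at hn'; linarith
        have h' := hy₀.2.1
        rw [this, abs_zero] at h'
        linarith
      · have : y₀ - 3 / 4 = 0 := by push_cast at hn'; linarith
        have h' := hy₀.2.2
        rw [this, abs_zero] at h'
        linarith
    · exact ⟨1, one_pos, fun y hy h1 h3 => (hne ⟨y, hy, h1, h3⟩).elim⟩
  have hC0 : 0 ≤ C := (norm_nonneg _).trans (hC (0, 0) ⟨⟨le_rfl, hε₀.le⟩, ⟨le_rfl, zero_le_one⟩⟩)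
  have hlim : Tendsto (fun ε => C / m ^ 2 * (4 * (1 - r ε ^ 2))) (𝓝[>] 0) (𝓝 0) := by
    have := ((((hr1.pow 2).const_sub 1).const_mul 4).const_mul (C / m ^ 2))
    simpa using this
  filter_upwards [hr0, hlim.eventually_lt_const (show (0 : ℝ) < δ / 2 by linarith),
    self_mem_nhdsWithin, nhdsWithin_le_nhds (Iio_mem_nhds hκ),
    nhdsWithin_le_nhds (Iic_mem_nhds hε₀)] with ε hrε hlimε hε0 hεκ hεε₀
  have hε0' : 0 < ε := hε0
  have hεκ' : ε < κ := hεκ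
  have hcP := continuous_peakKernel hrε.1 hrε.2
  have hcΦ : ContinuousOn (Φ ε) (Set.uIcc 0 1) := by
    rw [Set.uIcc_of_le zero_le_one]
    exact hΦ.comp (f := fun y => (ε, y)) (by fun_prop) fun y hy => ⟨⟨hε0'.le, hεε₀⟩, hy⟩
  -- A single bound for all y: the first summand covers the neighbourhoods of the peaks, and the
  -- second is at least C away from them because |1 + e(2y)| ≥ m there.
  have hpt : ∀ y ∈ Set.Icc (0 : ℝ) 1, ‖Φ ε y - L‖ ≤ δ / 2 + C / m ^ 2 * ‖1 + ee (2 * (y : ℂ))‖ ^ 2 := by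
    intro y hy
    by_cases hy1 : |y - 1 / 4| < κ
    · have := hκ' (ε, y) ⟨⟨hε0'.le, hεε₀⟩, hy⟩ (0, 1 / 4) ⟨⟨le_rfl, hε₀.le⟩, by norm_num⟩ (by
        rw [Prod.dist_eq, max_lt_iff, Real.dist_eq, Real.dist_eq, sub_zero, abs_of_pos hε0']
        exact ⟨hεκ', hy1⟩)
      rw [dist_eq] at this
      simp only [Function.uncurry, h1] at this
      have : 0 ≤ C / m ^ 2 * ‖1 + ee (2 * (y : ℂ))‖ ^ 2 := by positivity
      linarith
    · by_cases hy3 : |y - 3 / 4| < κ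
      · have := hκ' (ε, y) ⟨⟨hε0'.le, hεε₀⟩, hy⟩ (0, 3 / 4) ⟨⟨le_rfl, hε₀.le⟩, by norm_num⟩ (by
          rw [Prod.dist_eq, max_lt_iff, Real.dist_eq, Real.dist_eq, sub_zero, abs_of_pos hε0']
          exact ⟨hεκ', hy3⟩)
        rw [dist_eq] at this
        simp only [Function.uncurry, h3] at this
        have : 0 ≤ C / m ^ 2 * ‖1 + ee (2 * (y : ℂ))‖ ^ 2 := by positivity
        linarith
      · have h5 := hm' y hy (not_lt.1 hy1) (not_lt.1 hy3)
        have h6 := hC (ε, y) ⟨⟨hε0'.le, hεε₀⟩, hy⟩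
        have h7 : C ≤ C / m ^ 2 * ‖1 + ee (2 * (y : ℂ))‖ ^ 2 := by
          rw [div_mul_eq_mul_div, le_div_iff₀ (by positivity)]
          gcongr
        simp only [Function.uncurry, Pi.sub_apply] at h6
        linarith
  have heq : (∫ y in (0 : ℝ)..1, peakKernel (r ε) y * Φ ε y) - L =
      ∫ y in (0 : ℝ)..1, peakKernel (r ε) y * (Φ ε y - L) := by
    have h6 : ∫ y in (0 : ℝ)..1, peakKernel (r ε) y * L = L := by
      rw [intervalIntegral.integral_mul_const, integral_peakKernel hrε.1 hrε.2, one_mul]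
    simp only [mul_sub]
    rw [intervalIntegral.integral_sub ((hcP.continuousOn.fun_mul hcΦ).intervalIntegrable)
      ((hcP.fun_mul continuous_const).intervalIntegrable _ _), h6]
  rw [dist_eq, heq]
  calc _ ≤ ∫ y in (0 : ℝ)..1, (δ / 2 * ‖peakKernel (r ε) y‖ + C / m ^ 2 * (4 * (1 - r ε ^ 2))) := by
        refine intervalIntegral.norm_integral_le_of_norm_le zero_le_one
          (Eventually.of_forall fun y hy => ?_)
          (((continuous_const.mul hcP.norm).add continuous_const).intervalIntegrable _ _)
        rw [norm_mul]
        have h6 := mul_le_mul_of_nonneg_left (hpt y ⟨hy.1.le, hy.2⟩) (norm_nonneg (peakKernel (r ε) y))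
        have h7 := mul_le_mul_of_nonneg_left (norm_peakKernel_mul_le hrε.1 hrε.2 y)
          (show 0 ≤ C / m ^ 2 by positivity)
        linarith
    _ = δ / 2 + C / m ^ 2 * (4 * (1 - r ε ^ 2)) := by
        rw [intervalIntegral.integral_add ((continuous_const.fun_mul hcP.norm).intervalIntegrable _ _)
          (continuous_const.intervalIntegrable _ _), intervalIntegral.integral_const_mul,
          integral_norm_peakKernel hrε.1 hrε.2]
        simp
    _ < δ := by linarith

end

end EllipticYB

namespace EllipticYB

noncomputable section

open Complex Filter Topology

/-! ### The pinching limit of the beta integral -/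

variable {τ η : ℂ}

/-- The regular part `(1 - z) Γ(z)`, `z = e^{2πix}`, of the elliptic gamma function at `z = 1`. -/
def regGamma (τ η x : ℂ) : ℂ :=
  qPoch₂ (pp τ) (qq η) (ee (τ + 2 * η - x)) /
    (qPoch (pp τ * ee x) (pp τ) * qPoch₂ (pp τ) (qq η) (qq η * ee x))

theorem logGamma_eq_regGamma_div (hτ : 0 < τ.im) (hη : 0 < η.im) (x : ℂ) :
    logGamma τ η x = regGamma τ η x / (1 - ee x) := by
  rw [logGamma_eq_div hτ hη, qPoch₂_eq (norm_pp_lt_one hτ) (norm_qq_lt_one hη) (ee x),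
    qPoch_eq (norm_pp_lt_one hτ), regGamma, div_div]
  congr 1
  ring

theorem norm_mul_ee_lt_one {p x : ℂ} (hp : ‖p‖ < 1) (hx : 0 ≤ x.im) : ‖p * ee x‖ < 1 := by
  have : ‖ee x‖ ≤ 1 := by
    rw [norm_ee, Real.exp_le_one_iff]
    have := Real.pi_pos
    simp only [Left.neg_nonpos_iff]
    positivity
  rw [norm_mul]
  exact mul_lt_one_of_nonneg_of_lt_one_left (norm_nonneg _) hp this

theorem continuousOn_regGamma (hτ : 0 < τ.im) (hη : 0 < η.im) :
    ContinuousOn (regGamma τ η) {x | 0 ≤ x.im} := by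
  have hp := norm_pp_lt_one hτ
  have hq := norm_qq_lt_one hη
  have h1 := (differentiable_qPoch hp).continuous
  have h2 := (differentiable_qPoch₂ hp hq).continuous
  have hc := continuous_ee
  refine ContinuousOn.div (by fun_prop) (by fun_prop) fun x hx => mul_ne_zero ?_ ?_
  · exact qPoch_ne_zero_of_norm_lt hp (norm_mul_ee_lt_one hp hx)
  · exact qPoch₂_ne_zero_of_norm_lt hp hq (norm_mul_ee_lt_one hq hx)

theorem regGamma_zero (hτ : 0 < τ.im) (hη : 0 < η.im) :
    regGamma τ η 0 * (qPoch (pp τ) (pp τ) * qPoch (qq η) (qq η)) = 1 := by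
  have hp := norm_pp_lt_one hτ
  have hq := norm_qq_lt_one hη
  rw [regGamma, ee_zero, mul_one, mul_one, sub_zero, qPoch₂_comm _ _ (qq η), qPoch₂_eq hq hp,
    ← pp_mul_qq, qPoch₂_comm (qq η)]
  have h1 := qPoch_ne_zero_of_norm_lt hp hp
  have h2 := qPoch_ne_zero_of_norm_lt hq hq
  have h3 : qPoch₂ (pp τ) (qq η) (pp τ * qq η) ≠ 0 := qPoch₂_ne_zero_of_norm_lt hp hq (by
    rw [pp_mul_qq]
    refine norm_ee_lt_one.2 ?_
    have := two_mul_im_pos hη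
    rw [add_im]
    linarith)
  field_simp

theorem regGamma_add_one (x : ℂ) : regGamma τ η (x + 1) = regGamma τ η x := by
  have : ee (τ + 2 * η - (x + 1)) = ee (τ + 2 * η - x) := by
    rw [← ee_add_one]
    congr 1
    ring
  rw [regGamma, this, ee_add_one, regGamma]

theorem ee_one_div_two : ee (1 / 2) = -1 := by
  rw [ee, ← exp_pi_mul_I]
  congr 1
  ring

/-- At z = -1 the regular part is 2 Γ(-1), while the weight at x = i is 1 / Γ(-1)². -/
theorem regGamma_one_div_two (hτ : 0 < τ.im) (hη : 0 < η.im) :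
    regGamma τ η (1 / 2) ^ 2 * betaWeight τ η (1 / 4) = 4 := by
  have h1 := betaWeight_ofReal hτ hη (1 / 4)
  have h2 : ((1 / 4 : ℝ) : ℂ) = 1 / 4 := by push_cast; rfl
  have h3 : ee (1 / 4) ^ 2 = ee (1 / 2) := by
    rw [← ee_two_mul]
    congr 1
    ring
  have h4 : (ee (1 / 2))⁻¹ = ee (1 / 2) := by rw [ee_one_div_two]; norm_num
  rw [h2, gammaSq, h3, h4] at h1
  have h5 : betaWeight τ η (1 / 4) ≠ 0 := by
    have : ee (-(1 / 2)) = -1 := by rw [ee_neg, ee_one_div_two]; norm_num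
    rw [betaWeight, show (2 * (1 / 4) : ℂ) = 1 / 2 by norm_num, logTheta, logTheta, this,
      ee_one_div_two]
    exact mul_ne_zero
      (theta_ne_zero_of_norm_eq_one (norm_ee_lt_one.2 hτ) (by simp) (by norm_num))
      (theta_ne_zero_of_norm_eq_one (norm_ee_lt_one.2 (two_mul_im_pos hη)) (by simp) (by norm_num))
  have h6 := logGamma_eq_regGamma_div hτ hη (1 / 2)
  rw [logGamma, ee_one_div_two] at h6
  rw [ee_one_div_two] at h1
  have h7 : regGamma τ η (1 / 2) = 2 * ellGamma (pp τ) (qq η) (-1) := by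
    rw [h6]; ring
  rw [h1] at h5
  have h8 := fun h => h5 (inv_eq_zero.2 h)
  rw [h7, h1]
  field_simp [left_ne_zero_of_mul h8]
  ring

/-- The continuous part of the beta integrand with parameters `1/4 + iε`, `-1/4 + iε`. -/
def pinchPart (τ η c d e f : ℂ) (ε y : ℝ) : ℂ :=
  regGamma τ η (1 / 4 + ε * I + y) * regGamma τ η (1 / 4 + ε * I - y) *
    regGamma τ η (-1 / 4 + ε * I + y) * regGamma τ η (-1 / 4 + ε * I - y) *
    (gammaPair τ η c y * gammaPair τ η d y * gammaPair τ η e y *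
      gammaPair τ η (f - 2 * ε * I) y * betaWeight τ η y)

/-- With parameters ±i e^{-2πε}, the polar factors combine in pairs to 1 + r e(±2y), r = e^{-4πε},
so that 1 - r² times their reciprocal is the Poisson kernel. The pinching takes place at x = ±i,
away from the zeros x = ±1 of the weight. -/
theorem betaIntegrand_pinch (hτ : 0 < τ.im) (hη : 0 < η.im) (c d e f : ℂ)
    (ε y : ℝ) :
    (1 - Real.exp (-(4 * Real.pi * ε)) ^ 2) *
        betaIntegrand τ η (1 / 4 + ε * I) (-1 / 4 + ε * I) c d e (f - 2 * ε * I) y =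
      peakKernel (Real.exp (-(4 * Real.pi * ε))) y * pinchPart τ η c d e f ε y := by
  have hI : ee (1 / 4) = I := by
    rw [ee, show 2 * Real.pi * I * (1 / 4) = Real.pi / 2 * I by ring, exp_pi_div_two_mul_I]
  have hI' : ee (-1 / 4) = -I := by
    rw [neg_div, ee_neg, hI, inv_I]
  have hr : ((Real.exp (-(4 * Real.pi * ε)) : ℝ) : ℂ) = ee (ε * I) ^ 2 := by
    rw [← ee_two_mul, ee, ofReal_exp]
    congr 1
    push_cast
    linear_combination (-(4 * Real.pi * ε) : ℂ) * I_sq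
  have h1 : (1 - ee (1 / 4 + ε * I + y)) * (1 - ee (-1 / 4 + ε * I + y)) =
      1 + Real.exp (-(4 * Real.pi * ε)) * ee (2 * y) := by
    rw [hr, ee_add, ee_add, ee_add, ee_add, hI, hI', ee_two_mul]
    linear_combination (-(ee (ε * I) * ee y) ^ 2) * I_sq
  have h2 : (1 - ee (1 / 4 + ε * I - y)) * (1 - ee (-1 / 4 + ε * I - y)) =
      1 + Real.exp (-(4 * Real.pi * ε)) * ee (-(2 * y)) := by
    rw [hr, ee_sub, ee_sub, ee_add, ee_add, hI, hI', ee_neg, ee_two_mul, ← inv_pow]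
    linear_combination (-(ee (ε * I) * (ee y)⁻¹) ^ 2) * I_sq
  rw [peakKernel, betaIntegrand, pinchPart, gammaPair, gammaPair, ← h1, ← h2]
  simp only [logGamma_eq_regGamma_div hτ hη (1 / 4 + ε * I + y),
    logGamma_eq_regGamma_div hτ hη (1 / 4 + ε * I - y),
    logGamma_eq_regGamma_div hτ hη (-1 / 4 + ε * I + y),
    logGamma_eq_regGamma_div hτ hη (-1 / 4 + ε * I - y)]
  simp only [div_eq_mul_inv, mul_inv]
  ring

theorem continuousOn_pinchPart (hτ : 0 < τ.im) (hη : 0 < η.im) {c d e f : ℂ} (hc : 0 < c.im)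
    (hd : 0 < d.im) (he : 0 < e.im) {ε₀ : ℝ} (hf : 2 * ε₀ < f.im) :
    ContinuousOn (Function.uncurry (pinchPart τ η c d e f)) (Set.Icc 0 ε₀ ×ˢ Set.Icc 0 1) := by
  have hr : ∀ {g : ℝ × ℝ → ℂ}, Continuous g →
      (∀ z ∈ Set.Icc 0 ε₀ ×ˢ Set.Icc (0 : ℝ) 1, 0 ≤ (g z).im) →
      ContinuousOn (fun z => regGamma τ η (g z)) (Set.Icc 0 ε₀ ×ˢ Set.Icc 0 1) :=
    fun hg h => (continuousOn_regGamma hτ hη).comp hg.continuousOn h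
  have hl : ∀ {g : ℝ × ℝ → ℂ}, Continuous g →
      (∀ z ∈ Set.Icc 0 ε₀ ×ˢ Set.Icc (0 : ℝ) 1, 0 < (g z).im) →
      ContinuousOn (fun z => logGamma τ η (g z)) (Set.Icc 0 ε₀ ×ˢ Set.Icc 0 1) :=
    fun hg h => (continuousOn_logGamma hτ hη).comp hg.continuousOn h
  have hw : ContinuousOn (fun z : ℝ × ℝ => betaWeight τ η z.2) (Set.Icc 0 ε₀ ×ˢ Set.Icc 0 1) :=
    ((continuous_betaWeight hτ hη).comp continuous_snd).continuousOn
  unfold Function.uncurry pinchPart gammaPair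
  refine ((((hr (by fun_prop) ?_).mul (hr (by fun_prop) ?_)).mul (hr (by fun_prop) ?_)).mul
    (hr (by fun_prop) ?_)).mul ((((((hl (by fun_prop) ?_).mul (hl (by fun_prop) ?_)).mul
    ((hl (by fun_prop) ?_).mul (hl (by fun_prop) ?_))).mul ((hl (by fun_prop) ?_).mul
    (hl (by fun_prop) ?_))).mul ((hl (by fun_prop) ?_).mul (hl (by fun_prop) ?_))).mul hw)
  all_goals
    rintro ⟨ε, y⟩ ⟨⟨h1, h2⟩, -⟩
    simp
    try linarith

/-- The factors of `betaGammas` that do not involve `a + b`. -/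
def betaGammasRest (τ η a b c d e f : ℂ) : ℂ :=
    (logGamma τ η (a + c) * logGamma τ η (a + d) * logGamma τ η (a + e) * logGamma τ η (a + f)) *
    (logGamma τ η (b + c) * logGamma τ η (b + d) * logGamma τ η (b + e) * logGamma τ η (b + f)) *
    (logGamma τ η (c + d) * logGamma τ η (c + e) * logGamma τ η (c + f)) *
    (logGamma τ η (d + e) * logGamma τ η (d + f) * logGamma τ η (e + f))

theorem betaGammas_eq_mul (a b c d e f : ℂ) :
    betaGammas τ η a b c d e f = logGamma τ η (a + b) * betaGammasRest τ η a b c d e f := by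
  rw [betaGammas, betaGammasRest]
  ring

theorem pinchPart_zero_one_div_four (c d e f : ℂ) :
    pinchPart τ η c d e f 0 (1 / 4) =
      regGamma τ η 0 ^ 2 * (regGamma τ η (1 / 2) ^ 2 * betaWeight τ η (1 / 4)) *
        (gammaPair τ η c (1 / 4) * gammaPair τ η d (1 / 4) * gammaPair τ η e (1 / 4) *
          gammaPair τ η f (1 / 4)) := by
  have h : regGamma τ η (-1 / 4 - 1 / 4) = regGamma τ η (1 / 2) := by
    rw [← regGamma_add_one]
    congr 1
    norm_num
  rw [pinchPart]
  push_cast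
  simp only [zero_mul, mul_zero, add_zero, sub_zero, h]
  rw [show (1 / 4 + 1 / 4 : ℂ) = 1 / 2 by norm_num, show (1 / 4 - 1 / 4 : ℂ) = 0 by norm_num,
    show (-1 / 4 + 1 / 4 : ℂ) = 0 by norm_num]
  ring

/-- Modulo 1 the point 3/4 is -1/4, and the expression is invariant under y ↦ -y. -/
theorem pinchPart_zero_three_div_four (c d e f : ℂ) :
    pinchPart τ η c d e f 0 (3 / 4) = pinchPart τ η c d e f 0 (1 / 4) := by
  have h1 : regGamma τ η (1 / 4 + 3 / 4) = regGamma τ η 0 := by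
    rw [← regGamma_add_one 0]
    congr 1
    norm_num
  have h2 : regGamma τ η (1 / 4 - 3 / 4) = regGamma τ η (1 / 2) := by
    rw [← regGamma_add_one (1 / 4 - 3 / 4)]
    congr 1
    norm_num
  have h3 : regGamma τ η (-1 / 4 - 3 / 4) = regGamma τ η 0 := by
    rw [← regGamma_add_one]
    congr 1
    norm_num
  have h4 : ∀ x : ℂ, gammaPair τ η x (3 / 4) = gammaPair τ η x (1 / 4) := fun x => by
    rw [gammaPair, gammaPair, show x + 3 / 4 = x - 1 / 4 + 1 by ring, logGamma_add_one,
      ← logGamma_add_one (x - 3 / 4), show x - 3 / 4 + 1 = x + 1 / 4 by ring, mul_comm]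
  have h5 : betaWeight τ η (3 / 4) = betaWeight τ η (1 / 4) := by
    have h6 : ∀ σ x : ℂ, logTheta σ (x + 1) = logTheta σ x := fun σ x => by
      rw [logTheta, logTheta, ee_add_one]
    rw [betaWeight, betaWeight, show (2 * (3 / 4) : ℂ) = 2 * (1 / 4) + 1 by norm_num, h6,
      show (-(2 * (1 / 4)) : ℂ) = -(2 * (1 / 4) + 1) + 1 by norm_num, h6]
  rw [pinchPart_zero_one_div_four, pinchPart]
  push_cast
  simp only [zero_mul, mul_zero, add_zero, sub_zero, h1, h2, h3, h4, h5]
  rw [show (-1 / 4 + 3 / 4 : ℂ) = 1 / 2 by norm_num]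
  ring

/-- The balancing condition now reads c + d + e + f = τ + 2η, so the six gamma factors in these four
parameters cancel in three reflected pairs. -/
theorem betaGammasRest_pinch (hτ : 0 < τ.im) (hη : 0 < η.im) {c d e f : ℂ} (hc : 0 < c.im)
    (hd : 0 < d.im) (he : 0 < e.im) (hf : 0 < f.im) (hs : c + d + e + f = τ + 2 * η) :
    betaGammasRest τ η (1 / 4) (-1 / 4) c d e f =
      gammaPair τ η c (1 / 4) * gammaPair τ η d (1 / 4) * gammaPair τ η e (1 / 4) *
          gammaPair τ η f (1 / 4) := by
  have hp : ∀ {x y : ℂ}, 0 < x.im → 0 < y.im → 0 < (x + y).im := fun hx hy => by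
    rw [add_im]; exact add_pos hx hy
  have h1 := logGamma_mul_logGamma hτ hη (x := c + d) (y := e + f) (by rw [← hs]; ring)
    (hp hc hd) (hp he hf)
  have h2 := logGamma_mul_logGamma hτ hη (x := c + e) (y := d + f) (by rw [← hs]; ring)
    (hp hc he) (hp hd hf)
  have h3 := logGamma_mul_logGamma hτ hη (x := c + f) (y := d + e) (by rw [← hs]; ring)
    (hp hc hf) (hp hd he)
  have h4 : ∀ x : ℂ, logGamma τ η (1 / 4 + x) * logGamma τ η (-1 / 4 + x) =
      gammaPair τ η x (1 / 4) := fun x => by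
    rw [gammaPair, add_comm, show -1 / 4 + x = x - 1 / 4 by ring]
  rw [← h4, ← h4, ← h4, ← h4, betaGammasRest]
  linear_combination (logGamma τ η (1 / 4 + c) * logGamma τ η (1 / 4 + d) *
    logGamma τ η (1 / 4 + e) * logGamma τ η (1 / 4 + f) * logGamma τ η (-1 / 4 + c) *
    logGamma τ η (-1 / 4 + d) * logGamma τ η (-1 / 4 + e) * logGamma τ η (-1 / 4 + f)) *
    (logGamma τ η (c + e) * logGamma τ η (d + f) * (logGamma τ η (c + f) * logGamma τ η (d + e)) *
      h1 + logGamma τ η (c + f) * logGamma τ η (d + e) * h2 + h3)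

/-- The ratio of the two sides of the beta integral evaluation tends to `1` when two parameters
pinch the contour. -/
theorem tendsto_betaRatio_pinch (hτ : 0 < τ.im) (hη : 0 < η.im) {c d e f : ℂ} (hc : 0 < c.im)
    (hd : 0 < d.im) (he : 0 < e.im) (hf : 0 < f.im) (hs : c + d + e + f = τ + 2 * η) :
    Tendsto (fun ε : ℝ => betaRatio τ η (1 / 4 + ε * I) (-1 / 4 + ε * I) c d e (f - 2 * ε * I))
      (𝓝[>] 0) (𝓝 1) := by
  set r : ℝ → ℝ := fun ε => Real.exp (-(4 * Real.pi * ε)) with hr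
  have hrc : Continuous r := by fun_prop
  have hr1 : Tendsto r (𝓝[>] 0) (𝓝 1) := by
    have := (hrc.tendsto 0).mono_left (nhdsWithin_le_nhds (s := Set.Ioi 0))
    simpa [hr] using this
  have hrlt : ∀ ε : ℝ, 0 < ε → r ε < 1 := fun ε hε => by
    rw [hr, Real.exp_lt_one_iff]
    have := Real.pi_pos
    simp only [Left.neg_neg_iff]
    positivity
  have hint := tendsto_integral_peakKernel (r := r)
    (by filter_upwards [self_mem_nhdsWithin] with ε hε using ⟨(Real.exp_pos _).le, hrlt ε hε⟩)
    hr1 (ε₀ := f.im / 4) (by linarith)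
    (continuousOn_pinchPart hτ hη hc hd he (by linarith : 2 * (f.im / 4) < f.im)) rfl
    (pinchPart_zero_three_div_four c d e f)
  have hreg : Tendsto (fun ε : ℝ => regGamma τ η (2 * ε * I)) (𝓝[>] 0) (𝓝 (regGamma τ η 0)) := by
    have h1 := continuousOn_regGamma hτ hη 0 (by simp)
    have h2 : Tendsto (fun ε : ℝ => 2 * (ε : ℂ) * I) (𝓝[>] 0) (𝓝[{x | 0 ≤ x.im}] 0) := by
      rw [tendsto_nhdsWithin_iff]
      constructor
      · have : Continuous fun ε : ℝ => 2 * (ε : ℂ) * I := by fun_prop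
        have := (this.tendsto 0).mono_left (nhdsWithin_le_nhds (s := Set.Ioi 0))
        simpa using this
      · filter_upwards [self_mem_nhdsWithin] with ε hε
        have : (0 : ℝ) < ε := hε
        simp
        linarith
    exact h1.tendsto.comp h2
  have hrest : Tendsto (fun ε : ℝ => betaGammasRest τ η (1 / 4 + ε * I) (-1 / 4 + ε * I) c d e
      (f - 2 * ε * I)) (𝓝[>] 0) (𝓝 (betaGammasRest τ η (1 / 4) (-1 / 4) c d e f)) := by
    have hg : ∀ g : ℝ → ℂ, Continuous g → 0 < (g 0).im →
        ContinuousAt (fun ε => logGamma τ η (g ε)) 0 := fun g hg h0 =>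
      ContinuousAt.comp (g := logGamma τ η) (f := g)
        (differentiableAt_logGamma hτ hη h0).continuousAt hg.continuousAt
    have : ContinuousAt (fun ε : ℝ => betaGammasRest τ η (1 / 4 + ε * I) (-1 / 4 + ε * I) c d e
      (f - 2 * ε * I)) 0 := by
      unfold betaGammasRest
      refine (((((((hg _ (by fun_prop) ?_).mul (hg _ (by fun_prop) ?_)).mul
        (hg _ (by fun_prop) ?_)).mul (hg _ (by fun_prop) ?_))).mul ((((hg _ (by fun_prop) ?_).mul
        (hg _ (by fun_prop) ?_)).mul
        (hg _ (by fun_prop) ?_)).mul (hg _ (by fun_prop) ?_))).mul (((hg _ (by fun_prop) ?_).mul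
        (hg _ (by fun_prop) ?_)).mul (hg _ (by fun_prop) ?_))).mul (((hg _ (by fun_prop) ?_).mul
        (hg _ (by fun_prop) ?_)).mul (hg _ (by fun_prop) ?_))
      all_goals
        simp
        try linarith
    have := this.tendsto.mono_left (nhdsWithin_le_nhds (s := Set.Ioi 0))
    simpa using this
  set P := gammaPair τ η c (1 / 4) * gammaPair τ η d (1 / 4) * gammaPair τ η e (1 / 4) *
          gammaPair τ η f (1 / 4) with hP
  -- The auxiliary y is another parameter; it keeps Im x strictly below Im(τ + 2η), where Γ has no
  -- zeros.
  have hpair : ∀ x y : ℂ, 0 < x.im → 0 < y.im → x.im + y.im ≤ (τ + 2 * η).im →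
      gammaPair τ η x (1 / 4) ≠ 0 := fun x y hx hy hxy => by
    refine mul_ne_zero (logGamma_ne_zero hτ hη ?_ ?_) (logGamma_ne_zero hτ hη ?_ ?_)
    all_goals
      simp only [add_im, sub_im]
      simp at hxy
      norm_num
      try linarith
  have hsim : (τ + 2 * η).im = c.im + d.im + e.im + f.im := by
    rw [← hs]; simp only [add_im]
  have hP0 : P ≠ 0 := by
    refine mul_ne_zero (mul_ne_zero (mul_ne_zero (hpair c d hc hd ?_) (hpair d c hd hc ?_))
      (hpair e c he hc ?_)) (hpair f c hf hc ?_) <;> rw [hsim] <;> linarith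
  have hreg0 := regGamma_zero hτ hη
  have hR0 : regGamma τ η 0 ≠ 0 := left_ne_zero_of_mul_eq_one hreg0
  rw [betaGammasRest_pinch hτ hη hc hd he hf hs] at hrest
  have hrC : Tendsto (fun ε => (r ε : ℂ)) (𝓝[>] 0) (𝓝 1) := by
    have := (continuous_ofReal.tendsto 1).comp hr1
    rwa [ofReal_one] at this
  -- Numerator and denominator of the ratio are multiplied by 1 - r². The integral becomes one
  -- against the Poisson kernel, and (1 - r²) Γ(e(2iε)) becomes (1 + r) times the regular part.
  have hlim := (hint.const_mul (qPoch (pp τ) (pp τ) * qPoch (qq η) (qq η) / 2)).div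
    (((hrC.const_add 1).mul hreg).mul hrest)
    (mul_ne_zero (mul_ne_zero (by norm_num) hR0) hP0)
  -- The limit is (p;p)_∞ (q;q)_∞ / 2 · 4 R² P / (2 R P) with R = `regGamma τ η 0`, which is 1
  -- because R (p;p)_∞ (q;q)_∞ = 1.
  have hval : qPoch (pp τ) (pp τ) * qPoch (qq η) (qq η) / 2 * pinchPart τ η c d e f 0 (1 / 4) /
      ((1 + 1) * regGamma τ η 0 * P) = 1 := by
    rw [pinchPart_zero_one_div_four, regGamma_one_div_two hτ hη, ← hP]
    field_simp
    linear_combination 4 * hreg0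
  rw [hval] at hlim
  refine hlim.congr' ?_
  filter_upwards [self_mem_nhdsWithin] with ε hε
  have hε : 0 < ε := hε
  have h1 : (1 - r ε ^ 2 : ℂ) ≠ 0 := by
    have := hrlt ε hε
    have h0 : 0 < r ε := Real.exp_pos _
    exact_mod_cast (by nlinarith : 0 < 1 - r ε ^ 2).ne'
  have h2 : (1 - r ε : ℂ) ≠ 0 := by
    have := hrlt ε hε
    exact_mod_cast (by linarith : 0 < 1 - r ε).ne'
  have h3 : (1 + r ε : ℂ) ≠ 0 := by
    have h0 : 0 < r ε := Real.exp_pos _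
    exact_mod_cast (by linarith : 0 < 1 + r ε).ne'
  have h4 : ∫ y in (0 : ℝ)..1, peakKernel (r ε) y * pinchPart τ η c d e f ε y =
      (1 - r ε ^ 2) * betaIntegral τ η (1 / 4 + ε * I) (-1 / 4 + ε * I) c d e (f - 2 * ε * I) := by
    rw [betaIntegral, ← intervalIntegral.integral_const_mul]
    exact intervalIntegral.integral_congr fun y _ => (betaIntegrand_pinch hτ hη c d e f ε y).symm
  have h5 : logGamma τ η (1 / 4 + ε * I + (-1 / 4 + ε * I)) =
      regGamma τ η (2 * ε * I) / (1 - r ε) := by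
    rw [show (1 / 4 + ε * I + (-1 / 4 + ε * I) : ℂ) = 2 * ε * I by ring,
      logGamma_eq_regGamma_div hτ hη]
    congr 2
    rw [ee, hr, ofReal_exp]
    congr 1
    push_cast
    linear_combination (4 * Real.pi * ε : ℂ) * I_sq
  rw [Pi.div_apply, h4, betaRatio, betaGammas_eq_mul, h5]
  field_simp
  ring

end

end EllipticYB

namespace EllipticYB

noncomputable section

open Complex Filter Topology

/-! ### Evaluation of the elliptic beta integral -/

variable {τ η : ℂ}

theorem betaRatio_swap_third_last (a b c d e f : ℂ) :
    betaRatio τ η a b c d e f = betaRatio τ η a b f d e c := by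
  have h1 : betaIntegral τ η a b c d e f = betaIntegral τ η a b f d e c := by
    refine intervalIntegral.integral_congr fun y _ => ?_
    simp only [betaIntegrand]
    ring
  rw [betaRatio, betaRatio, h1, betaGammas, betaGammas, add_comm f d, add_comm f e, add_comm f c,
    add_comm d c, add_comm e c]
  ring

/-- Redistributing first a + b and then the sum of the second and third parameters moves two
parameters to ±1/4 + iε without changing the ratio. The ratio is thus independent of ε, and its
pinching limit is 1. -/
theorem betaRatio_eq_one_of_lt (hτ : 0 < τ.im) (hη : 0 < η.im) {a b c d e f : ℂ}
    (ha : 0 < a.im) (hb : 0 < b.im) (hc : 0 < c.im)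
    (hd : 0 < d.im) (he : 0 < e.im) (hf : 0 < f.im) (hs : a + b + c + d + e + f = τ + 2 * η)
    (h2 : (2 * η).im < (a + b).im) : betaRatio τ η a b c d e f = 1 := by
  have hlim := tendsto_betaRatio_pinch hτ hη hf hd he (f := a + b + c)
    (by rw [add_im, add_im]; linarith) (by rw [← hs]; ring)
  refine tendsto_nhds_unique (f := fun _ : ℝ => betaRatio τ η a b c d e f) (l := 𝓝[>] 0)
    tendsto_const_nhds (hlim.congr' ?_)
  have hη2 := two_mul_im_pos hη
  rw [add_im] at h2
  have h0 : ∀ᶠ ε : ℝ in 𝓝[>] 0, ε < c.im ∧ ε < a.im ∧ ε < b.im :=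
    nhdsWithin_le_nhds ((gt_mem_nhds hc).and ((gt_mem_nhds ha).and (gt_mem_nhds hb)))
  filter_upwards [self_mem_nhdsWithin, h0] with ε hε hεc
  have hε : 0 < ε := hε
  obtain ⟨hεc, hεa, hεb⟩ := hεc
  have hAim : (1 / 4 + ε * I : ℂ).im = ε := by simp
  have hBim : (-1 / 4 + ε * I : ℂ).im = ε := by simp
  set A : ℂ := 1 / 4 + ε * I with hA
  set B : ℂ := -1 / 4 + ε * I with hB
  rw [show a + b + c - 2 * ε * I = a + b + c - A - B by rw [hA, hB]; ring]
  symm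
  -- The pair (a, b) becomes (A, a + b - A), and then (a + b - A, c) becomes (B, a + b - A + c - B).
  -- The sum of the second pair still has imaginary part above Im 2η because ε < Im c.
  rw [betaRatio_eq_of_add_eq hτ hη ha hb (a' := A) (b' := a + b - A) (by rw [hAim]; exact hε)
    (by rw [sub_im, add_im, hAim]; linarith) hc hd he hf hs (by ring)
    (by rw [add_im]; linarith), betaRatio_swap_outer, betaRatio_swap_first,
    betaRatio_eq_of_add_eq hτ hη (a' := B) (b' := a + b - A + c - B)
    (by rw [sub_im, add_im, hAim]; linarith) hc (by rw [hBim]; exact hε)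
    (by rw [sub_im, add_im, sub_im, add_im, hAim, hBim]; linarith)
    (by rw [hAim]; exact hε) hd he hf (by rw [← hs]; ring) (by ring)
    (by rw [add_im, sub_im, add_im, hAim]; linarith)]
  rw [betaRatio_swap_outer, betaRatio_swap_first, betaRatio_swap_outer, betaRatio_swap_first,
    betaRatio_swap_third_last]
  rw [show a + b + c - A - B = a + b - A + c - B by ring]

/-- The point `(1 - s) x + s y` of the complex line through `x` and `y`. -/
def linePoint (x y s : ℂ) : ℂ := x + s * (y - x)

theorem linePoint_zero (x y : ℂ) : linePoint x y 0 = x := by simp [linePoint]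

theorem linePoint_one (x y : ℂ) : linePoint x y 1 = y := by simp [linePoint]

theorem differentiable_linePoint (x y : ℂ) : Differentiable ℂ (linePoint x y) := by
  unfold linePoint
  fun_prop

theorem isOpen_linePoint_im_pos (x y : ℂ) : IsOpen {s | 0 < (linePoint x y s).im} :=
  isOpen_lt continuous_const (continuous_im.comp (differentiable_linePoint x y).continuous)

theorem convex_linePoint_im_pos (x y : ℂ) : Convex ℝ {s | 0 < (linePoint x y s).im} := by
  intro s hs t ht α β hα hβ hαβ
  have hαβ' : (α : ℂ) + β = 1 := by exact_mod_cast hαβ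
  have : linePoint x y (α • s + β • t) = α * linePoint x y s + β * linePoint x y t := by
    simp only [linePoint, real_smul]
    linear_combination (-x) * hαβ'
  rw [Set.mem_ofPred_eq, this, add_im, im_ofReal_mul, im_ofReal_mul]
  rw [Set.mem_ofPred_eq] at hs ht
  rcases hα.eq_or_lt with rfl | hα
  · rw [zero_add] at hαβ
    rw [hαβ, one_mul, zero_mul, zero_add]
    exact ht
  · exact add_pos_of_pos_of_nonneg (mul_pos hα hs) (mul_nonneg hβ ht.le)

/-- **The elliptic beta integral.** -/
theorem betaIntegral_eq (hτ : 0 < τ.im) (hη : 0 < η.im) {a b c d e f : ℂ}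
    (ha : 0 < a.im) (hb : 0 < b.im) (hc : 0 < c.im)
    (hd : 0 < d.im) (he : 0 < e.im) (hf : 0 < f.im) (hs : a + b + c + d + e + f = τ + 2 * η) :
    qPoch (pp τ) (pp τ) * qPoch (qq η) (qq η) / 2 * betaIntegral τ η a b c d e f =
      betaGammas τ η a b c d e f := by
  suffices h : betaRatio τ η a b c d e f = 1 from
    (div_eq_one_iff_eq (betaGammas_ne_zero hτ hη ha hb hc hd he hf hs)).1 h
  have hη2 := two_mul_im_pos hη
  -- The base point (u, u, v, v, v, v) is balanced, as 2u = τ/2 + 2η and 4v = τ/2, and Im 2u > Im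
  -- 2η. The ratio is continued along the complex line from the given parameters (s = 0) to this
  -- point (s = 1). Admissible s form an intersection of half-planes, which is convex.
  set u : ℂ := (τ / 2 + 2 * η) / 2 with hu
  set v : ℂ := τ / 8 with hv
  have huim : u.im = (τ.im / 2 + (2 * η).im) / 2 := by simp [hu]
  have hvim : v.im = τ.im / 8 := by simp [hv]
  have hu0 : 0 < u.im := by rw [huim]; linarith
  have hv0 : 0 < v.im := by rw [hvim]; linarith
  have hld : ∀ x y, DifferentiableOn ℂ (linePoint x y) Set.univ := fun x y =>
    (differentiable_linePoint x y).differentiableOn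
  let P : ℂ → ℂ → Set ℂ := fun x y => {s | 0 < (linePoint x y s).im}
  have hopen : ∀ x y, IsOpen (P x y) := isOpen_linePoint_im_pos
  have hconv : ∀ x y, Convex ℝ (P x y) := convex_linePoint_im_pos
  let U : Set ℂ := P a u ∩ P b u ∩ P c v ∩ P d v ∩ P e v ∩ P f v
  have hU : IsOpen U := (((((hopen a u).inter (hopen b u)).inter (hopen c v)).inter
    (hopen d v)).inter (hopen e v)).inter (hopen f v)
  have hUc : Convex ℝ U := (((((hconv a u).inter (hconv b u)).inter (hconv c v)).inter
    (hconv d v)).inter (hconv e v)).inter (hconv f v)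
  have h0U : (0 : ℂ) ∈ U := by
    refine ⟨⟨⟨⟨⟨?_, ?_⟩, ?_⟩, ?_⟩, ?_⟩, ?_⟩ <;>
      rw [Set.mem_ofPred_eq, linePoint_zero] <;> assumption
  have h1U : (1 : ℂ) ∈ U := by
    refine ⟨⟨⟨⟨⟨?_, ?_⟩, ?_⟩, ?_⟩, ?_⟩, ?_⟩ <;>
      rw [Set.mem_ofPred_eq, linePoint_one] <;> assumption
  have hsum : ∀ s, linePoint a u s + linePoint b u s + linePoint c v s + linePoint d v s +
      linePoint e v s + linePoint f v s = τ + 2 * η := by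
    intro s
    simp only [linePoint, hu, hv]
    linear_combination (1 - s) * hs
  have hdiff : DifferentiableOn ℂ (fun s => betaRatio τ η (linePoint a u s) (linePoint b u s)
      (linePoint c v s) (linePoint d v s)
      (linePoint e v s) (linePoint f v s)) U :=
    differentiableOn_betaRatio hτ hη hU ((hld _ _).mono (Set.subset_univ _))
      ((hld _ _).mono (Set.subset_univ _)) ((hld _ _).mono (Set.subset_univ _))
      ((hld _ _).mono (Set.subset_univ _)) ((hld _ _).mono (Set.subset_univ _))
      ((hld _ _).mono (Set.subset_univ _)) (fun s hs => hs.1.1.1.1.1) (fun s hs => hs.1.1.1.1.2)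
      (fun s hs => hs.1.1.1.2) (fun s hs => hs.1.1.2) (fun s hs => hs.1.2) (fun s hs => hs.2)
      fun s _ => hsum s
  have hev : (fun s => betaRatio τ η (linePoint a u s) (linePoint b u s)
      (linePoint c v s) (linePoint d v s)
      (linePoint e v s) (linePoint f v s)) =ᶠ[𝓝 1] fun _ => 1 := by
    have hW : IsOpen {s | (2 * η).im < (linePoint a u s + linePoint b u s).im} :=
      isOpen_lt continuous_const (continuous_im.comp
        ((differentiable_linePoint a u).continuous.add (differentiable_linePoint b u).continuous))
    filter_upwards [hU.mem_nhds h1U, hW.mem_nhds (by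
      rw [Set.mem_ofPred_eq, linePoint_one, linePoint_one, add_im, huim]; linarith)] with s hs h2
    exact betaRatio_eq_one_of_lt hτ hη hs.1.1.1.1.1 hs.1.1.1.1.2 hs.1.1.1.2 hs.1.1.2 hs.1.2 hs.2
      (hsum s) h2
  have := (hdiff.analyticOnNhd hU).eqOn_of_preconnected_of_eventuallyEq analyticOnNhd_const
    hUc.isPreconnected h1U hev h0U
  simpa only [linePoint_zero] using this

end

end EllipticYB

namespace EllipticYB

noncomputable section

open Complex Filter Topology

variable {τ η : ℂ}

/-! ### The operators without gauge factors -/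

/-- `Γ(e^{2πix} a^{±1} b^{±1})` in logarithmic variables. -/
def gammaQuad (τ η x a b : ℂ) : ℂ := gammaPair τ η (x + a) b * gammaPair τ η (x - a) b

theorem gammaPM_ee (x a b : ℂ) :
    gammaPM (pp τ) (qq η) (ee x) (ee a) (ee b) = gammaQuad τ η x a b := by
  simp only [gammaPM, gammaQuad, gammaPair, logGamma, ee_add, ee_sub]
  ring

theorem gammaQuad_comm (x a b : ℂ) : gammaQuad τ η x a b = gammaQuad τ η x b a := by
  simp only [gammaQuad, gammaPair, add_right_comm x a b, sub_right_comm x a b,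
    add_sub_right_comm x a b, sub_add_eq_add_sub x a b]
  ring

theorem continuousOn_gammaQuad (hτ : 0 < τ.im) (hη : 0 < η.im) {X : Type*} [TopologicalSpace X]
    {s : Set X} {x : X → ℂ} {a b : X → ℝ} (hx : ContinuousOn x s) (ha : ContinuousOn a s)
    (hb : ContinuousOn b s) (h : ∀ z ∈ s, 0 < (x z).im) :
    ContinuousOn (fun z => gammaQuad τ η (x z) (a z) (b z)) s := by
  have hl : ∀ {g : X → ℂ}, ContinuousOn g s → (∀ z ∈ s, 0 < (g z).im) →
      ContinuousOn (fun z => logGamma τ η (g z)) s :=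
    fun hg h => (continuousOn_logGamma hτ hη).comp hg h
  have ha' : ContinuousOn (fun z => (a z : ℂ)) s := continuous_ofReal.comp_continuousOn ha
  have hb' : ContinuousOn (fun z => (b z : ℂ)) s := continuous_ofReal.comp_continuousOn hb
  unfold gammaQuad gammaPair
  refine ((hl ((hx.add ha').add hb') ?_).mul (hl ((hx.add ha').sub hb') ?_)).mul
    ((hl ((hx.sub ha').add hb') ?_).mul (hl ((hx.sub ha').sub hb') ?_)) <;>
  · intro z hz
    simpa using h z hz

theorem differentiableOn_gammaQuad (hτ : 0 < τ.im) (hη : 0 < η.im) {U : Set ℂ} {x : ℂ → ℂ}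
    (hx : DifferentiableOn ℂ x U) (h : ∀ s ∈ U, 0 < (x s).im) (a b : ℝ) :
    DifferentiableOn ℂ (fun s => gammaQuad τ η (x s) a b) U :=
  (differentiableOn_gammaPair_comp hτ hη (hx.add_const _) (fun s hs => by simpa using h s hs) b).mul
    (differentiableOn_gammaPair_comp hτ hη (hx.sub_const _) (fun s hs => by simpa using h s hs) b)

variable {n : ℕ}

/-- The integral operator with kernel `Γ(e^{2πix} w^{±1} y^{±1}) / Γ(y^{±2})` in the variable
number `i`. -/
def kernelOp (τ η x : ℂ) (i : Fin n) (g : (Fin n → ℝ) → ℂ) (z : Fin n → ℝ) : ℂ :=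
  qPoch (pp τ) (pp τ) * qPoch (qq η) (qq η) / 2 *
    ∫ y in (0 : ℝ)..1, gammaQuad τ η x (z i) y * betaWeight τ η y * g (Function.update z i y)

/-- The operator `M(e^{2πix})` in the variable number `i`. -/
def normOp (τ η x : ℂ) (i : Fin n) (g : (Fin n → ℝ) → ℂ) (z : Fin n → ℝ) : ℂ :=
  (logGamma τ η (2 * x))⁻¹ * kernelOp τ η x i g z

/-- Multiplication by `D(e^{2πix})` in the variables number `i` and `j`. -/
def multOp (τ η x : ℂ) (i j : Fin n) (g : (Fin n → ℝ) → ℂ) (z : Fin n → ℝ) : ℂ :=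
  gammaQuad τ η ((τ + 2 * η) / 2 - x) (z i) (z j) * g z

theorem multOp_symm (x : ℂ) (i j : Fin n) (g : (Fin n → ℝ) → ℂ) :
    multOp τ η x i j g = multOp τ η x j i g := by
  funext z
  rw [multOp, gammaQuad_comm, multOp]

theorem continuous_kernelOp (hτ : 0 < τ.im) (hη : 0 < η.im) {x : ℂ} (hx : 0 < x.im) (i : Fin n)
    {g : (Fin n → ℝ) → ℂ} (hg : Continuous g) : Continuous (kernelOp τ η x i g) := by
  refine continuous_const.mul ?_
  rw [← continuousOn_univ]
  refine continuousOn_intervalIntegral ?_ 0 1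
  rw [Set.univ_prod_univ]
  refine ((continuousOn_gammaQuad hτ hη continuousOn_const (by fun_prop) (by fun_prop)
    fun _ _ => hx).mul ?_).mul ?_
  · exact ((continuous_betaWeight hτ hη).comp continuous_snd).continuousOn
  · exact (hg.comp (continuous_fst.update i continuous_snd)).continuousOn

theorem continuous_normOp (hτ : 0 < τ.im) (hη : 0 < η.im) {x : ℂ} (hx : 0 < x.im) (i : Fin n)
    {g : (Fin n → ℝ) → ℂ} (hg : Continuous g) : Continuous (normOp τ η x i g) :=
  continuous_const.mul (continuous_kernelOp hτ hη hx i hg)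

theorem continuous_multOp (hτ : 0 < τ.im) (hη : 0 < η.im) {x : ℂ}
    (hx : x.im < ((τ + 2 * η) / 2).im) (i j : Fin n) {g : (Fin n → ℝ) → ℂ} (hg : Continuous g) :
    Continuous (multOp τ η x i j g) := by
  refine Continuous.mul ?_ hg
  rw [← continuousOn_univ]
  exact continuousOn_gammaQuad hτ hη continuousOn_const (by fun_prop) (by fun_prop)
    fun _ _ => by rw [sub_im]; linarith

theorem kernelOp_const_mul (x : ℂ) (i : Fin n) (c : ℂ) (g : (Fin n → ℝ) → ℂ) :
    kernelOp τ η x i (fun z => c * g z) = fun z => c * kernelOp τ η x i g z := by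
  funext z
  rw [kernelOp, kernelOp, mul_left_comm c, ← intervalIntegral.integral_const_mul c]
  congr 2
  funext y
  ring

theorem multOp_const_mul (x : ℂ) (i j : Fin n) (c : ℂ) (g : (Fin n → ℝ) → ℂ) :
    multOp τ η x i j (fun z => c * g z) = fun z => c * multOp τ η x i j g z := by
  funext z
  rw [multOp, multOp]
  ring

theorem kernelOp_multOp_comm {i j k : Fin n} (hj : j ≠ i) (hk : k ≠ i) (x y : ℂ)
    (g : (Fin n → ℝ) → ℂ) :
    kernelOp τ η x i (multOp τ η y j k g) = multOp τ η y j k (kernelOp τ η x i g) := by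
  funext z
  simp only [kernelOp, multOp, Function.update_of_ne hj, Function.update_of_ne hk]
  rw [mul_left_comm (gammaQuad _ _ _ _ _),
    ← intervalIntegral.integral_const_mul (gammaQuad τ η ((τ + 2 * η) / 2 - y) _ _)]
  congr 2
  funext y
  ring

theorem normOp_multOp_comm {i j k : Fin n} (hj : j ≠ i) (hk : k ≠ i) (x y : ℂ)
    (g : (Fin n → ℝ) → ℂ) :
    normOp τ η x i (multOp τ η y j k g) = multOp τ η y j k (normOp τ η x i g) := by
  funext z
  simp only [normOp, kernelOp_multOp_comm hj hk, multOp]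
  ring

theorem multOp_multOp_comm (i j k l : Fin n) (x y : ℂ) (g : (Fin n → ℝ) → ℂ) :
    multOp τ η x i j (multOp τ η y k l g) = multOp τ η y k l (multOp τ η x i j g) := by
  funext z
  simp only [multOp]
  ring

theorem intervalIntegral_swap_of_continuous {F : ℝ → ℝ → ℂ}
    (hF : Continuous fun t : ℝ × ℝ => F t.1 t.2) (a b c d : ℝ) :
    ∫ x in a..b, ∫ y in c..d, F x y = ∫ y in c..d, ∫ x in a..b, F x y := by
  refine MeasureTheory.intervalIntegral_intervalIntegral_swap ?_
  exact (hF.continuousOn.integrableOn_compact (isCompact_uIcc.prod isCompact_uIcc)).mono_set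
    (Set.prod_mono Set.uIoc_subset_uIcc Set.uIoc_subset_uIcc)

theorem kernelOp_comm (hτ : 0 < τ.im) (hη : 0 < η.im) {x y : ℂ} (hx : 0 < x.im) (hy : 0 < y.im)
    {i j : Fin n} (hij : i ≠ j) {g : (Fin n → ℝ) → ℂ} (hg : Continuous g) :
    kernelOp τ η x i (kernelOp τ η y j g) = kernelOp τ η y j (kernelOp τ η x i g) := by
  funext z
  have hQ : ∀ {x : ℂ}, 0 < x.im → ∀ a : ℝ, Continuous fun t : ℝ => gammaQuad τ η x a t :=
    fun hx a => continuousOn_univ.1 (continuousOn_gammaQuad hτ hη continuousOn_const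
      continuousOn_const continuousOn_id fun _ _ => hx)
  have hw := continuous_betaWeight hτ hη
  simp only [kernelOp, Function.update_of_ne hij, Function.update_of_ne hij.symm]
  simp only [mul_left_comm _ (qPoch (pp τ) (pp τ) * qPoch (qq η) (qq η) / 2),
    intervalIntegral.integral_const_mul]
  congr 2
  simp only [← intervalIntegral.integral_const_mul]
  rw [intervalIntegral_swap_of_continuous]
  · refine intervalIntegral.integral_congr fun t _ => intervalIntegral.integral_congr fun s _ => ?_
    simp only [Function.update_comm hij]
    ring
  · refine Continuous.mul ?_ (Continuous.mul ?_ ?_)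
    · exact ((hQ hx _).mul hw).comp continuous_fst
    · exact ((hQ hy _).mul hw).comp continuous_snd
    · have hu : Continuous fun t : ℝ × ℝ => Function.update (Function.update z i t.1) j t.2 :=
        Continuous.update (A := fun _ => ℝ) (Continuous.update (A := fun _ => ℝ) continuous_const
          i continuous_fst) j continuous_snd
      exact hg.comp hu

theorem normOp_comm (hτ : 0 < τ.im) (hη : 0 < η.im) {x y : ℂ} (hx : 0 < x.im) (hy : 0 < y.im)
    {i j : Fin n} (hij : i ≠ j) {g : (Fin n → ℝ) → ℂ} (hg : Continuous g) :
    normOp τ η x i (normOp τ η y j g) = normOp τ η y j (normOp τ η x i g) := by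
  funext z
  have h := congrFun (kernelOp_comm hτ hη hx hy hij hg) z
  change _ * kernelOp τ η x i (fun z => _ * kernelOp τ η y j g z) z =
    _ * kernelOp τ η y j (fun z => _ * kernelOp τ η x i g z) z
  rw [kernelOp_const_mul, kernelOp_const_mul]
  simp only [h]
  ring

/-- The evaluation of the inner integral of the star-triangle relation. -/
theorem integral_gammaQuad_mul (hτ : 0 < τ.im) (hη : 0 < η.im) {x y : ℂ} (hx : 0 < x.im)
    (hy : 0 < y.im) (hxy : (x + y).im < ((τ + 2 * η) / 2).im) (w r s : ℝ) :
    qPoch (pp τ) (pp τ) * qPoch (qq η) (qq η) / 2 *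
      ∫ v in (0 : ℝ)..1, gammaQuad τ η x w v * betaWeight τ η v *
        gammaQuad τ η ((τ + 2 * η) / 2 - (x + y)) v r * gammaQuad τ η y v s =
    logGamma τ η (2 * x) * logGamma τ η (2 * y) * (logGamma τ η (2 * (x + y)))⁻¹ *
      (gammaQuad τ η ((τ + 2 * η) / 2 - y) w r * gammaQuad τ η (x + y) w s *
        gammaQuad τ η ((τ + 2 * η) / 2 - x) s r) := by
  set c := (τ + 2 * η) / 2 - (x + y) with hc
  have hc0 : 0 < c.im := by rw [hc, sub_im]; linarith
  -- The six parameters x ± w, c ± r, y ± s add up to 2(x + y + c) = τ + 2η by the choice of c.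
  have h := betaIntegral_eq hτ hη (a := x + w) (b := x - w) (c := c + r) (d := c - r) (e := y + s)
    (f := y - s) (by simpa using hx) (by simpa using hx) (by simpa using hc0) (by simpa using hc0)
    (by simpa using hy) (by simpa using hy) (by rw [hc]; ring)
  have h1 : ∫ v in (0 : ℝ)..1, gammaQuad τ η x w v * betaWeight τ η v *
        gammaQuad τ η c v r * gammaQuad τ η y v s =
      betaIntegral τ η (x + w) (x - w) (c + r) (c - r) (y + s) (y - s) := by
    refine intervalIntegral.integral_congr fun v _ => ?_
    simp only [gammaQuad_comm _ (v : ℂ)]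
    simp only [gammaQuad, betaIntegrand]
    ring
  -- The reflection formula: 2c and 2(x + y) add up to τ + 2η.
  have h2 : logGamma τ η (c + r + (c - r)) = (logGamma τ η (2 * (x + y)))⁻¹ := by
    refine eq_inv_of_mul_eq_one_left (logGamma_mul_logGamma hτ hη ?_ ?_ ?_)
    · rw [hc]; ring
    · rw [show c + r + (c - r) = c + c by ring, add_im]; linarith
    · rw [two_mul, add_im, add_im]; linarith
  have e1 : (τ + 2 * η) / 2 - y = x + c := by rw [hc]; ring
  have e2 : (τ + 2 * η) / 2 - x = y + c := by rw [hc]; ring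
  rw [h1, h, betaGammas, h2, e1, e2]
  simp only [gammaQuad, gammaPair]
  rw [show x + w + (x - w) = 2 * x by ring, show y + s + (y - s) = 2 * y by ring]
  ring_nf

/-- After the two integrations are exchanged, the intermediate variable occurs in gamma factors
only, and the inner integral over it is an elliptic beta integral. -/
theorem kernelOp_star_triangle (hτ : 0 < τ.im) (hη : 0 < η.im) {x y : ℂ} (hx : 0 < x.im)
    (hy : 0 < y.im) (hxy : (x + y).im < ((τ + 2 * η) / 2).im) {i j : Fin n} (hij : j ≠ i)
    {g : (Fin n → ℝ) → ℂ} (hg : Continuous g) :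
    kernelOp τ η x i (multOp τ η (x + y) i j (kernelOp τ η y i g)) = fun z =>
      logGamma τ η (2 * x) * logGamma τ η (2 * y) * (logGamma τ η (2 * (x + y)))⁻¹ *
        multOp τ η y i j (kernelOp τ η (x + y) i (multOp τ η x i j g)) z := by
  funext z
  have hQ : ∀ {x : ℂ} (a b : ℝ × ℝ → ℝ), 0 < x.im → Continuous a → Continuous b →
      Continuous fun t : ℝ × ℝ => gammaQuad τ η x (a t) (b t) := fun a b hx ha hb =>
    continuousOn_univ.1 (continuousOn_gammaQuad hτ hη continuousOn_const
      ha.continuousOn hb.continuousOn fun _ _ => hx)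
  have hw := continuous_betaWeight hτ hη
  set c := (τ + 2 * η) / 2 - (x + y) with hc
  have hc0 : 0 < c.im := by rw [hc, sub_im]; linarith
  set κ := qPoch (pp τ) (pp τ) * qPoch (qq η) (qq η) / 2 with hκ
  have hF : Continuous fun t : ℝ × ℝ => κ * (gammaQuad τ η x (z i) t.1 * betaWeight τ η t.1 *
      (gammaQuad τ η c t.1 (z j) * (gammaQuad τ η y t.1 t.2 * betaWeight τ η t.2 *
        g (Function.update z i t.2)))) := by
    have h1 := hQ (fun _ => z i) Prod.fst hx continuous_const continuous_fst
    have h2 := hQ Prod.fst (fun _ => z j) hc0 continuous_fst continuous_const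
    have h3 := hQ Prod.fst Prod.snd hy continuous_fst continuous_snd
    have h4 : Continuous fun t : ℝ × ℝ => betaWeight τ η t.1 := hw.comp continuous_fst
    have h5 : Continuous fun t : ℝ × ℝ => betaWeight τ η t.2 := hw.comp continuous_snd
    have h6 : Continuous fun t : ℝ × ℝ => Function.update z i t.2 :=
      Continuous.update (A := fun _ => ℝ) continuous_const i continuous_snd
    have h7 : Continuous fun t : ℝ × ℝ => g (Function.update z i t.2) := hg.comp h6
    exact continuous_const.mul ((h1.mul h4).mul (h2.mul ((h3.mul h5).mul h7)))
  simp only [kernelOp, multOp, Function.update_of_ne hij, Function.update_self,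
    Function.update_idem, ← hκ, ← hc]
  simp only [mul_left_comm _ κ, intervalIntegral.integral_const_mul]
  congr 1
  simp only [← intervalIntegral.integral_const_mul]
  rw [intervalIntegral_swap_of_continuous hF]
  refine intervalIntegral.integral_congr fun s _ => ?_
  have h := integral_gammaQuad_mul hτ hη hx hy hxy (z i) (z j) s
  rw [← hκ, ← hc] at h
  have h' : ∀ v : ℝ, κ * (gammaQuad τ η x (z i) v * betaWeight τ η v *
      (gammaQuad τ η c v (z j) * (gammaQuad τ η y v s *
        betaWeight τ η s * g (Function.update z i s)))) =
      (betaWeight τ η s * g (Function.update z i s)) * (κ * (gammaQuad τ η x (z i) v *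
        betaWeight τ η v * gammaQuad τ η c v (z j) * gammaQuad τ η y v s)) := fun v => by ring
  simp only [h', intervalIntegral.integral_const_mul, h]
  ring

/-- The operator form of the star-triangle relation. -/
theorem normOp_star_triangle (hτ : 0 < τ.im) (hη : 0 < η.im) {x y : ℂ} (hx : 0 < x.im)
    (hy : 0 < y.im) (hxy : (x + y).im < ((τ + 2 * η) / 2).im) {i j : Fin n} (hij : j ≠ i)
    {g : (Fin n → ℝ) → ℂ} (hg : Continuous g) :
    normOp τ η x i (multOp τ η (x + y) i j (normOp τ η y i g)) =
      multOp τ η y i j (normOp τ η (x + y) i (multOp τ η x i j g)) := by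
  -- In this range Γ(2x) has no zeros, so the constants of the unnormalised relation cancel against
  -- the normalising factors.
  have h0 : ∀ {x : ℂ}, 0 < x.im → x.im < ((τ + 2 * η) / 2).im → logGamma τ η (2 * x) ≠ 0 := by
    intro x h1 h2
    have : ((τ + 2 * η) / 2).im + ((τ + 2 * η) / 2).im = (τ + 2 * η).im := by
      rw [← add_im, add_halves]
    refine logGamma_ne_zero hτ hη ?_ ?_ <;> rw [two_mul, add_im] <;> linarith
  rw [add_im] at hxy
  have hx0 := h0 hx (by linarith)
  have hy0 := h0 hy (by linarith)
  have h := kernelOp_star_triangle hτ hη hx hy (by rwa [add_im]) hij hg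
  change (fun z => _ * kernelOp τ η x i (multOp τ η (x + y) i j (fun z => _ *
    kernelOp τ η y i g z)) z) = multOp τ η y i j (fun z => _ * _)
  simp only [multOp_const_mul, kernelOp_const_mul, h]
  funext z
  field_simp

end

end EllipticYB

namespace EllipticYB

noncomputable section

open Complex Filter Topology

variable {τ η : ℂ}

/-! ### The Yang-Baxter equation in the region of small parameters -/

/-- Two reduced words of a permutation of six strands agree when the generators, labelled by the
pairs of strands that cross, satisfy the braid relations. -/
theorem labelled_braid_word {X : Type*} (s : Fin 5 → Fin 6 → Fin 6 → X → X)
    (hb : ∀ (k l : Fin 5) (a b c : Fin 6), k.val + 1 = l.val → a < b → b < c → ∀ g,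
      s k b c (s l a c (s k a b g)) = s l a b (s k a c (s l b c g)))
    (hc : ∀ (k l : Fin 5) (a b c d : Fin 6), k.val + 1 < l.val ∨ l.val + 1 < k.val → a < b →
      c < d → ∀ g, s k a b (s l c d g) = s l c d (s k a b g)) (g : X) :
    s 3 0 3 (s 2 0 2 (s 4 1 3 (s 3 1 2 (s 1 0 5 (s 0 0 4 (s 2 1 5 (s 1 1 4
      (s 3 2 5 (s 2 2 4 (s 4 3 5 (s 3 3 4 g))))))))))) =
    s 1 2 5 (s 0 2 4 (s 2 3 5 (s 1 3 4 (s 3 0 5 (s 2 0 4 (s 4 1 5 (s 3 1 4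
      (s 1 0 3 (s 0 0 2 (s 2 1 3 (s 1 1 2 g))))))))))) := by
  -- The permutation reverses the order of the blocks {0,1}, {2,3}, {4,5}. There is one braid move
  -- for each of the eight triples with one strand from every block; all other moves are
  -- commutations of distant generators.
  rw [hc 3 1 1 2 0 5 (by decide) (by decide) (by decide),
    hc 4 1 1 3 0 5 (by decide) (by decide) (by decide),
    hc 3 0 1 2 0 4 (by decide) (by decide) (by decide),
    hc 1 3 1 4 2 5 (by decide) (by decide) (by decide),
    ← hb 2 3 1 2 5 (by decide) (by decide) (by decide),
    hc 0 2 0 4 2 5 (by decide) (by decide) (by decide),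
    hc 4 2 1 3 2 5 (by decide) (by decide) (by decide),
    ← hb 1 2 0 2 5 (by decide) (by decide) (by decide),
    hc 3 1 0 3 2 5 (by decide) (by decide) (by decide),
    hc 4 0 1 3 0 4 (by decide) (by decide) (by decide),
    ← hb 1 2 1 2 4 (by decide) (by decide) (by decide),
    hc 3 1 1 5 2 4 (by decide) (by decide) (by decide),
    hc 4 1 1 3 2 4 (by decide) (by decide) (by decide),
    ← hb 0 1 0 2 4 (by decide) (by decide) (by decide),
    hc 2 0 0 5 2 4 (by decide) (by decide) (by decide),
    hc 3 0 0 3 2 4 (by decide) (by decide) (by decide),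
    hc 1 4 1 2 3 5 (by decide) (by decide) (by decide),
    hc 2 4 1 4 3 5 (by decide) (by decide) (by decide),
    ← hb 3 4 1 3 5 (by decide) (by decide) (by decide),
    hc 0 3 0 2 3 5 (by decide) (by decide) (by decide),
    hc 1 3 0 4 3 5 (by decide) (by decide) (by decide),
    ← hb 2 3 0 3 5 (by decide) (by decide) (by decide),
    hc 1 3 1 2 3 4 (by decide) (by decide) (by decide),
    ← hb 2 3 1 3 4 (by decide) (by decide) (by decide),
    hc 4 2 1 5 3 4 (by decide) (by decide) (by decide),
    hc 0 2 0 2 3 4 (by decide) (by decide) (by decide),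
    ← hb 1 2 0 3 4 (by decide) (by decide) (by decide),
    hc 3 1 0 5 3 4 (by decide) (by decide) (by decide),
    hc 0 4 0 2 1 5 (by decide) (by decide) (by decide),
    hc 0 3 0 2 1 4 (by decide) (by decide) (by decide),
    hc 1 4 0 3 1 5 (by decide) (by decide) (by decide),
    hc 1 3 0 3 1 4 (by decide) (by decide) (by decide)]

variable {n : ℕ}

/-- The operator `normOp` on continuous functions. -/
def contNorm (hτ : 0 < τ.im) (hη : 0 < η.im) (x : ℂ) (i : Fin n)
    (g : {g : (Fin n → ℝ) → ℂ // Continuous g}) : {g : (Fin n → ℝ) → ℂ // Continuous g} :=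
  open Classical in
  if hx : 0 < x.im then ⟨normOp τ η x i g, continuous_normOp hτ hη hx i g.2⟩ else g

/-- The operator `multOp` on continuous functions. -/
def contMult (hτ : 0 < τ.im) (hη : 0 < η.im) (x : ℂ) (i j : Fin n)
    (g : {g : (Fin n → ℝ) → ℂ // Continuous g}) : {g : (Fin n → ℝ) → ℂ // Continuous g} :=
  open Classical in
  if hx : x.im < ((τ + 2 * η) / 2).im then ⟨multOp τ η x i j g, continuous_multOp hτ hη hx i j g.2⟩
  else g

theorem contNorm_of_pos (hτ : 0 < τ.im) (hη : 0 < η.im) {x : ℂ} (hx : 0 < x.im) (i : Fin n)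
    (g : {g : (Fin n → ℝ) → ℂ // Continuous g}) :
    (contNorm hτ hη x i g : (Fin n → ℝ) → ℂ) = normOp τ η x i g := by
  rw [contNorm, dif_pos hx]

theorem contMult_of_lt (hτ : 0 < τ.im) (hη : 0 < η.im) {x : ℂ}
    (hx : x.im < ((τ + 2 * η) / 2).im) (i j : Fin n)
    (g : {g : (Fin n → ℝ) → ℂ // Continuous g}) :
    (contMult hτ hη x i j g : (Fin n → ℝ) → ℂ) = multOp τ η x i j g := by
  rw [contMult, dif_pos hx]

/-- The operators at the sites and links of a chain of three sites. -/
def chainOp (hτ : 0 < τ.im) (hη : 0 < η.im) (U : Fin 6 → ℂ) (k : Fin 5) (a b : Fin 6) :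
    {g : (Fin 3 → ℝ) → ℂ // Continuous g} → {g : (Fin 3 → ℝ) → ℂ // Continuous g} :=
  match k with
  | 0 => contNorm hτ hη (U b - U a) 0
  | 1 => contMult hτ hη (U b - U a) 0 1
  | 2 => contNorm hτ hη (U b - U a) 1
  | 3 => contMult hτ hη (U b - U a) 1 2
  | 4 => contNorm hτ hη (U b - U a) 2

/-- The operator `S₂ S₁ S₃ S₂` at the sites `i`, `j` of a function without gauge factor. -/
def wordR (τ η a b c d : ℂ) (i j : Fin n) (g : (Fin n → ℝ) → ℂ) : (Fin n → ℝ) → ℂ :=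
  multOp τ η (d - a) i j (normOp τ η (c - a) i (normOp τ η (d - b) j (multOp τ η (c - b) i j g)))

/-- Increasing imaginary parts of small total spread give every difference U b - U a with a < b the
conditions required of both kinds of operators. All intermediate words are then defined with the
unit circle as contour, and the combinatorics of braid words applies. The words act on continuous
functions, for which the exchange of integrals is justified. -/
theorem wordR_braid_of_small (hτ : 0 < τ.im) (hη : 0 < η.im) {U : Fin 6 → ℂ}
    (hU : StrictMono fun k => (U k).im) (hlt : (U 5 - U 0).im < ((τ + 2 * η) / 2).im)
    {g : (Fin 3 → ℝ) → ℂ} (hg : Continuous g) :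
    wordR τ η (U 0) (U 1) (U 2) (U 3) 1 2 (wordR τ η (U 0) (U 1) (U 4) (U 5) 0 1
        (wordR τ η (U 2) (U 3) (U 4) (U 5) 1 2 g)) =
      wordR τ η (U 2) (U 3) (U 4) (U 5) 0 1 (wordR τ η (U 0) (U 1) (U 4) (U 5) 1 2
        (wordR τ η (U 0) (U 1) (U 2) (U 3) 0 1 g)) := by
  have h1 : ∀ {a b : Fin 6}, a < b → 0 < (U b - U a).im := fun hab => by
    rw [sub_im]
    exact sub_pos.2 (hU hab)
  have h2 : ∀ {a b : Fin 6}, (U b - U a).im < ((τ + 2 * η) / 2).im := fun {a b} => by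
    have h3 := hU.monotone (Fin.le_last b)
    have h4 := hU.monotone (Fin.zero_le a)
    have h5 : (U (Fin.last 5)).im = (U 5).im := rfl
    rw [sub_im] at hlt ⊢
    linarith
  have hN := fun {a b : Fin 6} (hab : a < b) (i : Fin 3) g => contNorm_of_pos hτ hη (h1 hab) i g
  have hM := fun (a b : Fin 6) (i j : Fin 3) g =>
    contMult_of_lt hτ hη (h2 (a := a) (b := b)) i j g
  -- The braid relation when the lower generator is an integral operator. The next statement, with
  -- the lower generator a multiplication, is the same star-triangle relation read backwards with
  -- the two parameters exchanged.
  have hst : ∀ (i j : Fin 3), j ≠ i → ∀ a b c : Fin 6, a < b → b < c → ∀ g,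
      contNorm hτ hη (U c - U b) i (contMult hτ hη (U c - U a) i j
        (contNorm hτ hη (U b - U a) i g)) = contMult hτ hη (U b - U a) i j
        (contNorm hτ hη (U c - U a) i (contMult hτ hη (U c - U b) i j g)) := by
    intro i j hij a b c hab hbc g
    refine Subtype.ext ?_
    simp only [hN hbc, hN hab, hN (hab.trans hbc), hM]
    have h := normOp_star_triangle hτ hη (h1 hbc) (h1 hab)
      (by rw [sub_add_sub_cancel]; exact h2) hij g.2
    rwa [sub_add_sub_cancel] at h
  have hst' : ∀ (i j : Fin 3), j ≠ i → ∀ a b c : Fin 6, a < b → b < c → ∀ g,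
      contMult hτ hη (U c - U b) i j (contNorm hτ hη (U c - U a) i
        (contMult hτ hη (U b - U a) i j g)) = contNorm hτ hη (U b - U a) i
        (contMult hτ hη (U c - U a) i j (contNorm hτ hη (U c - U b) i g)) := by
    intro i j hij a b c hab hbc g
    refine Subtype.ext ?_
    simp only [hN hbc, hN hab, hN (hab.trans hbc), hM]
    have h := normOp_star_triangle hτ hη (h1 hab) (h1 hbc)
      (by rw [add_comm, sub_add_sub_cancel]; exact h2) hij g.2
    rw [add_comm, sub_add_sub_cancel] at h
    exact h.symm
  have hsymm : ∀ (i j : Fin 3) (a b : Fin 6) g,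
      contMult hτ hη (U b - U a) i j g = contMult hτ hη (U b - U a) j i g := fun i j a b g =>
    Subtype.ext (by rw [hM, hM, multOp_symm])
  have hNM : ∀ (i j k : Fin 3), j ≠ i → k ≠ i → ∀ a b c d : Fin 6, a < b → c < d → ∀ g,
      contNorm hτ hη (U b - U a) i (contMult hτ hη (U d - U c) j k g) =
        contMult hτ hη (U d - U c) j k (contNorm hτ hη (U b - U a) i g) := by
    intro i j k hj hk a b c d hab hcd g
    refine Subtype.ext ?_
    simp only [hN hab, hM]
    exact normOp_multOp_comm hj hk _ _ _
  have hNN : ∀ (i j : Fin 3), i ≠ j → ∀ a b c d : Fin 6, a < b → c < d → ∀ g,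
      contNorm hτ hη (U b - U a) i (contNorm hτ hη (U d - U c) j g) =
        contNorm hτ hη (U d - U c) j (contNorm hτ hη (U b - U a) i g) := by
    intro i j hij a b c d hab hcd g
    refine Subtype.ext ?_
    simp only [hN hab, hN hcd]
    exact normOp_comm hτ hη (h1 hab) (h1 hcd) hij g.2
  have hMM : ∀ (i j k l : Fin 3) (a b c d : Fin 6) g,
      contMult hτ hη (U b - U a) i j (contMult hτ hη (U d - U c) k l g) =
        contMult hτ hη (U d - U c) k l (contMult hτ hη (U b - U a) i j g) := by
    intro i j k l a b c d g
    refine Subtype.ext ?_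
    simp only [hM]
    exact multOp_multOp_comm _ _ _ _ _ _ _
  have key := labelled_braid_word (chainOp hτ hη U) ?_ ?_ ⟨g, hg⟩
  · have key' := congrArg Subtype.val key
    simp only [chainOp, hM, hN (show (0 : Fin 6) < 2 by decide), hN (show (1 : Fin 6) < 3 by decide),
      hN (show (0 : Fin 6) < 4 by decide), hN (show (1 : Fin 6) < 5 by decide),
      hN (show (2 : Fin 6) < 4 by decide), hN (show (3 : Fin 6) < 5 by decide)] at key'
    exact key'
  · intro k l a b c hkl hab hbc g
    obtain ⟨rfl, rfl⟩ | ⟨rfl, rfl⟩ | ⟨rfl, rfl⟩ | ⟨rfl, rfl⟩ : k = 0 ∧ l = 1 ∨ k = 1 ∧ l = 2 ∨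
      k = 2 ∧ l = 3 ∨ k = 3 ∧ l = 4 := by revert k l; decide
    · exact hst 0 1 (by decide) a b c hab hbc g
    · simp only [chainOp, hsymm 0 1]
      exact hst' 1 0 (by decide) a b c hab hbc g
    · exact hst 1 2 (by decide) a b c hab hbc g
    · simp only [chainOp, hsymm 1 2]
      exact hst' 2 1 (by decide) a b c hab hbc g
  · intro k l a b c d hkl hab hcd g
    have hkl' : (k, l) ∈ [((0, 2) : Fin 5 × Fin 5), (0, 3), (0, 4), (1, 3), (1, 4), (2, 4),
      (2, 0), (3, 0), (4, 0), (3, 1), (4, 1), (4, 2)] := by revert k l; decide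
    simp only [List.mem_cons, Prod.mk.injEq, List.not_mem_nil, or_false] at hkl'
    rcases hkl' with ⟨rfl, rfl⟩ | ⟨rfl, rfl⟩ | ⟨rfl, rfl⟩ | ⟨rfl, rfl⟩ | ⟨rfl, rfl⟩ | ⟨rfl, rfl⟩ |
      ⟨rfl, rfl⟩ | ⟨rfl, rfl⟩ | ⟨rfl, rfl⟩ | ⟨rfl, rfl⟩ | ⟨rfl, rfl⟩ | ⟨rfl, rfl⟩
    · exact hNN 0 1 (by decide) a b c d hab hcd g
    · exact hNM 0 1 2 (by decide) (by decide) a b c d hab hcd g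
    · exact hNN 0 2 (by decide) a b c d hab hcd g
    · exact hMM 0 1 1 2 a b c d g
    · exact (hNM 2 0 1 (by decide) (by decide) c d a b hcd hab g).symm
    · exact hNN 1 2 (by decide) a b c d hab hcd g
    · exact hNN 1 0 (by decide) a b c d hab hcd g
    · exact (hNM 0 1 2 (by decide) (by decide) c d a b hcd hab g).symm
    · exact hNN 2 0 (by decide) a b c d hab hcd g
    · exact hMM 1 2 0 1 a b c d g
    · exact hNM 2 0 1 (by decide) (by decide) a b c d hab hcd g
    · exact hNN 2 1 (by decide) a b c d hab hcd g

end

end EllipticYB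

namespace EllipticYB

noncomputable section

open Complex Filter Topology

variable {τ η : ℂ} {n : ℕ}

/-! ### Analytic continuation of the Yang-Baxter equation -/

/-- A jointly continuous family of functions that is holomorphic in the parameter. -/
def IsHolFamily (U : Set ℂ) (F : ℂ → (Fin n → ℝ) → ℂ) : Prop :=
  ContinuousOn (fun t : ℂ × (Fin n → ℝ) => F t.1 t.2) (U ×ˢ Set.univ) ∧
    ∀ z, DifferentiableOn ℂ (fun s => F s z) U

theorem IsHolFamily.multOp (hτ : 0 < τ.im) (hη : 0 < η.im) {U : Set ℂ}
    {F : ℂ → (Fin n → ℝ) → ℂ} (hF : IsHolFamily U F) {x : ℂ → ℂ} (hx : DifferentiableOn ℂ x U)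
    (h : ∀ s ∈ U, (x s).im < ((τ + 2 * η) / 2).im) (i j : Fin n) :
    IsHolFamily U fun s => multOp τ η (x s) i j (F s) := by
  have hx' : DifferentiableOn ℂ (fun s => (τ + 2 * η) / 2 - x s) U := hx.const_sub _
  have h' : ∀ s ∈ U, 0 < ((τ + 2 * η) / 2 - x s).im := fun s hs => by
    rw [sub_im]
    linarith [h s hs]
  refine ⟨ContinuousOn.mul ?_ hF.1, fun z => DifferentiableOn.mul ?_ (hF.2 z)⟩
  · exact continuousOn_gammaQuad hτ hη (hx'.continuousOn.comp continuousOn_fst fun t ht => ht.1)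
      (by fun_prop) (by fun_prop) fun t ht => h' _ ht.1
  · exact differentiableOn_gammaQuad hτ hη hx' h' _ _

/-- Joint continuity is carried along with holomorphy because it is what differentiation under a
further integral sign requires. -/
theorem IsHolFamily.kernelOp (hτ : 0 < τ.im) (hη : 0 < η.im) {U : Set ℂ} (hU : IsOpen U)
    {F : ℂ → (Fin n → ℝ) → ℂ} (hF : IsHolFamily U F) {x : ℂ → ℂ} (hx : DifferentiableOn ℂ x U)
    (h : ∀ s ∈ U, 0 < (x s).im) (i : Fin n) :
    IsHolFamily U fun s => kernelOp τ η (x s) i (F s) := by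
  have hw := continuous_betaWeight hτ hη
  constructor
  · refine continuousOn_const.mul ?_
    refine continuousOn_intervalIntegral (F := fun (t : ℂ × (Fin n → ℝ)) (y : ℝ) =>
      gammaQuad τ η (x t.1) (t.2 i) y * betaWeight τ η y * F t.1 (Function.update t.2 i y)) ?_ 0 1
    refine (ContinuousOn.mul ?_ ?_).mul ?_
    · exact continuousOn_gammaQuad hτ hη
        (hx.continuousOn.comp (continuous_fst.comp continuous_fst).continuousOn fun t ht => ht.1.1)
        (by fun_prop) (by fun_prop) fun t ht => h _ ht.1.1
    · exact (hw.comp continuous_snd).continuousOn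
    · have h1 : Continuous fun t : (ℂ × (Fin n → ℝ)) × ℝ =>
          (t.1.1, Function.update t.1.2 i t.2) := by fun_prop
      exact hF.1.comp h1.continuousOn fun t ht => ⟨ht.1.1, trivial⟩
  · intro z
    refine (differentiableOn_intervalIntegral (F := fun s (y : ℝ) =>
      gammaQuad τ η (x s) (z i) y * betaWeight τ η y * F s (Function.update z i y)) hU ?_
      (fun y => ?_) 0 1).const_mul _
    · refine (ContinuousOn.mul ?_ ?_).mul ?_
      · exact continuousOn_gammaQuad hτ hη (hx.continuousOn.comp continuousOn_fst fun t ht => ht.1)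
          (by fun_prop) (by fun_prop) fun t ht => h _ ht.1
      · exact (hw.comp continuous_snd).continuousOn
      · have h1 : Continuous fun t : ℂ × ℝ => (t.1, Function.update z i t.2) := by fun_prop
        exact hF.1.comp h1.continuousOn fun t ht => ⟨ht.1, trivial⟩
    · exact ((differentiableOn_gammaQuad hτ hη hx h _ _).mul_const _).mul (hF.2 _)

/-- The conditions under which the unit circle is the contour of both integrals of `wordR`. -/
structure ContourCond (τ η a b c d : ℂ) : Prop where
  left : 0 < (c - a).im
  right : 0 < (d - b).im
  inner : 0 < ((τ + 2 * η) / 2 - (c - b)).im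
  outer : 0 < ((τ + 2 * η) / 2 - (d - a)).im

/-- The operator `wordR` without the normalising factors. -/
def wordK (τ η a b c d : ℂ) (i j : Fin n) (g : (Fin n → ℝ) → ℂ) : (Fin n → ℝ) → ℂ :=
  multOp τ η (d - a) i j (kernelOp τ η (c - a) i (kernelOp τ η (d - b) j
    (multOp τ η (c - b) i j g)))

/-- The normalising factor of `wordR`. -/
def wordNorm (τ η a b c d : ℂ) : ℂ :=
  (logGamma τ η (2 * (c - a)))⁻¹ * (logGamma τ η (2 * (d - b)))⁻¹

theorem wordK_const_mul (a b c d : ℂ) (i j : Fin n) (r : ℂ) (g : (Fin n → ℝ) → ℂ) :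
    wordK τ η a b c d i j (fun z => r * g z) = fun z => r * wordK τ η a b c d i j g z := by
  simp only [wordK, multOp_const_mul, kernelOp_const_mul]

theorem wordR_eq (a b c d : ℂ) (i j : Fin n) (g : (Fin n → ℝ) → ℂ) :
    wordR τ η a b c d i j g = fun z => wordNorm τ η a b c d * wordK τ η a b c d i j g z := by
  have h : ∀ x (i : Fin n) (g : (Fin n → ℝ) → ℂ), normOp τ η x i g =
    fun z => (logGamma τ η (2 * x))⁻¹ * kernelOp τ η x i g z := fun _ _ _ => rfl
  simp only [wordR, h, kernelOp_const_mul, multOp_const_mul]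
  funext z
  rw [wordNorm, wordK, mul_assoc]

theorem continuous_wordR (hτ : 0 < τ.im) (hη : 0 < η.im) {a b c d : ℂ}
    (h : ContourCond τ η a b c d) (i j : Fin n) {g : (Fin n → ℝ) → ℂ} (hg : Continuous g) :
    Continuous (wordR τ η a b c d i j g) := by
  have h3 := h.inner
  have h4 := h.outer
  rw [sub_im] at h3 h4
  exact continuous_multOp hτ hη (by linarith) i j (continuous_normOp hτ hη h.left i
    (continuous_normOp hτ hη h.right j (continuous_multOp hτ hη (by linarith) i j hg)))

theorem IsHolFamily.wordK (hτ : 0 < τ.im) (hη : 0 < η.im) {U : Set ℂ} (hU : IsOpen U)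
    {F : ℂ → (Fin n → ℝ) → ℂ} (hF : IsHolFamily U F) {a b c d : ℂ → ℂ}
    (ha : DifferentiableOn ℂ a U) (hb : DifferentiableOn ℂ b U) (hc : DifferentiableOn ℂ c U)
    (hd : DifferentiableOn ℂ d U) (h : ∀ s ∈ U, ContourCond τ η (a s) (b s) (c s) (d s))
    (i j : Fin n) : IsHolFamily U fun s => wordK τ η (a s) (b s) (c s) (d s) i j (F s) := by
  have h' : ∀ x : ℂ, 0 < ((τ + 2 * η) / 2 - x).im → x.im < ((τ + 2 * η) / 2).im := fun x hx => by
    rw [sub_im] at hx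
    linarith
  exact (((hF.multOp hτ hη (hc.sub hb) (fun s hs => h' _ (h s hs).inner) i j).kernelOp hτ hη hU
    (hd.sub hb) (fun s hs => (h s hs).right) j).kernelOp hτ hη hU (hc.sub ha)
    (fun s hs => (h s hs).left) i).multOp hτ hη (hd.sub ha) (fun s hs => h' _ (h s hs).outer) i j

/-- Each contour condition says that an affine expression in the parameters has positive imaginary
part, so along a line it is again a condition on a `linePoint`. -/
theorem setOf_contourCond_linePoint (a b c d a' b' c' d' : ℂ) :
    {s | ContourCond τ η (linePoint a a' s) (linePoint b b' s) (linePoint c c' s)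
      (linePoint d d' s)} = {s | 0 < (linePoint (c - a) (c' - a') s).im} ∩
        {s | 0 < (linePoint (d - b) (d' - b') s).im} ∩
        {s | 0 < (linePoint ((τ + 2 * η) / 2 - (c - b)) ((τ + 2 * η) / 2 - (c' - b')) s).im} ∩
        {s | 0 < (linePoint ((τ + 2 * η) / 2 - (d - a)) ((τ + 2 * η) / 2 - (d' - a')) s).im} := by
  have h1 : ∀ s x x' y y', linePoint (x - y) (x' - y') s = linePoint x x' s - linePoint y y' s :=
    fun s x x' y y' => by
      simp only [linePoint]
      ring
  have h2 : ∀ s x, linePoint x x s = x := fun s x => by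
    simp only [linePoint]
    ring
  ext s
  simp only [h1, h2]
  exact ⟨fun h => ⟨⟨⟨h.left, h.right⟩, h.inner⟩, h.outer⟩,
    fun h => ⟨h.1.1.1, h.1.1.2, h.1.2, h.2⟩⟩

theorem isOpen_contourCond_linePoint (a b c d a' b' c' d' : ℂ) :
    IsOpen {s | ContourCond τ η (linePoint a a' s) (linePoint b b' s) (linePoint c c' s)
      (linePoint d d' s)} := by
  rw [setOf_contourCond_linePoint]
  exact (((isOpen_linePoint_im_pos _ _).inter (isOpen_linePoint_im_pos _ _)).inter
    (isOpen_linePoint_im_pos _ _)).inter (isOpen_linePoint_im_pos _ _)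

theorem convex_contourCond_linePoint (a b c d a' b' c' d' : ℂ) :
    Convex ℝ {s | ContourCond τ η (linePoint a a' s) (linePoint b b' s) (linePoint c c' s)
      (linePoint d d' s)} := by
  rw [setOf_contourCond_linePoint]
  exact (((convex_linePoint_im_pos _ _).inter (convex_linePoint_im_pos _ _)).inter
    (convex_linePoint_im_pos _ _)).inter (convex_linePoint_im_pos _ _)

/-- Both sides carry the same three normalising factors, which do not vanish in this region and
cancel. -/
theorem wordK_braid_of_small (hτ : 0 < τ.im) (hη : 0 < η.im) {U : Fin 6 → ℂ}
    (hU : StrictMono fun k => (U k).im) (hlt : (U 5 - U 0).im < ((τ + 2 * η) / 2).im)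
    {g : (Fin 3 → ℝ) → ℂ} (hg : Continuous g) :
    wordK τ η (U 0) (U 1) (U 2) (U 3) 1 2 (wordK τ η (U 0) (U 1) (U 4) (U 5) 0 1
        (wordK τ η (U 2) (U 3) (U 4) (U 5) 1 2 g)) =
      wordK τ η (U 2) (U 3) (U 4) (U 5) 0 1 (wordK τ η (U 0) (U 1) (U 4) (U 5) 1 2
        (wordK τ η (U 0) (U 1) (U 2) (U 3) 0 1 g)) := by
  have h := wordR_braid_of_small hτ hη hU hlt hg
  simp only [wordR_eq, wordK_const_mul] at h
  have h0 : ∀ {a b : Fin 6}, a < b → logGamma τ η (2 * (U b - U a)) ≠ 0 := by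
    intro a b hab
    have h1 := hU hab
    have h3 := hU.monotone (Fin.le_last b)
    have h4 := hU.monotone (Fin.zero_le a)
    have h5 : (U (Fin.last 5)).im = (U 5).im := rfl
    have h6 : ((τ + 2 * η) / 2).im + ((τ + 2 * η) / 2).im = (τ + 2 * η).im := by
      rw [← add_im, add_halves]
    rw [sub_im] at hlt
    refine logGamma_ne_zero hτ hη ?_ ?_ <;> rw [two_mul, add_im, sub_im] <;> linarith
  have hN : ∀ {a b c d : Fin 6}, a < c → b < d → wordNorm τ η (U a) (U b) (U c) (U d) ≠ 0 :=
    fun hac hbd => mul_ne_zero (inv_ne_zero (h0 hac)) (inv_ne_zero (h0 hbd))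
  funext z
  have hz := congrFun h z
  have h1 := hN (show (0 : Fin 6) < 2 by decide) (show (1 : Fin 6) < 3 by decide)
  have h2 := hN (show (0 : Fin 6) < 4 by decide) (show (1 : Fin 6) < 5 by decide)
  have h3 := hN (show (2 : Fin 6) < 4 by decide) (show (3 : Fin 6) < 5 by decide)
  refine mul_left_cancel₀ (mul_ne_zero (mul_ne_zero h1 h2) h3) ?_
  linear_combination hz

/-- Only the contour conditions of the three R-operators are assumed. The identity from the region
of small parameters is continued along a complex line on which these conditions cut out a convex
open set. -/
theorem wordR_braid (hτ : 0 < τ.im) (hη : 0 < η.im) {U : Fin 6 → ℂ}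
    (h12 : ContourCond τ η (U 0) (U 1) (U 2) (U 3)) (h13 : ContourCond τ η (U 0) (U 1) (U 4) (U 5))
    (h23 : ContourCond τ η (U 2) (U 3) (U 4) (U 5)) {g : (Fin 3 → ℝ) → ℂ} (hg : Continuous g) :
    wordR τ η (U 0) (U 1) (U 2) (U 3) 1 2 (wordR τ η (U 0) (U 1) (U 4) (U 5) 0 1
        (wordR τ η (U 2) (U 3) (U 4) (U 5) 1 2 g)) =
      wordR τ η (U 2) (U 3) (U 4) (U 5) 0 1 (wordR τ η (U 0) (U 1) (U 4) (U 5) 1 2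
        (wordR τ η (U 0) (U 1) (U 2) (U 3) 0 1 g)) := by
  -- The common normalising factors are set aside before the continuation: Γ(2x) may vanish on the
  -- way, so their holomorphy is not available.
  suffices h : wordK τ η (U 0) (U 1) (U 2) (U 3) 1 2 (wordK τ η (U 0) (U 1) (U 4) (U 5) 0 1
        (wordK τ η (U 2) (U 3) (U 4) (U 5) 1 2 g)) =
      wordK τ η (U 2) (U 3) (U 4) (U 5) 0 1 (wordK τ η (U 0) (U 1) (U 4) (U 5) 1 2
        (wordK τ η (U 0) (U 1) (U 2) (U 3) 0 1 g)) by
    simp only [wordR_eq, wordK_const_mul, h]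
    funext z
    ring
  funext z
  have hT : 0 < ((τ + 2 * η) / 2).im := by
    have := two_mul_im_pos hη
    rw [← mul_one_div, mul_comm, show (1 / 2 : ℂ) = ((1 / 2 : ℝ) : ℂ) by norm_num, im_ofReal_mul,
      add_im]
    linarith
  set T := ((τ + 2 * η) / 2).im with hTdef
  -- The base point has equally spaced imaginary parts with total spread 5T/6 < T, so it lies in the
  -- region of small parameters.
  let B : Fin 6 → ℂ := fun k => ((k : ℝ) * (T / 6) : ℝ) * I
  have hB : ∀ k : Fin 6, (B k).im = k * (T / 6) := fun k => by simp [B]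
  have hBcond : ∀ a b c d : Fin 6, a < c → b < d → ContourCond τ η (B a) (B b) (B c) (B d) := by
    intro a b c d hac hbd
    have h1 : ((a : ℕ) : ℝ) < c := by exact_mod_cast hac
    have h2 : ((b : ℕ) : ℝ) < d := by exact_mod_cast hbd
    have h3 : ((c : ℕ) : ℝ) ≤ 5 := by exact_mod_cast Nat.le_of_lt_succ c.2
    have h4 : ((d : ℕ) : ℝ) ≤ 5 := by exact_mod_cast Nat.le_of_lt_succ d.2
    have h5 : (0 : ℝ) ≤ (a : ℕ) := Nat.cast_nonneg _
    have h6 : (0 : ℝ) ≤ (b : ℕ) := Nat.cast_nonneg _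
    constructor <;> simp only [sub_im, hB, ← hTdef] <;> nlinarith
  let L : Fin 6 → ℂ → ℂ := fun k => linePoint (U k) (B k)
  have hL : ∀ (k : Fin 6) (W : Set ℂ), DifferentiableOn ℂ (L k) W := fun k W =>
    (differentiable_linePoint _ _).differentiableOn
  have hL0 : ∀ k, L k 0 = U k := fun k => linePoint_zero _ _
  have hL1 : ∀ k, L k 1 = B k := fun k => linePoint_one _ _
  let C : Fin 6 → Fin 6 → Fin 6 → Fin 6 → Set ℂ := fun a b c d =>
    {s | ContourCond τ η (L a s) (L b s) (L c s) (L d s)}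
  have hCo : ∀ a b c d, IsOpen (C a b c d) := fun _ _ _ _ =>
    isOpen_contourCond_linePoint _ _ _ _ _ _ _ _
  have hCc : ∀ a b c d, Convex ℝ (C a b c d) := fun _ _ _ _ =>
    convex_contourCond_linePoint _ _ _ _ _ _ _ _
  let W : Set ℂ := C 0 1 2 3 ∩ C 0 1 4 5 ∩ C 2 3 4 5
  have hW : IsOpen W := ((hCo _ _ _ _).inter (hCo _ _ _ _)).inter (hCo _ _ _ _)
  have hWc : Convex ℝ W := ((hCc _ _ _ _).inter (hCc _ _ _ _)).inter (hCc _ _ _ _)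
  have h0W : (0 : ℂ) ∈ W := by
    refine ⟨⟨?_, ?_⟩, ?_⟩ <;> simpa only [C, Set.mem_ofPred_eq, hL0]
  have h1W : (1 : ℂ) ∈ W := by
    refine ⟨⟨?_, ?_⟩, ?_⟩ <;> simp only [C, Set.mem_ofPred_eq, hL1] <;>
      exact hBcond _ _ _ _ (by decide) (by decide)
  have hF : IsHolFamily W fun _ => g := ⟨(hg.comp continuous_snd).continuousOn,
    fun z => differentiableOn_const _⟩
  have hl := ((hF.wordK hτ hη hW (hL 2 _) (hL 3 _) (hL 4 _) (hL 5 _) (fun s hs => hs.2) 1 2).wordK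
    hτ hη hW (hL 0 _) (hL 1 _) (hL 4 _) (hL 5 _) (fun s hs => hs.1.2) 0 1).wordK
    hτ hη hW (hL 0 _) (hL 1 _) (hL 2 _) (hL 3 _) (fun s hs => hs.1.1) 1 2
  have hr := ((hF.wordK hτ hη hW (hL 0 _) (hL 1 _) (hL 2 _) (hL 3 _) (fun s hs => hs.1.1) 0 1).wordK
    hτ hη hW (hL 0 _) (hL 1 _) (hL 4 _) (hL 5 _) (fun s hs => hs.1.2) 1 2).wordK
    hτ hη hW (hL 2 _) (hL 3 _) (hL 4 _) (hL 5 _) (fun s hs => hs.2) 0 1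
  have hLim : ∀ k, Continuous fun s => (L k s).im := fun k =>
    continuous_im.comp (differentiable_linePoint _ _).continuous
  -- The defining inequalities of the small region are open, so they persist for s near 1.
  have hev : ∀ᶠ s in 𝓝 (1 : ℂ), StrictMono (fun k => (L k s).im) ∧
      (L 5 s - L 0 s).im < ((τ + 2 * η) / 2).im := by
    refine Filter.Eventually.and ?_ ?_
    · have h1 : ∀ a b : Fin 6, ∀ᶠ s in 𝓝 (1 : ℂ), a < b → (L a s).im < (L b s).im := by
        intro a b
        by_cases hab : a < b
        · have h2 : (L a 1).im < (L b 1).im := by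
            have h3 : ((a : ℕ) : ℝ) < b := by exact_mod_cast hab
            rw [hL1, hL1, hB, hB]
            nlinarith
          filter_upwards [(isOpen_lt (hLim a) (hLim b)).mem_nhds h2] with s hs _ using hs
        · exact Filter.Eventually.of_forall fun s h => absurd h hab
      filter_upwards [eventually_all.2 fun a => eventually_all.2 (h1 a)] with s hs a b hab
      exact hs a b hab
    · have h1 : Continuous fun s => (L 5 s - L 0 s).im := by
        simp only [sub_im]
        exact (hLim 5).sub (hLim 0)
      refine (isOpen_lt h1 continuous_const).mem_nhds ?_
      rw [Set.mem_ofPred_eq, hL1, hL1, sub_im, hB, hB, ← hTdef]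
      norm_num
      linarith
  have := ((hl.2 z).analyticOnNhd hW).eqOn_of_preconnected_of_eventuallyEq
    ((hr.2 z).analyticOnNhd hW) hWc.isPreconnected h1W ?_ h0W
  · simpa only [hL0] using this
  · filter_upwards [hev] with s hs
    exact congrFun (wordK_braid_of_small hτ hη (U := fun k => L k s) hs.1 hs.2 hg) z

end

end EllipticYB

namespace EllipticYB

noncomputable section

open Complex Filter Topology

variable {τ η : ℂ} {n : ℕ}

/-! ### The operators with gauge factors -/

/-- Multiplication by the gauge factor `e^{-πi(z_1² + ⋯ + z_n²)/η}`. -/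
def gaugeLift (η : ℂ) (g : (Fin n → ℝ) → ℂ) : (Fin n → ℝ) → ℂ :=
  fun z => exp (-(Real.pi * I * (∑ k, (z k : ℂ) ^ 2) / η)) * g z

/-- The function `f(e^{2πi z_1}, …, e^{2πi z_n})`. -/
def torusLift (f : (Fin n → ℂ) → ℂ) : (Fin n → ℝ) → ℂ := fun z => f fun k => ee (z k)

theorem gauge_eq (f : (Fin n → ℂ) → ℂ) : gauge η f = gaugeLift η (torusLift f) := rfl

theorem continuous_torusLift {f : (Fin n → ℂ) → ℂ} (hf : ContinuousOn f (torus n)) :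
    Continuous (torusLift f) := by
  refine hf.comp_continuous ?_ fun z k => norm_ee_ofReal _
  exact continuous_pi fun k => continuous_ee.comp (continuous_ofReal.comp (continuous_apply k))

theorem sum_update_sq (z : Fin n → ℝ) (i : Fin n) (y : ℝ) :
    ∑ k, (Function.update z i y k : ℂ) ^ 2 = ∑ k, (z k : ℂ) ^ 2 - (z i : ℂ) ^ 2 + (y : ℂ) ^ 2 := by
  rw [← Finset.add_sum_erase _ _ (Finset.mem_univ i),
    ← Finset.add_sum_erase _ (fun k => (z k : ℂ) ^ 2) (Finset.mem_univ i), Function.update_self,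
    Finset.sum_congr rfl fun k hk => by
      rw [Function.update_of_ne (Finset.ne_of_mem_erase hk)]]
  ring

/-- The two exponentials around M exchange the Gaussian in the integration variable for the one in
z_i. Moreover dx/x = 2πi dy turns the prefactor 1/(4πi) into 1/2. -/
theorem opM_gaugeLift (hτ : 0 < τ.im) (hη : 0 < η.im) (x : ℂ) (i : Fin n)
    (g : (Fin n → ℝ) → ℂ) :
    opM τ η (ee x) i (gaugeLift η g) = gaugeLift η (normOp τ η x i g) := by
  funext z
  have hG : ∀ y : ℝ, exp (-(Real.pi * I * (z i : ℂ) ^ 2 / η)) *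
      (exp (Real.pi * I * (y : ℂ) ^ 2 / η) *
      exp (-(Real.pi * I * (∑ k, (Function.update z i y k : ℂ) ^ 2) / η))) =
      exp (-(Real.pi * I * (∑ k, (z k : ℂ) ^ 2) / η)) := by
    intro y
    rw [← exp_add, ← exp_add, sum_update_sq]
    congr 1
    ring
  have h1 : ∀ y : ℝ, gammaPM (pp τ) (qq η) (ee x) (ee (z i)) (ee y) /
        (ellGamma (pp τ) (qq η) (ee x ^ 2) * gammaSq (pp τ) (qq η) (ee y)) *
        (exp (Real.pi * I * (y : ℂ) ^ 2 / η) * gaugeLift η g (Function.update z i y)) *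
        (2 * Real.pi * I) =
      (2 * Real.pi * I) * (logGamma τ η (2 * x))⁻¹ * (exp (Real.pi * I * (y : ℂ) ^ 2 / η) *
      exp (-(Real.pi * I * (∑ k, (Function.update z i y k : ℂ) ^ 2) / η))) *
        (gammaQuad τ η x (z i) y * betaWeight τ η y * g (Function.update z i y)) := by
    intro y
    rw [gammaPM_ee, ← ee_two_mul, gaugeLift, betaWeight_ofReal hτ hη, logGamma, div_eq_mul_inv,
      mul_inv]
    ring
  have h2 : (Real.pi : ℂ) * I ≠ 0 := mul_ne_zero (ofReal_ne_zero.2 Real.pi_ne_zero) I_ne_zero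
  rw [opM, baileyM, gaugeLift, normOp, kernelOp, mul_left_comm, ← mul_assoc,
    ← intervalIntegral.integral_const_mul, ← intervalIntegral.integral_const_mul,
    ← intervalIntegral.integral_const_mul, ← intervalIntegral.integral_const_mul]
  refine intervalIntegral.integral_congr fun y _ => ?_
  simp only [h1]
  rw [← hG y]
  field_simp
  ring

theorem baileyD_ee (x a b : ℂ) :
    baileyD τ η (ee x) (ee a) (ee b) = gammaQuad τ η ((τ + 2 * η) / 2 - x) a b := by
  rw [baileyD, sqrtpq_eq, ← ee_neg, ← ee_add, gammaPM_ee, sub_eq_add_neg]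

theorem S₂_gaugeLift (i j : Fin n) (U : Fin 4 → ℂ) (g : (Fin n → ℝ) → ℂ) :
    S₂ τ η i j U (gaugeLift η g) = gaugeLift η (multOp τ η (U 2 - U 1) i j g) := by
  funext z
  rw [S₂, baileyD_ee, gaugeLift, gaugeLift, multOp]
  ring

theorem S₁_gaugeLift (hτ : 0 < τ.im) (hη : 0 < η.im) (i : Fin n) (U : Fin 4 → ℂ)
    (g : (Fin n → ℝ) → ℂ) :
    S₁ τ η i U (gaugeLift η g) = gaugeLift η (normOp τ η (U 1 - U 0) i g) :=
  opM_gaugeLift hτ hη _ _ _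

theorem S₃_gaugeLift (hτ : 0 < τ.im) (hη : 0 < η.im) (i : Fin n) (U : Fin 4 → ℂ)
    (g : (Fin n → ℝ) → ℂ) :
    S₃ τ η i U (gaugeLift η g) = gaugeLift η (normOp τ η (U 3 - U 2) i g) :=
  opM_gaugeLift hτ hη _ _ _

theorem opP_gaugeLift (i j : Fin n) (g : (Fin n → ℝ) → ℂ) :
    opP i j (gaugeLift η g) = gaugeLift η (opP i j g) := by
  funext z
  rw [opP, gaugeLift, gaugeLift, opP, Equiv.sum_comp (Equiv.swap i j) fun k => (z k : ℂ) ^ 2]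

theorem bbR_gaugeLift (hτ : 0 < τ.im) (hη : 0 < η.im) (i j : Fin n) (U : Fin 4 → ℂ)
    (g : (Fin n → ℝ) → ℂ) :
    bbR τ η i j U (gaugeLift η g) =
      gaugeLift η (opP i j (wordR τ η (U 0) (U 1) (U 2) (U 3) i j g)) := by
  rw [bbR, opR, S₂_gaugeLift, S₃_gaugeLift hτ hη, S₁_gaugeLift hτ hη, S₂_gaugeLift, opP_gaugeLift]
  rfl

/-! ### Permutation operators -/

theorem update_comp_swap (z : Fin n → ℝ) (i k l : Fin n) (y : ℝ) :
    (fun m => Function.update z i y (Equiv.swap k l m)) =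
      Function.update (fun m => z (Equiv.swap k l m)) (Equiv.swap k l i) y := by
  have := Function.update_comp_equiv z (Equiv.swap k l) i y
  rwa [Equiv.symm_swap] at this

theorem swap_apply_swap_apply (k l i : Fin n) : Equiv.swap k l (Equiv.swap k l i) = i := by
  rw [← Equiv.Perm.mul_apply, Equiv.swap_mul_self, Equiv.Perm.one_apply]

theorem normOp_opP (x : ℂ) (i k l : Fin n) (g : (Fin n → ℝ) → ℂ) :
    normOp τ η x i (opP k l g) = opP k l (normOp τ η x (Equiv.swap k l i) g) := by
  funext z
  simp only [normOp, kernelOp, opP, update_comp_swap, swap_apply_swap_apply]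

theorem multOp_opP (x : ℂ) (i j k l : Fin n) (g : (Fin n → ℝ) → ℂ) :
    multOp τ η x i j (opP k l g) =
      opP k l (multOp τ η x (Equiv.swap k l i) (Equiv.swap k l j) g) := by
  funext z
  simp only [multOp, opP, swap_apply_swap_apply]

theorem wordR_opP (a b c d : ℂ) (i j k l : Fin n) (g : (Fin n → ℝ) → ℂ) :
    wordR τ η a b c d i j (opP k l g) =
      opP k l (wordR τ η a b c d (Equiv.swap k l i) (Equiv.swap k l j) g) := by
  simp only [wordR, multOp_opP, normOp_opP]

theorem opP_braid (g : (Fin 3 → ℝ) → ℂ) :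
    opP 0 1 (opP 0 2 (opP 1 2 g)) = opP 1 2 (opP 0 2 (opP 0 1 g)) := by
  have h : ∀ k : Fin 3, Equiv.swap 0 1 (Equiv.swap 0 2 (Equiv.swap 1 2 k)) =
      Equiv.swap 1 2 (Equiv.swap 0 2 (Equiv.swap 0 1 k)) := by decide
  funext z
  simp only [opP, h]

/-! ### The Yang-Baxter equation -/

theorem norm_sqrtpq_lt_iff (x : ℂ) :
    ‖sqrtpq τ η‖ < ‖ee x‖ ↔ 0 < ((τ + 2 * η) / 2 - x).im := by
  rw [sqrtpq_eq, norm_ee_lt_norm_ee, sub_im, sub_pos]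

theorem Admissible.contourCond {U : Fin 4 → ℂ} (h : Admissible τ η U) :
    ContourCond τ η (U 0) (U 1) (U 2) (U 3) :=
  ⟨norm_ee_lt_one.1 h.norm_M₁, norm_ee_lt_one.1 h.norm_M₂, (norm_sqrtpq_lt_iff _).1 h.norm_D₁,
    (norm_sqrtpq_lt_iff _).1 h.norm_D₂⟩

/-- Moving the permutations to the left relabels the sites, so that the factors at (0,1), (0,2),
(1,2) become words at adjacent sites in the pattern of `wordR_braid`. The permutations themselves
satisfy the braid relation. -/
theorem bbR_braid (hτ : 0 < τ.im) (hη : 0 < η.im) {U : Fin 6 → ℂ}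
    (h12 : ContourCond τ η (U 0) (U 1) (U 2) (U 3)) (h13 : ContourCond τ η (U 0) (U 1) (U 4) (U 5))
    (h23 : ContourCond τ η (U 2) (U 3) (U 4) (U 5)) {g : (Fin 3 → ℝ) → ℂ} (hg : Continuous g) :
    bbR τ η 0 1 ![U 0, U 1, U 2, U 3] (bbR τ η 0 2 ![U 0, U 1, U 4, U 5]
        (bbR τ η 1 2 ![U 2, U 3, U 4, U 5] (gaugeLift η g))) =
      bbR τ η 1 2 ![U 2, U 3, U 4, U 5] (bbR τ η 0 2 ![U 0, U 1, U 4, U 5]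
        (bbR τ η 0 1 ![U 0, U 1, U 2, U 3] (gaugeLift η g))) := by
  simp only [bbR_gaugeLift hτ hη, Matrix.cons_val]
  have e1 : Equiv.swap (1 : Fin 3) 2 0 = 0 := by decide
  have e2 : Equiv.swap (0 : Fin 3) 2 1 = 1 := by decide
  have e3 : Equiv.swap (0 : Fin 3) 1 2 = 2 := by decide
  simp only [wordR_opP, Equiv.swap_apply_left, Equiv.swap_apply_right, e1, e2, e3, opP_braid,
    wordR_braid hτ hη h12 h13 h23 hg]

end

end EllipticYB

namespace EllipticYB

noncomputable section

open Complex Filter Topology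

variable {τ η : ℂ} {n : ℕ}

/-! ### Functions on the torus -/

theorem ee_arg_div {x : ℂ} (hx : ‖x‖ = 1) : ee ((arg x / (2 * Real.pi) : ℝ) : ℂ) = x := by
  have h := norm_mul_exp_arg_mul_I x
  rw [hx, ofReal_one, one_mul] at h
  rw [ee]
  convert h using 2
  have : (Real.pi : ℂ) ≠ 0 := ofReal_ne_zero.2 Real.pi_ne_zero
  push_cast
  field_simp

theorem exists_ee_eq_of_mem_torus {X : Fin n → ℂ} (hX : X ∈ torus n) :
    ∃ z : Fin n → ℝ, X = fun k => ee (z k) :=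
  ⟨fun k => arg (X k) / (2 * Real.pi), funext fun k => (ee_arg_div (hX k)).symm⟩

/-- Near each point of the torus, `arg` of the quotient by that point gives a continuous local
section Z of the covering by the variables z. -/
theorem continuousOn_torus_of_lift {F : (Fin n → ℂ) → ℂ} (hF : Continuous (torusLift F)) :
    ContinuousOn F (torus n) := by
  intro X₀ hX₀
  obtain ⟨z₀, rfl⟩ := exists_ee_eq_of_mem_torus hX₀
  let Z : (Fin n → ℂ) → Fin n → ℝ := fun X k => z₀ k + arg (X k / ee (z₀ k)) / (2 * Real.pi)
  have hZ : ContinuousAt Z fun k => ee (z₀ k) := by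
    refine continuousAt_pi.2 fun k => continuousAt_const.add (ContinuousAt.div_const ?_ _)
    refine ContinuousAt.comp (g := arg) (f := fun X : Fin n → ℂ => X k / ee (z₀ k)) ?_ ?_
    · refine continuousAt_arg ?_
      rw [div_self (ee_ne_zero _)]
      exact one_mem_slitPlane
    · exact (continuousAt_apply k _).div_const _
  have h : ∀ X ∈ torus n, torusLift F (Z X) = F X := fun X hX => by
    rw [torusLift]
    congr 1
    funext k
    have h1 : ‖X k / ee (z₀ k)‖ = 1 := by rw [norm_div, hX k, hX₀ k, div_one]
    have h2 := ee_arg_div h1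
    change ee ((z₀ k + arg (X k / ee (z₀ k)) / (2 * Real.pi) : ℝ) : ℂ) = X k
    rw [ofReal_add, ee_add, h2, mul_div_cancel₀ _ (ee_ne_zero _)]
  exact ((hF.continuousAt.comp hZ).continuousWithinAt).congr (fun X hX => (h X hX).symm)
    (h _ hX₀).symm

theorem circleIntegral_eq_integral_ee (g : ℂ → ℂ) :
    (∮ x in C(0, 1), g x) = ∫ y in (0 : ℝ)..1, 2 * Real.pi * I * ee y * g (ee y) := by
  have h : ∀ y : ℝ, circleMap 0 1 (2 * Real.pi * y) = ee y := fun y => by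
    rw [circleMap, ee, ofReal_one, one_mul, zero_add]
    congr 1
    push_cast
    ring
  have h2 := intervalIntegral.integral_comp_mul_left (a := 0) (b := 1)
    (fun θ => deriv (circleMap 0 1) θ • g (circleMap 0 1 θ)) (c := 2 * Real.pi) (by positivity)
  rw [mul_zero, mul_one, eq_inv_smul_iff₀ (by positivity), ← intervalIntegral.integral_smul] at h2
  rw [circleIntegral, ← h2]
  refine intervalIntegral.integral_congr fun y _ => ?_
  simp only [deriv_circleMap, h, smul_eq_mul, real_smul]
  push_cast
  ring

theorem torusIntegrable_of_continuous {F : (Fin 2 → ℂ) → ℂ} {G : ℝ → ℝ → ℂ}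
    (hG : Continuous fun t : ℝ × ℝ => G t.1 t.2)
    (h : ∀ (w : Fin 2 → ℂ) (x y : ℝ), w 0 = ee x → w 1 = ee y → F w = G x y) :
    TorusIntegrable F 0 1 := by
  have h1 : (fun θ : Fin 2 → ℝ => F (torusMap 0 1 θ)) =
      fun θ => G (θ 0 / (2 * Real.pi)) (θ 1 / (2 * Real.pi)) := by
    have h2 : ∀ (θ : Fin 2 → ℝ) k, torusMap 0 1 θ k = ee ((θ k / (2 * Real.pi) : ℝ) : ℂ) := by
      intro θ k
      have : (Real.pi : ℂ) ≠ 0 := ofReal_ne_zero.2 Real.pi_ne_zero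
      rw [torusMap, ee, Pi.zero_apply, Pi.one_apply, ofReal_one, one_mul, zero_add]
      congr 1
      push_cast
      field_simp
    exact funext fun θ => h _ _ _ (h2 θ 0) (h2 θ 1)
  rw [TorusIntegrable, h1]
  have h2 : Continuous fun θ : Fin 2 → ℝ => (θ 0 / (2 * Real.pi), θ 1 / (2 * Real.pi)) := by
    fun_prop
  exact (hG.comp h2).continuousOn.integrableOn_compact isCompact_Icc

theorem torusIntegral_eq_integral_integral {F : (Fin 2 → ℂ) → ℂ} {G : ℝ → ℝ → ℂ}
    (hG : Continuous fun t : ℝ × ℝ => G t.1 t.2)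
    (h : ∀ (w : Fin 2 → ℂ) (x y : ℝ), w 0 = ee x → w 1 = ee y → F w = G x y) :
    (∯ w in T((0 : Fin 2 → ℂ), (1 : Fin 2 → ℝ)), F w) =
      ∫ x in (0 : ℝ)..1, 2 * Real.pi * I * ee x *
        ∫ y in (0 : ℝ)..1, 2 * Real.pi * I * ee y * G x y := by
  rw [torusIntegral_succ (torusIntegrable_of_continuous hG h)]
  change (∮ x in C(0, 1), _) = _
  rw [circleIntegral_eq_integral_ee]
  refine intervalIntegral.integral_congr fun x _ => ?_
  rw [torusIntegral_dim1]
  change _ * (∮ y in C(0, 1), _) = _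
  rw [circleIntegral_eq_integral_ee]
  congr 1
  refine intervalIntegral.integral_congr fun y _ => ?_
  rw [h _ x y rfl rfl]

/-! ### The explicit form of the `R`-operator -/

/-- The integrand of the double integral operator in logarithmic variables. -/
def logIntegrand (τ η : ℂ) (i j : Fin n) (U : Fin 4 → ℂ) (g : (Fin n → ℝ) → ℂ) (z : Fin n → ℝ)
    (x y : ℝ) : ℂ :=
  wordNorm τ η (U 0) (U 1) (U 2) (U 3) *
    (gammaQuad τ η (U 2 - U 0) (z j) x * betaWeight τ η x *
      (gammaQuad τ η (U 3 - U 1) (z i) y * betaWeight τ η y *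
        (gammaQuad τ η ((τ + 2 * η) / 2 - (U 2 - U 1)) x y *
          g (Function.update (Function.update z i x) j y))))

theorem ellIntegrand_eq (hτ : 0 < τ.im) (hη : 0 < η.im) (i j : Fin n) (U : Fin 4 → ℂ)
    (f : (Fin n → ℂ) → ℂ) (z : Fin n → ℝ) (w : Fin 2 → ℂ) (x y : ℝ) (hx : w 0 = ee x)
    (hy : w 1 = ee y) :
    ellIntegrand τ η i j U f (fun k => ee (z k)) w =
      logIntegrand τ η i j U (torusLift f) z x y / (ee x * ee y) := by
  have h1 : Function.update (Function.update (fun k => ee (z k)) i (w 0)) j (w 1) =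
      fun k => ee (Function.update (Function.update z i x) j y k) := by
    have h := Function.comp_update (fun t : ℝ => ee t) (Function.update z i x) j y
    have h' := Function.comp_update (fun t : ℝ => ee t) z i x
    rw [h'] at h
    rw [hx, hy]
    exact h.symm
  have h2 : sqrtpq τ η * ee (U 1 - U 2) = ee ((τ + 2 * η) / 2 - (U 2 - U 1)) := by
    rw [sqrtpq_eq, ← ee_add]
    congr 1
    ring
  rw [ellIntegrand, h1, h2, hx, hy, gammaPM_ee, gammaPM_ee, gammaPM_ee, logIntegrand, wordNorm,
    betaWeight_ofReal hτ hη, betaWeight_ofReal hτ hη, torusLift, logGamma, logGamma]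
  simp only [div_eq_mul_inv, mul_inv]
  ring

theorem continuous_logIntegrand (hτ : 0 < τ.im) (hη : 0 < η.im) {U : Fin 4 → ℂ}
    (hU : ContourCond τ η (U 0) (U 1) (U 2) (U 3)) (i j : Fin n) {g : (Fin n → ℝ) → ℂ}
    (hg : Continuous g) (z : Fin n → ℝ) :
    Continuous fun t : ℝ × ℝ => logIntegrand τ η i j U g z t.1 t.2 := by
  have hQ : ∀ {x : ℂ} (a b : ℝ × ℝ → ℝ), 0 < x.im → Continuous a → Continuous b →
      Continuous fun t : ℝ × ℝ => gammaQuad τ η x (a t) (b t) := fun a b hx ha hb =>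
    continuousOn_univ.1 (continuousOn_gammaQuad hτ hη continuousOn_const
      ha.continuousOn hb.continuousOn fun _ _ => hx)
  have hw := continuous_betaWeight hτ hη
  have h1 := hQ (fun _ => z j) Prod.fst hU.left continuous_const continuous_fst
  have h2 := hQ (fun _ => z i) Prod.snd hU.right continuous_const continuous_snd
  have h3 := hQ Prod.fst Prod.snd hU.inner continuous_fst continuous_snd
  have h4 : Continuous fun t : ℝ × ℝ => betaWeight τ η t.1 := hw.comp continuous_fst
  have h5 : Continuous fun t : ℝ × ℝ => betaWeight τ η t.2 := hw.comp continuous_snd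
  have h6 : Continuous fun t : ℝ × ℝ => Function.update (Function.update z i t.1) j t.2 := by
    fun_prop
  have h7 : Continuous fun t : ℝ × ℝ => g (Function.update (Function.update z i t.1) j t.2) :=
    hg.comp h6
  exact continuous_const.mul ((h1.mul h4).mul ((h2.mul h5).mul (h3.mul h7)))

theorem continuous_logIntegrand_div (hτ : 0 < τ.im) (hη : 0 < η.im) {U : Fin 4 → ℂ}
    (hU : ContourCond τ η (U 0) (U 1) (U 2) (U 3)) (i j : Fin n) {g : (Fin n → ℝ) → ℂ}
    (hg : Continuous g) (z : Fin n → ℝ) :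
    Continuous fun t : ℝ × ℝ => logIntegrand τ η i j U g z t.1 t.2 / (ee t.1 * ee t.2) := by
  have hc := continuous_ee
  exact (continuous_logIntegrand hτ hη hU i j hg z).div (by fun_prop) fun t =>
    mul_ne_zero (ee_ne_zero _) (ee_ne_zero _)

theorem torusIntegrable_ellIntegrand (hτ : 0 < τ.im) (hη : 0 < η.im) {U : Fin 4 → ℂ}
    (hU : ContourCond τ η (U 0) (U 1) (U 2) (U 3)) (i j : Fin n) {f : (Fin n → ℂ) → ℂ}
    (hf : ContinuousOn f (torus n)) {X : Fin n → ℂ} (hX : X ∈ torus n) :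
    TorusIntegrable (ellIntegrand τ η i j U f X) 0 1 := by
  obtain ⟨z, rfl⟩ := exists_ee_eq_of_mem_torus hX
  exact torusIntegrable_of_continuous
    (continuous_logIntegrand_div hτ hη hU i j (continuous_torusLift hf) z)
    fun w x y => ellIntegrand_eq hτ hη i j U f z w x y

/-- The two kernel operators integrate over different variables and the outer multiplication does
not involve these, so the word collapses to one double integral, and ℙ exchanges the outer
variables. The factor (2πi)² from the two differentials turns 1/(4πi)² into the two prefactors 1/2.
-/
theorem torusLift_ellR (hτ : 0 < τ.im) (hη : 0 < η.im) {U : Fin 4 → ℂ}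
    (hU : ContourCond τ η (U 0) (U 1) (U 2) (U 3)) {i j : Fin n} (hij : i ≠ j)
    {f : (Fin n → ℂ) → ℂ} (hf : ContinuousOn f (torus n)) :
    torusLift (ellR τ η i j U f) =
      opP i j (wordR τ η (U 0) (U 1) (U 2) (U 3) i j (torusLift f)) := by
  funext z
  -- Both exchanged variables are overwritten, so the exchange disappears from the argument of f.
  have h0 : ∀ x y : ℝ, Function.update (Function.update (fun k => z (Equiv.swap i j k)) i x) j y =
      Function.update (Function.update z i x) j y := by
    intro x y
    funext k
    rcases eq_or_ne k j with rfl | hj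
    · rw [Function.update_self, Function.update_self]
    rcases eq_or_ne k i with rfl | hi
    · rw [Function.update_of_ne hj, Function.update_of_ne hj, Function.update_self,
        Function.update_self]
    · rw [Function.update_of_ne hj, Function.update_of_ne hj, Function.update_of_ne hi,
        Function.update_of_ne hi, Equiv.swap_apply_of_ne_of_ne hi hj]
  have h1 : sqrtpq τ η * ee (U 0 - U 3) = ee ((τ + 2 * η) / 2 - (U 3 - U 0)) := by
    rw [sqrtpq_eq, ← ee_add]
    congr 1
    ring
  have hpi : (Real.pi : ℂ) ≠ 0 := ofReal_ne_zero.2 Real.pi_ne_zero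
  rw [torusLift, ellR, torusIntegral_eq_integral_integral
    (continuous_logIntegrand_div hτ hη hU i j (continuous_torusLift hf) z)
    fun w x y => ellIntegrand_eq hτ hη i j U f z w x y]
  rw [opP, wordR_eq]
  simp only [wordK, multOp, kernelOp, Equiv.swap_apply_left, Equiv.swap_apply_right,
    Function.update_self, Function.update_of_ne hij, Function.update_of_ne hij.symm, h0]
  rw [h1, gammaPM_ee, gammaQuad_comm _ (z i : ℂ)]
  have h2 : ∀ x : ℝ, 2 * Real.pi * I * ee x * (∫ y in (0 : ℝ)..1, 2 * Real.pi * I * ee y *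
      (logIntegrand τ η i j U (torusLift f) z x y / (ee x * ee y))) =
      (2 * Real.pi * I) ^ 2 * ∫ y in (0 : ℝ)..1, logIntegrand τ η i j U (torusLift f) z x y := by
    intro x
    rw [← intervalIntegral.integral_const_mul, ← intervalIntegral.integral_const_mul]
    refine intervalIntegral.integral_congr fun y _ => ?_
    have hx := ee_ne_zero (x : ℂ)
    have hy := ee_ne_zero (y : ℂ)
    field_simp
  simp only [h2]
  simp only [logIntegrand, intervalIntegral.integral_const_mul,
    mul_left_comm _ (qPoch (pp τ) (pp τ) * qPoch (qq η) (qq η) / 2)]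
  field_simp
  ring

theorem bbR_gauge (hτ : 0 < τ.im) (hη : 0 < η.im) {U : Fin 4 → ℂ}
    (hU : ContourCond τ η (U 0) (U 1) (U 2) (U 3)) {i j : Fin n} (hij : i ≠ j)
    {f : (Fin n → ℂ) → ℂ} (hf : ContinuousOn f (torus n)) :
    bbR τ η i j U (gauge η f) = gauge η (ellR τ η i j U f) := by
  rw [gauge_eq, bbR_gaugeLift hτ hη, gauge_eq, torusLift_ellR hτ hη hU hij hf]

theorem continuousOn_ellR (hτ : 0 < τ.im) (hη : 0 < η.im) {U : Fin 4 → ℂ}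
    (hU : ContourCond τ η (U 0) (U 1) (U 2) (U 3)) {i j : Fin n} (hij : i ≠ j)
    {f : (Fin n → ℂ) → ℂ} (hf : ContinuousOn f (torus n)) :
    ContinuousOn (ellR τ η i j U f) (torus n) := by
  refine continuousOn_torus_of_lift ?_
  rw [torusLift_ellR hτ hη hU hij hf]
  exact (continuous_wordR hτ hη hU i j (continuous_torusLift hf)).comp
    (continuous_pi fun k => continuous_apply _)

theorem eqOn_torus_of_gauge_eq {f g : (Fin n → ℂ) → ℂ} (h : gauge η f = gauge η g) {X : Fin n → ℂ}
    (hX : X ∈ torus n) : f X = g X := by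
  obtain ⟨z, rfl⟩ := exists_ee_eq_of_mem_torus hX
  exact mul_left_cancel₀ (exp_ne_zero _) (congrFun h z)

end

end EllipticYB

/-! ### The Yang-Baxter equation, the explicit form and the Coxeter relations -/

theorem theorem4 (τ η : ℂ) (hτ : 0 < τ.im) (hη : 0 < η.im) :
    -- the Yang-Baxter equation
    (∀ ℓ₁ ℓ₂ ℓ₃ u v : ℂ,
      EllipticYB.Admissible τ η (EllipticYB.params η ℓ₁ ℓ₂ (u - v) 0) →
      EllipticYB.Admissible τ η (EllipticYB.params η ℓ₁ ℓ₃ u 0) →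
      EllipticYB.Admissible τ η (EllipticYB.params η ℓ₂ ℓ₃ v 0) →
      (∀ Φ ∈ EllipticYB.space η 3,
        EllipticYB.bbRspec τ η ℓ₁ ℓ₂ (0 : Fin 3) 1 (u - v)
          (EllipticYB.bbRspec τ η ℓ₁ ℓ₃ 0 2 u (EllipticYB.bbRspec τ η ℓ₂ ℓ₃ 1 2 v Φ)) =
        EllipticYB.bbRspec τ η ℓ₂ ℓ₃ 1 2 v
          (EllipticYB.bbRspec τ η ℓ₁ ℓ₃ 0 2 u
            (EllipticYB.bbRspec τ η ℓ₁ ℓ₂ 0 1 (u - v) Φ))) ∧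
      (∀ f : (Fin 3 → ℂ) → ℂ, ContinuousOn f (EllipticYB.torus 3) →
        ∀ X ∈ EllipticYB.torus 3,
          EllipticYB.ellR τ η (0 : Fin 3) 1 (EllipticYB.params η ℓ₁ ℓ₂ (u - v) 0)
            (EllipticYB.ellR τ η 0 2 (EllipticYB.params η ℓ₁ ℓ₃ u 0)
              (EllipticYB.ellR τ η 1 2 (EllipticYB.params η ℓ₂ ℓ₃ v 0) f)) X =
          EllipticYB.ellR τ η 1 2 (EllipticYB.params η ℓ₂ ℓ₃ v 0)
            (EllipticYB.ellR τ η 0 2 (EllipticYB.params η ℓ₁ ℓ₃ u 0)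
              (EllipticYB.ellR τ η 0 1 (EllipticYB.params η ℓ₁ ℓ₂ (u - v) 0) f)) X)) ∧
    -- the operators are well defined, and they are given by the explicit double integral
    (∀ (n : ℕ) (i j : Fin n), i ≠ j → ∀ U : Fin 4 → ℂ, EllipticYB.Admissible τ η U →
      ∀ f : (Fin n → ℂ) → ℂ, ContinuousOn f (EllipticYB.torus n) →
        (∀ X ∈ EllipticYB.torus n,
          TorusIntegrable (EllipticYB.ellIntegrand τ η i j U f X) 0 1) ∧
        ContinuousOn (EllipticYB.ellR τ η i j U f) (EllipticYB.torus n) ∧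
        EllipticYB.bbR τ η i j U (EllipticYB.gauge η f) =
          EllipticYB.gauge η (EllipticYB.ellR τ η i j U f)) ∧
    -- the cubic Coxeter relations
    (∀ U : Fin 4 → ℂ, ∀ Φ ∈ EllipticYB.space η 2,
      (‖EllipticYB.ee (U 1 - U 0)‖ < 1 → ‖EllipticYB.ee (U 2 - U 1)‖ < 1 →
        ‖EllipticYB.sqrtpq τ η‖ < ‖EllipticYB.ee (U 2 - U 0)‖ →
        EllipticYB.S₁ τ η 0 (EllipticYB.s₂ (EllipticYB.s₁ U))
            (EllipticYB.S₂ τ η 0 1 (EllipticYB.s₁ U) (EllipticYB.S₁ τ η 0 U Φ)) =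
          EllipticYB.S₂ τ η 0 1 (EllipticYB.s₁ (EllipticYB.s₂ U))
            (EllipticYB.S₁ τ η 0 (EllipticYB.s₂ U) (EllipticYB.S₂ τ η 0 1 U Φ))) ∧
      (‖EllipticYB.ee (U 2 - U 1)‖ < 1 → ‖EllipticYB.ee (U 3 - U 2)‖ < 1 →
        ‖EllipticYB.sqrtpq τ η‖ < ‖EllipticYB.ee (U 3 - U 1)‖ →
        EllipticYB.S₂ τ η 0 1 (EllipticYB.s₃ (EllipticYB.s₂ U))
            (EllipticYB.S₃ τ η 1 (EllipticYB.s₂ U) (EllipticYB.S₂ τ η 0 1 U Φ)) =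
          EllipticYB.S₃ τ η 1 (EllipticYB.s₂ (EllipticYB.s₃ U))
            (EllipticYB.S₂ τ η 0 1 (EllipticYB.s₃ U) (EllipticYB.S₃ τ η 1 U Φ)))) := by
  refine ⟨fun ℓ₁ ℓ₂ ℓ₃ u v h12 h13 h23 => ?_, fun n i j hij U hU f hf => ?_, fun U Φ hΦ => ?_⟩
  · have h12 := h12.contourCond
    have h13 := h13.contourCond
    have h23 := h23.contourCond
    have hbb : ∀ Φ ∈ EllipticYB.space η 3,
        EllipticYB.bbRspec τ η ℓ₁ ℓ₂ (0 : Fin 3) 1 (u - v)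
          (EllipticYB.bbRspec τ η ℓ₁ ℓ₃ 0 2 u (EllipticYB.bbRspec τ η ℓ₂ ℓ₃ 1 2 v Φ)) =
        EllipticYB.bbRspec τ η ℓ₂ ℓ₃ 1 2 v
          (EllipticYB.bbRspec τ η ℓ₁ ℓ₃ 0 2 u
            (EllipticYB.bbRspec τ η ℓ₁ ℓ₂ 0 1 (u - v) Φ)) := by
      rintro Φ ⟨f, hf, rfl⟩
      -- Only differences of spectral parameters matter, so the sites 1, 2, 3 can be given the
      -- spectral parameters u, v, 0. This yields the six strand labels common to the three
      -- operators.
      simp only [← EllipticYB.bbR_params, EllipticYB.gauge_eq]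
      exact EllipticYB.bbR_braid hτ hη
        (U := ![u / 2 + η * (ℓ₁ + 1 / 2), u / 2 - η * (ℓ₁ + 1 / 2),
          v / 2 + η * (ℓ₂ + 1 / 2), v / 2 - η * (ℓ₂ + 1 / 2),
          0 / 2 + η * (ℓ₃ + 1 / 2), 0 / 2 - η * (ℓ₃ + 1 / 2)])
        (by
          constructor
          · convert h12.left using 2; simp [EllipticYB.params]; ring
          · convert h12.right using 2; simp [EllipticYB.params]; ring
          · convert h12.inner using 2; simp [EllipticYB.params]; ring
          · convert h12.outer using 2; simp [EllipticYB.params]; ring)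
        h13 h23 (EllipticYB.continuous_torusLift hf)
    refine ⟨hbb, fun f hf X hX => EllipticYB.eqOn_torus_of_gauge_eq (η := η) ?_ hX⟩
    have h01 : (0 : Fin 3) ≠ 1 := by decide
    have h02 : (0 : Fin 3) ≠ 2 := by decide
    have h12' : (1 : Fin 3) ≠ 2 := by decide
    have c1 := EllipticYB.continuousOn_ellR hτ hη h23 h12' hf
    have c2 := EllipticYB.continuousOn_ellR hτ hη h13 h02 c1
    have d1 := EllipticYB.continuousOn_ellR hτ hη h12 h01 hf
    have d2 := EllipticYB.continuousOn_ellR hτ hη h13 h02 d1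
    -- Each double integral operator is carried through the injective map f ↦ `gauge η f`. The
    -- continuity of the intermediate functions is what permits the next step.
    rw [← EllipticYB.bbR_gauge hτ hη h12 h01 c2, ← EllipticYB.bbR_gauge hτ hη h13 h02 c1,
      ← EllipticYB.bbR_gauge hτ hη h23 h12' hf, ← EllipticYB.bbR_gauge hτ hη h23 h12' d2,
      ← EllipticYB.bbR_gauge hτ hη h13 h02 d1, ← EllipticYB.bbR_gauge hτ hη h12 h01 hf]
    exact hbb _ ⟨f, hf, rfl⟩
  · have hU := hU.contourCond
    exact ⟨fun X hX => EllipticYB.torusIntegrable_ellIntegrand hτ hη hU i j hf hX,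
      EllipticYB.continuousOn_ellR hτ hη hU hij hf, EllipticYB.bbR_gauge hτ hη hU hij hf⟩
  · obtain ⟨f, hf, rfl⟩ := hΦ
    have hg := EllipticYB.continuous_torusLift hf
    rw [EllipticYB.gauge_eq]
    have hD : ∀ {x : ℂ}, ‖EllipticYB.sqrtpq τ η‖ < ‖EllipticYB.ee x‖ →
        x.im < ((τ + 2 * η) / 2).im := fun hx => by
      have := (EllipticYB.norm_sqrtpq_lt_iff _).1 hx
      rwa [Complex.sub_im, sub_pos] at this
    constructor
    · intro h1 h2 h3
      -- The star-triangle relation in z_1 with x = v_1 - u_2 and y = u_2 - u_1, hence x + y = v_1 -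
      -- u_1.
      have h := EllipticYB.normOp_star_triangle hτ hη (EllipticYB.norm_ee_lt_one.1 h2)
        (EllipticYB.norm_ee_lt_one.1 h1) (by rw [sub_add_sub_cancel]; exact hD h3)
        (show (1 : Fin 2) ≠ 0 by decide) hg
      rw [sub_add_sub_cancel] at h
      simp only [EllipticYB.S₁_gaugeLift hτ hη, EllipticYB.S₂_gaugeLift]
      exact congrArg _ h
    · intro h1 h2 h3
      -- The same relation in z_2, read from right to left, with x = v_1 - u_2 and y = v_2 - v_1; D
      -- is symmetric in its two variables.
      have h := EllipticYB.normOp_star_triangle hτ hη (EllipticYB.norm_ee_lt_one.1 h1)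
        (EllipticYB.norm_ee_lt_one.1 h2)
        (by rw [add_comm, sub_add_sub_cancel]; exact hD h3)
        (show (0 : Fin 2) ≠ 1 by decide) hg
      rw [add_comm, sub_add_sub_cancel] at h
      simp only [EllipticYB.S₃_gaugeLift hτ hη, EllipticYB.S₂_gaugeLift,
        EllipticYB.multOp_symm _ 0 1]
      exact congrArg _ h.symm
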